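/- Let $G=(V,E)$ be a finite simple graph with $V\neq\emptyset$, and let $\mathcal T$ be a rooted tree decomposition of $G$ with root $r$ and bags $B_x\subseteq V$. Let $h$ be the maximum, over all leaves $\ell$ of $\mathcal T$, of the size of the union of the bags on the path from $r$ to $\ell$. A circuit $C$ over $(\mathbb Z[2^V];\oplus',*)$ along $\mathcal T$ is a directed acyclic graph of $|C|$ gates in which every gate sits at a node of $\mathcal T$ and a gate at a node $x$ computes a function $2^{B_x}\to\mathbb Z$; every node of $\mathcal T$ carries at least one gate, and the output gate sits at the root. The operands of a gate at $x$ come from gates at $x$ or at children of $x$. The gates are of the following kinds: (i) constants, which are singletons, i.e. functions that vanish except possibly at one set $A\subseteq B_x$; (ii) relaxed pointwise additions $\oplus'$ of one or two operands, where an operand $g:2^{B_y}\to\mathbb Z$ from a node $y$ contributes, at $X\subseteq B_x$, the value $g[(X\cap B_y)\cup(B_y\setminus B_x)]$ if $X\subseteq B_y$, and, if $X\not\subseteq B_y$, either $0$ or the same expression, as specified for that operand of the gate (so for $B_y=B_x$ this is ordinary pointwise addition); (iii) subset convolutions $(g_1*g_2)[X]=\sum_{X'\subseteq X}g_1[X']\,g_2[X\setminus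 X']$, whose operands sit at nodes with bag $B_x$. The circuit $C$ evaluates $f:2^V\to\mathbb Z$ if its output gate computes $X\mapsto f[X\cup(V\setminus B_r)]$ for $X\subseteq B_r$; in particular $f[V]$ is the output at $B_r$. There is a single algorithm (a program of a random access machine with logarithmic costs and read-only input) which, given $G$, $\mathcal T$, a circuit $C$ along $\mathcal T$ that evaluates a function $f$, and an integer $m\ge 2$ such that $0\le f[V]<m$, computes $f[V]$ in time $O^*((|V|+|E|)\,2^{h})$, where $O^*$ hides a factor polynomial in the bit length of the input, and at the same time in $O(|V|\,|C|\log m)$ bits of work space. The constant of the space bound, the polynomial and the program do not depend on the instance. -/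

import Mathlib

/-! ### A random access machine with bit costs

Registers `R_0, R_1, …` hold natural numbers.  The input is a read-only list of natural numbers
that is accessed through a head; like the input of an off-line machine it is not part of the work
space.  Programs are built from instructions by composition, branching and `while`-loops. -/

namespace RAM

/-- The arithmetic operations; `sub` is truncated subtraction. -/
inductive ArithOp where
  | add | sub | mul | div | mod

/-- The value of an arithmetic operation. -/
def ArithOp.eval : ArithOp → ℕ → ℕ → ℕ
  | .add, a, b => a + b
  | .sub, a, b => a - b
  | .mul, a, b => a * b
  | .div, a, b => a / b
  | .mod, a, b => a % b

/-- Elementary instructions. -/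
inductive Instr where
  /-- `R_i := c` -/
  | set (i c : ℕ)
  /-- `R_i := R_j o R_k` -/
  | arith (o : ArithOp) (i j k : ℕ)
  /-- `R_i := R_{R_j}` -/
  | load (i j : ℕ)
  /-- `R_{R_i} := R_j` -/
  | store (i j : ℕ)
  /-- put the input head at position `R_i` -/
  | seek (i : ℕ)
  /-- move the input head one position to the right -/
  | next
  /-- `R_i :=` the input entry under the head (`0` beyond the end of the input) -/
  | read (i : ℕ)

/-- Programs. -/
inductive Prog where
  | instr (a : Instr)
  | seq (p q : Prog)
  /-- if `R_i ≠ 0` then `p` else `q` -/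
  | ite (i : ℕ) (p q : Prog)
  /-- while `R_i ≠ 0` do `p` -/
  | loop (i : ℕ) (p : Prog)

/-- A configuration: the registers, a bound `top` above all addresses written to so far, and the
position of the input head. -/
structure Store where
  mem : ℕ → ℕ
  top : ℕ
  head : ℕ

/-- The initial configuration. -/
def Store.init : Store := ⟨fun _ => 0, 0, 0⟩

/-- The number of bits in the work memory: every register below `top` is charged for its content
in binary and for one separator. -/
def Store.space (σ : Store) : ℕ := ∑ i ∈ Finset.range σ.top, (1 + Nat.size (σ.mem i))

/-- Writing `v` into register `i`. -/
def Store.write (σ : Store) (i v : ℕ) : Store :=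
  ⟨Function.update σ.mem i v, max σ.top (i + 1), σ.head⟩

/-- The effect of an instruction on input `inp`. -/
def Instr.exec (inp : List ℕ) : Instr → Store → Store
  | .set i c, σ => σ.write i c
  | .arith o i j k, σ => σ.write i (o.eval (σ.mem j) (σ.mem k))
  | .load i j, σ => σ.write i (σ.mem (σ.mem j))
  | .store i j, σ => σ.write (σ.mem i) (σ.mem j)
  | .seek i, σ => ⟨σ.mem, σ.top, σ.mem i⟩
  | .next, σ => ⟨σ.mem, σ.top, σ.head + 1⟩
  | .read i, σ => σ.write i (inp.getD σ.head 0)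

/-- The logarithmic cost of an instruction: one plus the bit lengths of all numbers and addresses
that it handles. -/
def Instr.cost (inp : List ℕ) : Instr → Store → ℕ
  | .set i c, _ => 1 + Nat.size i + Nat.size c
  | .arith o i j k, σ => 1 + Nat.size i + Nat.size j + Nat.size k
      + Nat.size (σ.mem j) + Nat.size (σ.mem k) + Nat.size (o.eval (σ.mem j) (σ.mem k))
  | .load i j, σ => 1 + Nat.size i + Nat.size j + Nat.size (σ.mem j) + Nat.size (σ.mem (σ.mem j))
  | .store i j, σ => 1 + Nat.size i + Nat.size j + Nat.size (σ.mem i) + Nat.size (σ.mem j)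
  | .seek i, σ => 1 + Nat.size i + Nat.size (σ.mem i)
  | .next, _ => 1
  | .read i, σ => 1 + Nat.size i + Nat.size (inp.getD σ.head 0)

/-- `Exec inp p σ t s τ`: on input `inp`, the program `p` started in configuration `σ` halts in
configuration `τ`, after time `t` and with peak work space `s`. -/
inductive Exec (inp : List ℕ) : Prog → Store → ℕ → ℕ → Store → Prop
  | instr (a : Instr) (σ : Store) :
      Exec inp (.instr a) σ (a.cost inp σ) (max σ.space (a.exec inp σ).space) (a.exec inp σ)
  | seq {p q : Prog} {σ τ υ : Store} {t₁ t₂ s₁ s₂ : ℕ} :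
      Exec inp p σ t₁ s₁ τ → Exec inp q τ t₂ s₂ υ →
      Exec inp (.seq p q) σ (t₁ + t₂) (max s₁ s₂) υ
  | ite_true {i : ℕ} {p q : Prog} {σ τ : Store} {t s : ℕ} :
      σ.mem i ≠ 0 → Exec inp p σ t s τ →
      Exec inp (.ite i p q) σ (1 + Nat.size i + Nat.size (σ.mem i) + t) s τ
  | ite_false {i : ℕ} {p q : Prog} {σ τ : Store} {t s : ℕ} :
      σ.mem i = 0 → Exec inp q σ t s τ →
      Exec inp (.ite i p q) σ (1 + Nat.size i + t) s τ
  | loop_true {i : ℕ} {p : Prog} {σ τ υ : Store} {t₁ t₂ s₁ s₂ : ℕ} :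
      σ.mem i ≠ 0 → Exec inp p σ t₁ s₁ τ → Exec inp (.loop i p) τ t₂ s₂ υ →
      Exec inp (.loop i p) σ (1 + Nat.size i + Nat.size (σ.mem i) + t₁ + t₂) (max s₁ s₂) υ
  | loop_false {i : ℕ} {p : Prog} {σ : Store} :
      σ.mem i = 0 → Exec inp (.loop i p) σ (1 + Nat.size i) σ.space σ

/-- The length of an input in bits. -/
def bitLength (inp : List ℕ) : ℕ := (inp.map fun a => 1 + Nat.size a).sum

end RAM

/-! ### Tree decompositions -/

/-- A tree decomposition, with tree nodes `0, …, t - 1`, of a graph with vertices `0, …, n - 1`,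
rooted at one of its nodes. -/
structure TreeDecomp {n : ℕ} (G : SimpleGraph (Fin n)) (t : ℕ) where
  tree : SimpleGraph (Fin t)
  isTree : tree.IsTree
  root : Fin t
  bag : Fin t → Finset (Fin n)
  /-- if `z` lies on the path from `x` to `y` then `B_x ∩ B_y ⊆ B_z` -/
  inter_subset : ∀ (x y z : Fin t) (p : tree.Walk x y), p.IsPath → z ∈ p.support →
    bag x ∩ bag y ⊆ bag z
  edge_mem : ∀ u v : Fin n, G.Adj u v → ∃ x, u ∈ bag x ∧ v ∈ bag x
  vertex_mem : ∀ v : Fin n, ∃ x, v ∈ bag x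

namespace TreeDecomp

variable {n : ℕ} {G : SimpleGraph (Fin n)} {t : ℕ} (T : TreeDecomp G t)

/-- `c` is a child of `x`. -/
def IsChild (c x : Fin t) : Prop :=
  T.tree.Adj x c ∧ T.tree.dist T.root c = T.tree.dist T.root x + 1

/-- A leaf of the rooted tree. -/
def IsLeaf (x : Fin t) : Prop := ∀ c, ¬ T.IsChild c x

open Classical in
/-- The parent of a node; the root is its own parent by convention. -/
noncomputable def parent (c : Fin t) : Fin t :=
  if h : ∃ x, T.IsChild c x then h.choose else c

open Classical in
/-- The union of all bags on the path from the root to `x`. -/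
noncomputable def pathUnion (x : Fin t) : Finset (Fin n) :=
  Finset.univ.filter fun v =>
    ∃ p : T.tree.Walk T.root x, p.IsPath ∧ ∃ z ∈ p.support, v ∈ T.bag z

open Classical in
/-- The maximum size of the union of all bags along a path from the root to a leaf. -/
noncomputable def branchSize : ℕ :=
  (Finset.univ.filter fun x => T.IsLeaf x).sup fun x => (T.pathUnion x).card

end TreeDecomp

/-! ### Circuits over `(ℤ[2^V]; ⊕', ∗)` along a tree decomposition -/

/-- The singleton `f_A` with value `a`: zero except at `A`. -/
def singletonFun {n : ℕ} (A : Finset (Fin n)) (a : ℤ) (X : Finset (Fin n)) : ℤ :=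
  if X = A then a else 0

/-- Subset convolution. -/
def subsetConv {n : ℕ} (f g : Finset (Fin n) → ℤ) (X : Finset (Fin n)) : ℤ :=
  ∑ Y ∈ X.powerset, f Y * g (X \ Y)

/-- An operand `f` of a relaxed addition, given on the subsets of the bag `B`, read on the subsets
`X` of the bag `B'`.  All forgotten vertices (those of `B \ B'`) are added to `X`.  If `X`
contains introduced vertices (those of `B' \ B`), then these are disregarded if `keep` is true,
and the value is zero otherwise.  For `B = B'` the operand is left unchanged. -/
def relaxedRead {n : ℕ} (B B' : Finset (Fin n)) (keep : Bool) (f : Finset (Fin n) → ℤ)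
    (X : Finset (Fin n)) : ℤ :=
  if keep = true ∨ X ⊆ B then f ((X ∩ B) ∪ (B \ B')) else 0

/-- The gates of a circuit with gates `0, …, s - 1`. -/
inductive Gate (n s : ℕ) where
  /-- a constant: the singleton `f_A` with value `a` -/
  | const (A : Finset (Fin n)) (a : ℤ)
  /-- a relaxed pointwise addition with a single operand -/
  | move (kb : Bool) (b : Fin s)
  /-- a relaxed pointwise addition of two operands -/
  | add (kb : Bool) (b : Fin s) (kc : Bool) (c : Fin s)
  /-- a subset convolution -/
  | conv (b c : Fin s)

/-- A circuit with `s` gates along `T`.  Every gate sits at a node `x` of `T` and computes a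
function on the subsets of the bag `B_x`; its operands are earlier gates that sit at `x` or at
children of `x`; the operands of a subset convolution sit at nodes with the same bag. Every node
carries a gate, and the output gate sits at the root. -/
structure Circuit {n : ℕ} {G : SimpleGraph (Fin n)} {t : ℕ} (T : TreeDecomp G t) (s : ℕ) where
  gate : Fin s → Gate n s
  node : Fin s → Fin t
  out : Fin s
  node_surjective : Function.Surjective node
  node_out : node out = T.root
  const_subset : ∀ g A a, gate g = .const A a → A ⊆ T.bag (node g)
  move_wire : ∀ g kb b, gate g = .move kb b →
    b < g ∧ (node b = node g ∨ T.IsChild (node b) (node g))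
  add_wire : ∀ g kb b kc c, gate g = .add kb b kc c →
    (b < g ∧ (node b = node g ∨ T.IsChild (node b) (node g))) ∧
    (c < g ∧ (node c = node g ∨ T.IsChild (node c) (node g)))
  conv_wire : ∀ g b c, gate g = .conv b c →
    (b < g ∧ (node b = node g ∨ T.IsChild (node b) (node g)) ∧
      T.bag (node b) = T.bag (node g)) ∧
    (c < g ∧ (node c = node g ∨ T.IsChild (node c) (node g)) ∧
      T.bag (node c) = T.bag (node g))

namespace Circuit

variable {n : ℕ} {G : SimpleGraph (Fin n)} {t : ℕ} {T : TreeDecomp G t} {s : ℕ}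

/-- The function computed by gate `g`; it is meaningful on the subsets of the bag of the node of
`g`.  The tests `b < g` always succeed. -/
def value (C : Circuit T s) (g : Fin s) : Finset (Fin n) → ℤ :=
  match C.gate g with
  | .const A a => singletonFun A a
  | .move kb b =>
      if _hb : b < g then
        relaxedRead (T.bag (C.node b)) (T.bag (C.node g)) kb (C.value b)
      else 0
  | .add kb b kc c =>
      if _hb : b < g then
        if _hc : c < g then
          relaxedRead (T.bag (C.node b)) (T.bag (C.node g)) kb (C.value b) +
            relaxedRead (T.bag (C.node c)) (T.bag (C.node g)) kc (C.value c)
        else 0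
      else 0
  | .conv b c =>
      if _hb : b < g then
        if _hc : c < g then subsetConv (C.value b) (C.value c) else 0
      else 0
termination_by g

/-- `f` is evaluated by `C`: with `r` the root, the output `f_r[X]` for `X ⊆ B_r` is the value of
`f` at the union of `X` and the vertices that are not in `B_r`. -/
def Evaluates (C : Circuit T s) (f : Finset (Fin n) → ℤ) : Prop :=
  ∀ X ⊆ T.bag T.root, f (X ∪ (T.bag T.root)ᶜ) = C.value C.out X

end Circuit

/-! ### The encoding of an instance as an input -/

/-- A subset of `{0, …, n - 1}` as a row of `n` bits. -/
def encodeSet {n : ℕ} (A : Finset (Fin n)) : List ℕ :=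
  List.ofFn fun v => if v ∈ A then 1 else 0

/-- The adjacency matrix of a graph, row by row. -/
noncomputable def encodeGraph {n : ℕ} (G : SimpleGraph (Fin n)) : List ℕ :=
  (List.ofFn fun u => encodeSet (G.neighborSet u).toFinite.toFinset).flatten

/-- The parents of the nodes, followed by the bags. -/
noncomputable def encodeTree {n : ℕ} {G : SimpleGraph (Fin n)} {t : ℕ} (T : TreeDecomp G t) :
    List ℕ :=
  (List.ofFn fun x => (T.parent x : ℕ)) ++ (List.ofFn fun x => encodeSet (T.bag x)).flatten

/-- A gate without the value of a constant: `5 + n` entries. -/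
def Gate.encode {n s : ℕ} : Gate n s → List ℕ
  | .const A _ => [0, 0, 0, 0, 0] ++ encodeSet A
  | .move kb b => [1, kb.toNat, (b : ℕ), 0, 0] ++ encodeSet (∅ : Finset (Fin n))
  | .add kb b kc c => [2, kb.toNat, (b : ℕ), kc.toNat, (c : ℕ)] ++ encodeSet (∅ : Finset (Fin n))
  | .conv b c => [3, 0, (b : ℕ), 0, (c : ℕ)] ++ encodeSet (∅ : Finset (Fin n))

/-- The value of a constant gate (zero for other gates). -/
def Gate.coeff {n s : ℕ} : Gate n s → ℤ
  | .const _ a => a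
  | _ => 0

/-- An integer: its sign, its binary digits (least significant first), and an end marker. -/
def encodeInt (a : ℤ) : List ℕ :=
  (if a < 0 then 1 else 0) :: (Nat.digits 2 a.natAbs ++ [2])

/-- The gates of a circuit with their nodes, followed by the values of the constants. -/
def encodeCircuit {n : ℕ} {G : SimpleGraph (Fin n)} {t : ℕ} {T : TreeDecomp G t} {s : ℕ}
    (C : Circuit T s) : List ℕ :=
  (List.ofFn fun g => (C.node g : ℕ) :: (C.gate g).encode).flatten ++
    (List.ofFn fun g => encodeInt (C.gate g).coeff).flatten

/-- An instance: a graph, a tree decomposition, a circuit and the bound `m`. -/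
noncomputable def encodeInstance {n : ℕ} (G : SimpleGraph (Fin n)) {t : ℕ} (T : TreeDecomp G t)
    {s : ℕ} (C : Circuit T s) (m : ℕ) : List ℕ :=
  [n, t, s, m, (T.root : ℕ), (C.out : ℕ)] ++ encodeGraph G ++ encodeTree T ++ encodeCircuit C

/-!
The functions computed by the gates are not stored: a gate at node `x` would need `2 ^ |B_x|`
numbers.  Instead, they are transformed so that all operations become pointwise, and the transforms
are computed for one argument at a time.

*Ranked lifts.* A function `f` on the subsets of a bag is represented by power series over `ℤ/m`
that begin with the monomial `f X • X ^ |X|` (`IsRankedLift`).  In this representation a subset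
convolution may be replaced by a union product, because sets that overlap contribute in higher
degrees only (`isRankedLift_unionProd`), and the zeta transform turns union products into products
of power series (`zeta_unionProd`).  A relaxed addition multiplies or divides by powers of `X`
(`rankedRead`), and its zeta transform at a set `Y` also depends on the zeta transform of the
operand at `Y` only, provided that no vertex is forgotten (`zeta_rankedRead`).

*Forgotten vertices.*  On the way from a node to its parent, the vertices in `D = forgotten x` have
to be fixed as present.  Möbius inversion over the subsets of `D` alone does this: the series
`passed` to the parent is an alternating sum of zeta transforms at the sets `Y ∪ Z`, `Z ⊆ D`
(`sum_sign_lower_zeta`).  At the root all vertices of the bag are forgotten, which leaves the value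
`f V` (`coeff_passed_root`).

*Traversal.*  The tree is traversed recursively with a current set `Y`.  At a node, a binary counter
runs through the subsets of the forgotten vertices; for each of them the children are processed, the
gates are evaluated, and the results are added to one accumulator per gate.  A node is thus visited
once per subset of the union of the bags above it and its own, at most `2 ^ h` times (`cost_rec`,
`reach_final`).  The recursion needs no stack, since the parents are part of the input, the counter
is part of `Y`, and a child determines its successor.

*Space and time.*  The memory holds `Y` and, for every gate, two power series truncated at degree
`n`, with coefficients modulo `m`; `0 ≤ f V < m` makes the result modulo `m` sufficient.  The
constants of the circuit may be so long that even the position of a digit does not fit into the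
work space.  They are reduced modulo `m` digit by digit while the input head moves over them.

The random access machine is programmed by means of expressions and commands over variables and a
matrix, with the correctness predicate `WP`, which includes the bounds on time and space; a
lemma `wp_foo` states the effect of the command `foo`.  The lemma `wp_round` says that the body of
the main loop performs a step of the traversal, and `exec_evaluator` puts the parts together.
-/

/-! ### Rooted trees and the vertices forgotten at a node -/

namespace TreeDecomp

variable {n : ℕ} {G : SimpleGraph (Fin n)} {t : ℕ} (T : TreeDecomp G t)

theorem not_mem_support_of_isChild {c x : Fin t} (h : T.IsChild c x)
    {p : T.tree.Walk T.root x} (hp : p.IsPath) : c ∉ p.support := by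
  classical
  intro hc
  obtain ⟨q, hq, hql⟩ := T.isTree.connected.exists_path_of_dist T.root x
  obtain ⟨r, -, hr⟩ := T.isTree.existsUnique_path T.root x
  have hpq : p = q := (hr p hp).trans (hr q hq).symm
  have h1 := SimpleGraph.dist_le (p.takeUntil c hc)
  have h2 := p.length_takeUntil_le_length hc
  have h3 := h.2
  have h4 : p.length = T.tree.dist T.root x := hpq ▸ hql
  omega

theorem isChild_unique {c x y : Fin t} (hx : T.IsChild c x) (hy : T.IsChild c y) : x = y := by
  obtain ⟨p, hp, -⟩ := T.isTree.connected.exists_path_of_dist T.root x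
  obtain ⟨q, hq, -⟩ := T.isTree.connected.exists_path_of_dist T.root y
  have hp' := hp.concat (T.not_mem_support_of_isChild hx hp) hx.1
  have hq' := hq.concat (T.not_mem_support_of_isChild hy hq) hy.1
  obtain ⟨r, -, hr⟩ := T.isTree.existsUnique_path T.root c
  exact (SimpleGraph.Walk.concat_inj ((hr _ hp').trans (hr _ hq').symm)).1

theorem exists_isChild {c : Fin t} (hc : c ≠ T.root) : ∃ x, T.IsChild c x := by
  obtain ⟨p, hp, hl⟩ := T.isTree.connected.exists_path_of_dist T.root c
  cases p using SimpleGraph.Walk.concatRec with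
  | Hnil => exact absurd rfl hc
  | Hconcat q h _ =>
    rename_i v _
    refine ⟨v, h, ?_⟩
    have h1 := SimpleGraph.dist_le q
    have h2 : T.tree.dist T.root c ≤ T.tree.dist T.root v + 1 := by
      obtain ⟨q', -, hq'⟩ := T.isTree.connected.exists_path_of_dist T.root v
      have := SimpleGraph.dist_le (q'.concat h)
      rw [SimpleGraph.Walk.length_concat] at this
      omega
    rw [SimpleGraph.Walk.length_concat] at hl
    omega

theorem not_isChild_root (x : Fin t) : ¬ T.IsChild T.root x := by
  intro h
  have := h.2
  simp at this

theorem isChild_parent {c : Fin t} (hc : c ≠ T.root) : T.IsChild c (T.parent c) := by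
  have h := T.exists_isChild hc
  rw [parent, dif_pos h]
  exact h.choose_spec

theorem parent_root : T.parent T.root = T.root := by
  rw [parent, dif_neg]
  rintro ⟨x, hx⟩
  exact T.not_isChild_root x hx

theorem isChild_iff {c x : Fin t} : T.IsChild c x ↔ c ≠ T.root ∧ T.parent c = x := by
  constructor
  · intro h
    have hc : c ≠ T.root := by
      rintro rfl
      exact T.not_isChild_root x h
    exact ⟨hc, T.isChild_unique (T.isChild_parent hc) h⟩
  · rintro ⟨hc, rfl⟩
    exact T.isChild_parent hc

/-- The distance of a node from the root. -/
noncomputable def depth (x : Fin t) : ℕ := T.tree.dist T.root x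

theorem depth_parent (x : Fin t) : T.depth (T.parent x) = T.depth x - 1 := by
  by_cases h : x = T.root
  · subst h
    rw [T.parent_root]
    simp [depth]
  · have := (T.isChild_parent h).2
    simp only [depth]
    omega

theorem depth_iterate (i : ℕ) (x : Fin t) : T.depth (T.parent^[i] x) = T.depth x - i := by
  induction i with
  | zero => simp
  | succ i ih => rw [Function.iterate_succ_apply', depth_parent, ih]; omega

open Classical in
/-- The descendants of a node, the node included. -/
noncomputable def desc (x : Fin t) : Finset (Fin t) :=
  Finset.univ.filter fun z => ∃ i, T.parent^[i] z = x

theorem self_mem_desc (x : Fin t) : x ∈ T.desc x := by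
  simp only [desc, Finset.mem_filter, Finset.mem_univ, true_and]
  exact ⟨0, rfl⟩

theorem desc_subset {c x : Fin t} (h : T.IsChild c x) : T.desc c ⊆ T.desc x := by
  intro z
  simp only [desc, Finset.mem_filter, Finset.mem_univ, true_and]
  rintro ⟨i, hi⟩
  exact ⟨i + 1, by rw [Function.iterate_succ_apply', hi, (T.isChild_iff.1 h).2]⟩

theorem not_mem_desc_child {c x : Fin t} (h : T.IsChild c x) : x ∉ T.desc c := by
  simp only [desc, Finset.mem_filter, Finset.mem_univ, true_and, not_exists]
  intro i hi
  have h1 := T.depth_iterate i x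
  have h2 : T.depth c = T.depth x + 1 := h.2
  rw [hi] at h1
  omega

theorem disjoint_desc {c d x : Fin t} (hc : T.IsChild c x) (hd : T.IsChild d x) (hcd : c ≠ d) :
    Disjoint (T.desc c) (T.desc d) := by
  rw [Finset.disjoint_left]
  intro z
  simp only [desc, Finset.mem_filter, Finset.mem_univ, true_and]
  rintro ⟨i, hi⟩ ⟨j, hj⟩
  have h1 := T.depth_iterate i z
  have h2 := T.depth_iterate j z
  have h3 : T.depth c = T.depth x + 1 := hc.2
  have h4 : T.depth d = T.depth x + 1 := hd.2
  rw [hi] at h1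
  rw [hj] at h2
  have : i = j := by omega
  subst this
  exact hcd (hi.symm.trans hj)

theorem desc_child_ssubset {c x : Fin t} (h : T.IsChild c x) : T.desc c ⊂ T.desc x :=
  (Finset.ssubset_iff_of_subset (T.desc_subset h)).2
    ⟨x, T.self_mem_desc x, T.not_mem_desc_child h⟩

open Classical in
/-- The children of a node. -/
noncomputable def children (x : Fin t) : Finset (Fin t) :=
  Finset.univ.filter fun c => T.IsChild c x

theorem mem_children {c x : Fin t} : c ∈ T.children x ↔ T.IsChild c x := by
  simp [children]

theorem card_desc_children (x : Fin t) :
    1 + ∑ c ∈ T.children x, (T.desc c).card ≤ (T.desc x).card := by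
  classical
  rw [← Finset.card_biUnion]
  · have hx : x ∉ (T.children x).biUnion T.desc := by
      simp only [Finset.mem_biUnion, not_exists, not_and, mem_children]
      exact fun c hc => T.not_mem_desc_child hc
    rw [add_comm, ← Finset.card_insert_of_notMem hx]
    apply Finset.card_le_card
    intro z hz
    rcases Finset.mem_insert.1 hz with rfl | hz
    · exact T.self_mem_desc z
    · obtain ⟨c, hc, hz⟩ := Finset.mem_biUnion.1 hz
      exact T.desc_subset (T.mem_children.1 hc) hz
  · intro c hc d hd hcd
    exact T.disjoint_desc (T.mem_children.1 hc) (T.mem_children.1 hd) hcd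

theorem bag_subset_pathUnion (x : Fin t) : T.bag x ⊆ T.pathUnion x := by
  intro v hv
  obtain ⟨p, hp, -⟩ := T.isTree.connected.exists_path_of_dist T.root x
  simp only [pathUnion, Finset.mem_filter, Finset.mem_univ, true_and]
  exact ⟨p, hp, x, p.end_mem_support, hv⟩

theorem pathUnion_subset_child {c x : Fin t} (h : T.IsChild c x) :
    T.pathUnion x ⊆ T.pathUnion c := by
  intro v
  simp only [pathUnion, Finset.mem_filter, Finset.mem_univ, true_and]
  rintro ⟨p, hp, z, hz, hv⟩
  refine ⟨p.concat h.1, hp.concat (T.not_mem_support_of_isChild h hp) h.1, z, ?_, hv⟩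
  rw [SimpleGraph.Walk.support_concat]
  simp [hz]

/-- A vertex of `B_c` that occurs in a bag above `c` already belongs to the bag of the parent. -/
theorem bag_inter_pathUnion {c x : Fin t} (h : T.IsChild c x) :
    T.bag c ∩ T.pathUnion x ⊆ T.bag x := by
  classical
  intro v hv
  rw [Finset.mem_inter] at hv
  obtain ⟨hvc, hv⟩ := hv
  simp only [pathUnion, Finset.mem_filter, Finset.mem_univ, true_and] at hv
  obtain ⟨p, hp, z, hz, hvz⟩ := hv
  have hc := T.not_mem_support_of_isChild h hp
  have hq : ((p.dropUntil z hz).concat h.1).IsPath :=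
    (hp.dropUntil hz).concat (fun h' => hc (p.support_dropUntil_subset_support hz h')) h.1
  refine T.inter_subset z c x _ hq ?_ (Finset.mem_inter.2 ⟨hvz, hvc⟩)
  rw [SimpleGraph.Walk.support_concat]
  simp

/-- The maximum over the leaves bounds the unions at all nodes, since every node lies above a
leaf: a deepest node among those with a larger union has no children. -/
theorem card_pathUnion_le (x : Fin t) : (T.pathUnion x).card ≤ T.branchSize := by
  classical
  obtain ⟨z, hz, hmax⟩ := Finset.exists_max_image
    (Finset.univ.filter fun z => T.pathUnion x ⊆ T.pathUnion z) T.depth ⟨x, by simp⟩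
  simp only [Finset.mem_filter, Finset.mem_univ, true_and] at hz hmax
  refine (Finset.card_le_card hz).trans ?_
  refine Finset.le_sup (f := fun x => (T.pathUnion x).card) ?_
  simp only [Finset.mem_filter, Finset.mem_univ, true_and]
  intro c hc
  have h1 := hmax c (hz.trans (T.pathUnion_subset_child hc))
  have h2 : T.depth c = T.depth z + 1 := hc.2
  omega

open Classical in
/-- The vertices of `B_x` that are forgotten on the way to the parent of `x`; at the root, these
are all vertices of the bag.  Along a path from the root the sets `forgotten x` are disjoint. -/
noncomputable def forgotten (x : Fin t) : Finset (Fin n) :=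
  if x = T.root then T.bag x else T.bag x \ T.bag (T.parent x)

open Classical in
/-- The union of the bags of all proper ancestors of `x`. -/
noncomputable def above (x : Fin t) : Finset (Fin n) :=
  if x = T.root then ∅ else T.pathUnion (T.parent x)

theorem above_child {c x : Fin t} (h : T.IsChild c x) : T.above c = T.pathUnion x := by
  obtain ⟨hc, rfl⟩ := T.isChild_iff.1 h
  rw [above, if_neg hc]

theorem forgotten_child {c x : Fin t} (h : T.IsChild c x) :
    T.forgotten c = T.bag c \ T.bag x := by
  obtain ⟨hc, rfl⟩ := T.isChild_iff.1 h
  rw [forgotten, if_neg hc]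

theorem above_root : T.above T.root = ∅ := by rw [above, if_pos rfl]

theorem forgotten_root : T.forgotten T.root = T.bag T.root := by rw [forgotten, if_pos rfl]

theorem forgotten_subset_bag (x : Fin t) : T.forgotten x ⊆ T.bag x := by
  rw [forgotten]
  split_ifs
  · exact subset_rfl
  · exact Finset.sdiff_subset

theorem disjoint_forgotten_above (x : Fin t) : Disjoint (T.forgotten x) (T.above x) := by
  by_cases hx : x = T.root
  · subst hx
    rw [above_root]
    exact Finset.disjoint_empty_right _
  · have h := T.isChild_parent hx
    rw [T.above_child h, T.forgotten_child h, Finset.disjoint_left]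
    intro v hv hv'
    rw [Finset.mem_sdiff] at hv
    exact hv.2 (T.bag_inter_pathUnion h (Finset.mem_inter.2 ⟨hv.1, hv'⟩))

theorem above_subset (x : Fin t) : T.above x ⊆ T.pathUnion x := by
  by_cases hx : x = T.root
  · subst hx
    rw [above_root]
    exact Finset.empty_subset _
  · have h := T.isChild_parent hx
    rw [T.above_child h]
    exact T.pathUnion_subset_child h

theorem forgotten_subset_pathUnion (x : Fin t) : T.forgotten x ⊆ T.pathUnion x :=
  (T.forgotten_subset_bag x).trans (T.bag_subset_pathUnion x)

theorem card_above_add_card_forgotten (x : Fin t) :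
    (T.above x).card + (T.forgotten x).card ≤ (T.pathUnion x).card := by
  rw [add_comm, ← Finset.card_union_of_disjoint (T.disjoint_forgotten_above x)]
  exact Finset.card_le_card (Finset.union_subset (T.forgotten_subset_pathUnion x)
    (T.above_subset x))

end TreeDecomp

/-! ### Ranked lifts, and their zeta transforms -/

section RankedLift

open PowerSeries

/-- The zeta transform of a set function. -/
def zeta {V M : Type*} [AddCommMonoid M] (F : Finset V → M) (Y : Finset V) : M :=
  ∑ X ∈ Y.powerset, F X

theorem zeta_add {V M : Type*} [AddCommMonoid M] (F H : Finset V → M) (Y : Finset V) :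
    zeta (fun X => F X + H X) Y = zeta F Y + zeta H Y := Finset.sum_add_distrib

variable {V : Type*} [DecidableEq V] {R : Type*} [CommRing R]

/-- The union product of two set functions; the zeta transform turns it into a pointwise
product. -/
def unionProd {M : Type*} [CommSemiring M] (F H : Finset V → M) (X : Finset V) : M :=
  ∑ p ∈ (X.powerset ×ˢ X.powerset).filter (fun p => p.1 ∪ p.2 = X), F p.1 * H p.2

theorem zeta_unionProd {M : Type*} [CommSemiring M] (F H : Finset V → M) (Y : Finset V) :
    zeta (unionProd F H) Y = zeta F Y * zeta H Y := by
  have hmaps : ∀ p ∈ Y.powerset ×ˢ Y.powerset, p.1 ∪ p.2 ∈ Y.powerset := by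
    intro p hp
    simp only [Finset.mem_product, Finset.mem_powerset] at hp ⊢
    exact Finset.union_subset hp.1 hp.2
  rw [zeta, zeta, zeta, Finset.sum_mul_sum, ← Finset.sum_product',
    ← Finset.sum_fiberwise_of_maps_to hmaps]
  refine Finset.sum_congr rfl fun X hX => ?_
  rw [unionProd]
  refine Finset.sum_congr ?_ fun _ _ => rfl
  ext p
  simp only [Finset.mem_filter, Finset.mem_product, Finset.mem_powerset] at hX ⊢
  constructor
  · rintro ⟨⟨h1, h2⟩, h3⟩
    exact ⟨⟨h1.trans hX, h2.trans hX⟩, h3⟩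
  · rintro ⟨-, rfl⟩
    exact ⟨⟨Finset.subset_union_left, Finset.subset_union_right⟩, rfl⟩

/-- Möbius inversion over the subsets of `D` only. -/
theorem sum_sign_zeta {M : Type*} [AddCommGroup M] (F : Finset V → M) {Y D : Finset V}
    (h : Disjoint Y D) :
    ∑ Z ∈ D.powerset, (-1 : ℤ) ^ (D \ Z).card • zeta F (Y ∪ Z) =
      ∑ X ∈ Y.powerset, F (X ∪ D) := by
  induction D using Finset.induction_on generalizing F with
  | empty => simp [zeta]
  | insert a D ha ih =>
    have hY : a ∉ Y := fun h' => (Finset.disjoint_left.1 h h') (Finset.mem_insert_self a D)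
    have hYD : Disjoint Y D := h.mono_right (Finset.subset_insert a D)
    rw [Finset.sum_powerset_insert ha, ← Finset.sum_add_distrib]
    have key : ∀ Z ∈ D.powerset,
        (-1 : ℤ) ^ (insert a D \ Z).card • zeta F (Y ∪ Z) +
          (-1 : ℤ) ^ (insert a D \ insert a Z).card • zeta F (Y ∪ insert a Z) =
        (-1 : ℤ) ^ (D \ Z).card • zeta (fun X => F (insert a X)) (Y ∪ Z) := by
      intro Z hZ
      rw [Finset.mem_powerset] at hZ
      have haZ : a ∉ Z := fun h' => ha (hZ h')
      have h1 : insert a D \ Z = insert a (D \ Z) := Finset.insert_sdiff_of_notMem _ haZ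
      have h2 : insert a D \ insert a Z = D \ Z := by
        rw [Finset.insert_sdiff_insert, Finset.sdiff_insert_of_notMem ha]
      have h3 : a ∉ D \ Z := fun h' => ha (Finset.mem_sdiff.1 h').1
      have h4 : a ∉ Y ∪ Z := by simp [hY, haZ]
      rw [h1, h2, Finset.card_insert_of_notMem h3, Finset.union_insert, zeta, zeta, zeta,
        Finset.sum_powerset_insert h4, pow_succ]
      simp only [mul_neg, mul_one, neg_smul, smul_add]
      abel
    rw [Finset.sum_congr rfl key, ih _ hYD]
    exact Finset.sum_congr rfl fun X _ => by rw [Finset.union_insert]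

/-- Division of a power series by `X ^ d`, of which the coefficients above the degree `n` of the
dividend are not used. -/
noncomputable def lower (n d : ℕ) : R⟦X⟧ →ₗ[R] R⟦X⟧ where
  toFun p := PowerSeries.mk fun j => if j + d ≤ n then coeff (j + d) p else 0
  map_add' p q := by
    ext j
    simp only [coeff_mk, map_add]
    split_ifs <;> simp
  map_smul' a p := by
    ext j
    simp only [coeff_mk, RingHom.id_apply, coeff_smul]
    split_ifs <;> simp

theorem coeff_lower (n d j : ℕ) (p : R⟦X⟧) :
    coeff j (lower n d p) = if j + d ≤ n then coeff (j + d) p else 0 := by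
  simp [lower]

/-- `F` represents `f` on the subsets of `B`: the power series `F X` begins with the monomial
`f X • X ^ |X|`.  The coefficients of higher degree are arbitrary. -/
def IsRankedLift (B : Finset V) (F : Finset V → R⟦X⟧) (f : Finset V → ℤ) : Prop :=
  ∀ X ⊆ B, (∀ j < X.card, coeff j (F X) = 0) ∧ coeff X.card (F X) = (f X : R)

theorem coeff_mul_of_order {a b : ℕ} {p q : R⟦X⟧} (hp : ∀ j < a, coeff j p = 0)
    (hq : ∀ j < b, coeff j q = 0) :
    (∀ j < a + b, coeff j (p * q) = 0) ∧ coeff (a + b) (p * q) = coeff a p * coeff b q := by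
  obtain ⟨p', rfl⟩ := X_pow_dvd_iff.2 hp
  obtain ⟨q', rfl⟩ := X_pow_dvd_iff.2 hq
  have h : X ^ a * p' * (X ^ b * q') = X ^ (a + b) * (p' * q') := by ring
  constructor
  · intro j hj
    rw [h]
    exact X_pow_dvd_iff.1 (dvd_mul_right _ _) j hj
  · have e1 := coeff_X_pow_mul (p' * q') (a + b) 0
    have e2 := coeff_X_pow_mul p' a 0
    have e3 := coeff_X_pow_mul q' b 0
    rw [zero_add] at e1 e2 e3
    rw [h, e1, e2, e3]
    simp

/-- The union product of ranked lifts represents the subset convolution: pairs of sets with union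
`X` that are not disjoint contribute in degrees above `|X|` only. -/
theorem isRankedLift_unionProd {B : Finset V} {F H : Finset V → R⟦X⟧} {f h : Finset V → ℤ}
    (hF : IsRankedLift B F f) (hH : IsRankedLift B H h) (X : Finset V) (hX : X ⊆ B) :
    (∀ j < X.card, coeff j (unionProd F H X) = 0) ∧
      coeff X.card (unionProd F H X) = ((∑ Y ∈ X.powerset, f Y * h (X \ Y) : ℤ) : R) := by
  have hsub : ∀ p ∈ (X.powerset ×ˢ X.powerset).filter (fun p => p.1 ∪ p.2 = X),
      p.1 ⊆ B ∧ p.2 ⊆ B ∧ X.card ≤ p.1.card + p.2.card ∧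
        (X.card = p.1.card + p.2.card ↔ p.2 = X \ p.1) := by
    intro p hp
    simp only [Finset.mem_filter, Finset.mem_product, Finset.mem_powerset] at hp
    obtain ⟨⟨h1, h2⟩, h3⟩ := hp
    have hc := Finset.card_union_add_card_inter p.1 p.2
    rw [h3] at hc
    refine ⟨h1.trans hX, h2.trans hX, by omega, ?_⟩
    constructor
    · intro he
      have hd : p.1 ∩ p.2 = ∅ := Finset.card_eq_zero.1 (by omega)
      rw [← h3, Finset.union_sdiff_left]
      exact (Finset.sdiff_eq_self_of_disjoint
        (Finset.disjoint_iff_inter_eq_empty.2 hd).symm).symm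
    · intro he
      rw [he, Finset.card_sdiff_of_subset h1]
      have := Finset.card_le_card h1
      omega
  constructor
  · intro j hj
    rw [unionProd, map_sum]
    refine Finset.sum_eq_zero fun p hp => ?_
    obtain ⟨h1, h2, h3, -⟩ := hsub p hp
    exact (coeff_mul_of_order (hF _ h1).1 (hH _ h2).1).1 j (by omega)
  · rw [unionProd, map_sum, Int.cast_sum]
    symm
    refine Finset.sum_of_injOn (fun Y => (Y, X \ Y)) ?_ ?_ ?_ ?_
    · intro Y _ Z _ hYZ
      exact (Prod.ext_iff.1 hYZ).1
    · intro Y hY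
      simp only [Finset.coe_filter, Finset.mem_product, Finset.mem_powerset, Set.mem_ofPred_eq,
        Finset.coe_powerset, Set.mem_preimage, Set.mem_powerset_iff, Finset.coe_subset] at hY ⊢
      exact ⟨⟨hY, Finset.sdiff_subset⟩, Finset.union_sdiff_of_subset hY⟩
    · intro p hp hne
      obtain ⟨h1, h2, h3, h4⟩ := hsub p hp
      refine (coeff_mul_of_order (hF _ h1).1 (hH _ h2).1).1 _ ?_
      rcases h3.lt_or_eq with h3 | h3
      · exact h3
      · exfalso
        refine hne ⟨p.1, ?_, Prod.ext rfl (h4.1 h3).symm⟩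
        simp only [Finset.mem_filter, Finset.mem_product, Finset.mem_powerset] at hp
        simpa using hp.1.1
    · intro Y hY
      rw [Finset.mem_powerset] at hY
      have h1 := hF Y (hY.trans hX)
      have h2 := hH (X \ Y) (Finset.sdiff_subset.trans hX)
      have h3 := (coeff_mul_of_order h1.1 h2.1).2
      have h4 : Y.card + (X \ Y).card = X.card := by
        rw [Finset.card_sdiff_of_subset hY]
        have := Finset.card_le_card hY
        omega
      rw [h4, h1.2, h2.2] at h3
      simp only [h3, Int.cast_mul]

end RankedLift

section RelaxedRead

open PowerSeries

variable {n : ℕ} {R : Type*} [CommRing R]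

/-- The counterpart of `relaxedRead` for ranked lifts: forgotten vertices lower the rank, and
introduced vertices raise it. -/
noncomputable def rankedRead (B B' : Finset (Fin n)) (keep : Bool)
    (F : Finset (Fin n) → R⟦X⟧) (Y : Finset (Fin n)) : R⟦X⟧ :=
  if keep = true ∨ Y ⊆ B then
    X ^ (Y \ B).card * lower n (B \ B').card (F ((Y ∩ B) ∪ (B \ B'))) else 0

theorem isRankedLift_rankedRead {B B' : Finset (Fin n)} (keep : Bool)
    {F : Finset (Fin n) → R⟦X⟧} {f : Finset (Fin n) → ℤ} (hF : IsRankedLift B F f) :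
    IsRankedLift B' (rankedRead B B' keep F) (relaxedRead B B' keep f) := by
  intro Y hY
  rw [rankedRead, relaxedRead]
  split_ifs with hk
  · set Z := (Y ∩ B) ∪ (B \ B') with hZ
    have hZB : Z ⊆ B := Finset.union_subset Finset.inter_subset_right Finset.sdiff_subset
    have hdis : Disjoint (Y ∩ B) (B \ B') := by
      rw [Finset.disjoint_left]
      intro v hv hv'
      exact (Finset.mem_sdiff.1 hv').2 (hY (Finset.mem_inter.1 hv).1)
    have hcard : Z.card = (Y ∩ B).card + (B \ B').card := Finset.card_union_of_disjoint hdis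
    have hn : Z.card ≤ n := by simpa using Finset.card_le_univ Z
    have hYc : (Y ∩ B).card + (Y \ B).card = Y.card := Finset.card_inter_add_card_sdiff Y B
    obtain ⟨h1, h2⟩ := hF Z hZB
    have hlow : ∀ j < (Y ∩ B).card, coeff j (lower n (B \ B').card (F Z)) = 0 := by
      intro j hj
      rw [coeff_lower]
      split_ifs
      · exact h1 _ (by omega)
      · rfl
    have htop : coeff (Y ∩ B).card (lower n (B \ B').card (F Z)) = (f Z : R) := by
      rw [coeff_lower, if_pos (by omega), ← hcard, h2]
    constructor
    · intro j hj
      rw [coeff_X_pow_mul']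
      split_ifs
      · exact hlow _ (by omega)
      · rfl
    · rw [← hYc, coeff_X_pow_mul, htop]
  · simp

theorem sum_powerset_union_of_disjoint {V M : Type*} [DecidableEq V] [AddCommMonoid M]
    {A B : Finset V} (h : Disjoint A B) (F : Finset V → M) :
    ∑ Y ∈ (A ∪ B).powerset, F Y = ∑ Y ∈ A.powerset, ∑ Z ∈ B.powerset, F (Y ∪ Z) := by
  rw [← Finset.sum_product']
  refine Finset.sum_bij' (fun Y _ => (Y ∩ A, Y ∩ B)) (fun p _ => p.1 ∪ p.2) ?_ ?_ ?_ ?_ ?_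
  · intro Y _
    simp
  · intro p hp
    simp only [Finset.mem_product, Finset.mem_powerset] at hp ⊢
    exact Finset.union_subset_union hp.1 hp.2
  · intro Y hY
    rw [Finset.mem_powerset] at hY
    rw [← Finset.inter_union_distrib_left]
    exact Finset.inter_eq_left.2 hY
  · intro p hp
    simp only [Finset.mem_product, Finset.mem_powerset] at hp
    have h1 : p.2 ∩ A = ∅ := Finset.disjoint_iff_inter_eq_empty.1 (h.symm.mono_left hp.2)
    have h2 : p.1 ∩ B = ∅ := Finset.disjoint_iff_inter_eq_empty.1 (h.mono_left hp.1)
    ext1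
    · simp [Finset.union_inter_distrib_right, h1, Finset.inter_eq_left.2 hp.1]
    · simp [Finset.union_inter_distrib_right, h2, Finset.inter_eq_left.2 hp.2]
  · intro Y hY
    rw [Finset.mem_powerset] at hY
    rw [← Finset.inter_union_distrib_left, Finset.inter_eq_left.2 hY]

/-- The zeta transform of an operand.  Subsets of the introduced vertices only contribute their
rank, which makes a power of `1 + X`. -/
theorem zeta_rankedRead (B B' : Finset (Fin n)) (keep : Bool) (F : Finset (Fin n) → R⟦X⟧)
    (W : Finset (Fin n)) :
    zeta (rankedRead B B' keep F) W =
      (if keep = true then (1 + X) ^ (W \ B).card else 1) *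
        lower n (B \ B').card (zeta (fun Z => F (Z ∪ (B \ B'))) (W ∩ B)) := by
  have hdis : Disjoint (W ∩ B) (W \ B) := Finset.disjoint_sdiff_inter W B |>.symm
  have hW : W = (W ∩ B) ∪ (W \ B) := by rw [Finset.union_comm, Finset.sdiff_union_inter]
  have hparts : ∀ Y ∈ (W ∩ B).powerset, ∀ Z ∈ (W \ B).powerset,
      (Y ∪ Z) ∩ B = Y ∧ (Y ∪ Z) \ B = Z ∧ Y ⊆ B := by
    intro Y hY Z hZ
    rw [Finset.mem_powerset] at hY hZ
    have hYB : Y ⊆ B := hY.trans Finset.inter_subset_right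
    have hZB : Disjoint Z B := Finset.disjoint_of_subset_left hZ Finset.sdiff_disjoint
    refine ⟨?_, ?_, hYB⟩
    · rw [Finset.union_inter_distrib_right, Finset.inter_eq_left.2 hYB,
        Finset.disjoint_iff_inter_eq_empty.1 hZB, Finset.union_empty]
    · rw [Finset.union_sdiff_distrib, Finset.sdiff_eq_empty_iff_subset.2 hYB,
        Finset.sdiff_eq_self_of_disjoint hZB, Finset.empty_union]
  conv_lhs => rw [zeta, hW, sum_powerset_union_of_disjoint hdis]
  rw [zeta, map_sum, Finset.mul_sum]
  refine Finset.sum_congr rfl fun Y hY => ?_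
  cases keep with
  | true =>
    simp only [if_true]
    rw [add_comm, ← Finset.sum_pow_mul_eq_add_pow, Finset.sum_mul]
    refine Finset.sum_congr rfl fun Z hZ => ?_
    obtain ⟨h1, h2, -⟩ := hparts Y hY Z hZ
    simp [rankedRead, h1, h2]
  | false =>
    rw [Finset.sum_eq_single ∅]
    · obtain ⟨h1, h2, h3⟩ := hparts Y hY ∅ (Finset.empty_mem_powerset _)
      rw [Finset.union_empty] at h1 h2
      simp [rankedRead, h1, h2, h3]
    · intro Z hZ hne
      obtain ⟨h1, h2, h3⟩ := hparts Y hY Z hZ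
      rw [rankedRead, if_neg]
      rintro (h | h)
      · cases h
      · rw [← Finset.sdiff_eq_empty_iff_subset, h2] at h
        exact hne h
    · intro h
      exact absurd (Finset.empty_mem_powerset _) h

end RelaxedRead

namespace Circuit

open PowerSeries

variable {n : ℕ} {G : SimpleGraph (Fin n)} {t : ℕ} {T : TreeDecomp G t} {s : ℕ}

/-- A ranked lift of the function computed by gate `g`, in which subset convolutions are replaced
by union products. -/
noncomputable def lift (C : Circuit T s) (R : Type*) [CommRing R] (g : Fin s) :
    Finset (Fin n) → R⟦X⟧ :=
  match C.gate g with
  | .const A a => fun Y => if Y = A then PowerSeries.C (a : R) * X ^ A.card else 0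
  | .move kb b =>
      if _hb : b < g then
        rankedRead (T.bag (C.node b)) (T.bag (C.node g)) kb (C.lift R b)
      else 0
  | .add kb b kc c =>
      if _hb : b < g then
        if _hc : c < g then fun Y =>
          rankedRead (T.bag (C.node b)) (T.bag (C.node g)) kb (C.lift R b) Y +
            rankedRead (T.bag (C.node c)) (T.bag (C.node g)) kc (C.lift R c) Y
        else 0
      else 0
  | .conv b c =>
      if _hb : b < g then
        if _hc : c < g then
          unionProd
            (rankedRead (T.bag (C.node b)) (T.bag (C.node g)) false (C.lift R b))
            (rankedRead (T.bag (C.node c)) (T.bag (C.node g)) false (C.lift R c))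
        else 0
      else 0
termination_by g

theorem relaxedRead_self {B X : Finset (Fin n)} (f : Finset (Fin n) → ℤ) (hX : X ⊆ B) :
    relaxedRead B B false f X = f X := by
  simp [relaxedRead, hX, Finset.inter_eq_left.2 hX]

theorem isRankedLift_lift (C : Circuit T s) (R : Type*) [CommRing R] (g : Fin s) :
    IsRankedLift (T.bag (C.node g)) (C.lift R g) (C.value g) := by
  induction g using WellFoundedLT.induction with
  | ind g ih =>
    rw [Circuit.lift, Circuit.value]
    split
    next A a hg =>
      intro Y hY
      simp only [singletonFun]
      split_ifs with h
      · subst h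
        constructor
        · intro j hj
          rw [mul_comm, coeff_X_pow_mul', if_neg (by omega)]
        · have := coeff_X_pow_mul (PowerSeries.C (a : R)) Y.card 0
          rw [zero_add] at this
          rw [mul_comm, this]
          simp
      · simp
    next kb b hg =>
      obtain ⟨hb, -⟩ := C.move_wire g kb b hg
      simp only [dif_pos hb]
      exact isRankedLift_rankedRead kb (ih b hb)
    next kb b kc c hg =>
      obtain ⟨⟨hb, -⟩, ⟨hc, -⟩⟩ := C.add_wire g kb b kc c hg
      simp only [dif_pos hb, dif_pos hc]
      intro Y hY
      obtain ⟨h1, h2⟩ := isRankedLift_rankedRead (B' := T.bag (C.node g)) kb (ih b hb) Y hY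
      obtain ⟨h3, h4⟩ := isRankedLift_rankedRead (B' := T.bag (C.node g)) kc (ih c hc) Y hY
      constructor
      · intro j hj
        rw [map_add, h1 j hj, h3 j hj, add_zero]
      · rw [map_add, h2, h4]
        simp
    next b c hg =>
      obtain ⟨⟨hb, -, hbb⟩, ⟨hc, -, hcb⟩⟩ := C.conv_wire g b c hg
      simp only [dif_pos hb, dif_pos hc]
      intro Y hY
      have h1 := isRankedLift_rankedRead (B' := T.bag (C.node g)) false (ih b hb)
      have h2 := isRankedLift_rankedRead (B' := T.bag (C.node g)) false (ih c hc)
      obtain ⟨h3, h4⟩ := isRankedLift_unionProd h1 h2 Y hY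
      refine ⟨h3, h4.trans ?_⟩
      congr 1
      rw [subsetConv]
      refine Finset.sum_congr rfl fun Z hZ => ?_
      rw [Finset.mem_powerset] at hZ
      rw [hbb, hcb, relaxedRead_self _ (hZ.trans hY),
        relaxedRead_self _ (Finset.sdiff_subset.trans hY)]

/-- The information on gate `g` that is passed to the parent of its node: the zeta transform at
`Y`, taken over the vertices that the parent keeps, while the forgotten vertices are all
present. -/
noncomputable def passed (C : Circuit T s) (R : Type*) [CommRing R] (g : Fin s)
    (Y : Finset (Fin n)) : R⟦X⟧ :=
  lower n (T.forgotten (C.node g)).card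
    (zeta (fun Z => C.lift R g (Z ∪ T.forgotten (C.node g)))
      ((Y ∩ T.bag (C.node g)) \ T.forgotten (C.node g)))

/-- An operand of a gate at `x`, as it is available when the current set is `Y`. -/
noncomputable def operand (C : Circuit T s) (R : Type*) [CommRing R] (x : Fin t)
    (Y : Finset (Fin n)) (keep : Bool) (b : Fin s) : R⟦X⟧ :=
  (if keep = true then (1 + X) ^ ((Y ∩ T.bag x) \ T.bag (C.node b)).card else 1) *
    if C.node b = x then zeta (C.lift R b) (Y ∩ T.bag x) else C.passed R b Y

theorem coeff_mul_congr {R : Type*} [CommRing R] {N : ℕ} {p q p' q' : R⟦X⟧}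
    (hp : ∀ j ≤ N, coeff j p = coeff j p') (hq : ∀ j ≤ N, coeff j q = coeff j q') :
    ∀ j ≤ N, coeff j (p * q) = coeff j (p' * q') := by
  intro j hj
  rw [coeff_mul, coeff_mul]
  refine Finset.sum_congr rfl fun i hi => ?_
  have := Finset.HasAntidiagonal.mem_antidiagonal.1 hi
  rw [hp _ (by omega), hq _ (by omega)]

/-- What a gate needs from an operand is available at the current set: the zeta transform of an
operand at the same node, and the passed series of an operand at a child. -/
theorem coeff_zeta_rankedRead (C : Circuit T s) (R : Type*) [CommRing R] {x : Fin t}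
    (Y : Finset (Fin n)) (keep : Bool) {b : Fin s}
    (hb : C.node b = x ∨ T.IsChild (C.node b) x) {j : ℕ} (hj : j ≤ n) :
    coeff j (zeta (rankedRead (T.bag (C.node b)) (T.bag x) keep (C.lift R b)) (Y ∩ T.bag x)) =
      coeff j (C.operand R x Y keep b) := by
  rw [zeta_rankedRead, operand]
  refine coeff_mul_congr (N := n) (fun _ _ => rfl) ?_ j hj
  intro i hi
  rcases hb with rfl | hb
  · rw [if_pos rfl]
    simp [coeff_lower, hi, zeta]
  · have hne : C.node b ≠ x := by
      intro h
      have h2 := hb.2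
      rw [h] at h2
      omega
    rw [if_neg hne, passed, T.forgotten_child hb]
    have : (Y ∩ T.bag (C.node b)) \ (T.bag (C.node b) \ T.bag x) =
        Y ∩ T.bag x ∩ T.bag (C.node b) := by
      ext v
      simp only [Finset.mem_inter, Finset.mem_sdiff]
      tauto
    rw [this]

theorem zeta_lift_const (C : Circuit T s) (R : Type*) [CommRing R] {g : Fin s}
    {A : Finset (Fin n)} {a : ℤ} (hg : C.gate g = .const A a) (W : Finset (Fin n)) :
    zeta (C.lift R g) W = if A ⊆ W then PowerSeries.C (a : R) * X ^ A.card else 0 := by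
  have h : C.lift R g = fun Y => if Y = A then PowerSeries.C (a : R) * X ^ A.card else 0 := by
    rw [Circuit.lift]
    split <;> simp_all
  rw [zeta, h, Finset.sum_ite_eq']
  simp [Finset.mem_powerset]

theorem coeff_zeta_lift_move (C : Circuit T s) (R : Type*) [CommRing R] {g b : Fin s}
    {kb : Bool} (hg : C.gate g = .move kb b) (Y : Finset (Fin n)) {j : ℕ} (hj : j ≤ n) :
    coeff j (zeta (C.lift R g) (Y ∩ T.bag (C.node g))) =
      coeff j (C.operand R (C.node g) Y kb b) := by
  obtain ⟨hb, hw⟩ := C.move_wire g kb b hg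
  rw [← C.coeff_zeta_rankedRead R Y kb hw hj]
  have h : C.lift R g =
      rankedRead (T.bag (C.node b)) (T.bag (C.node g)) kb (C.lift R b) := by
    rw [Circuit.lift]
    split <;> simp_all
  rw [h]

theorem coeff_zeta_lift_add (C : Circuit T s) (R : Type*) [CommRing R] {g b c : Fin s}
    {kb kc : Bool} (hg : C.gate g = .add kb b kc c) (Y : Finset (Fin n)) {j : ℕ} (hj : j ≤ n) :
    coeff j (zeta (C.lift R g) (Y ∩ T.bag (C.node g))) =
      coeff j (C.operand R (C.node g) Y kb b + C.operand R (C.node g) Y kc c) := by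
  obtain ⟨⟨hb, hwb⟩, ⟨hc, hwc⟩⟩ := C.add_wire g kb b kc c hg
  rw [map_add, ← C.coeff_zeta_rankedRead R Y kb hwb hj, ← C.coeff_zeta_rankedRead R Y kc hwc hj,
    ← map_add, ← zeta_add]
  have h : C.lift R g = fun Y =>
      rankedRead (T.bag (C.node b)) (T.bag (C.node g)) kb (C.lift R b) Y +
        rankedRead (T.bag (C.node c)) (T.bag (C.node g)) kc (C.lift R c) Y := by
    rw [Circuit.lift]
    split <;> simp_all
  rw [h]

theorem coeff_zeta_lift_conv (C : Circuit T s) (R : Type*) [CommRing R] {g b c : Fin s}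
    (hg : C.gate g = .conv b c) (Y : Finset (Fin n)) {j : ℕ} (hj : j ≤ n) :
    coeff j (zeta (C.lift R g) (Y ∩ T.bag (C.node g))) =
      coeff j (C.operand R (C.node g) Y false b * C.operand R (C.node g) Y false c) := by
  obtain ⟨⟨hb, hwb, -⟩, ⟨hc, hwc, -⟩⟩ := C.conv_wire g b c hg
  have h : C.lift R g = unionProd
      (rankedRead (T.bag (C.node b)) (T.bag (C.node g)) false (C.lift R b))
      (rankedRead (T.bag (C.node c)) (T.bag (C.node g)) false (C.lift R c)) := by
    rw [Circuit.lift]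
    split <;> simp_all
  rw [h, zeta_unionProd]
  exact coeff_mul_congr (N := n) (fun i hi => C.coeff_zeta_rankedRead R Y false hwb hi)
    (fun i hi => C.coeff_zeta_rankedRead R Y false hwc hi) j hj

/-- The series that are summed up over all `Z ⊆ forgotten x` give the information that is passed
to the parent. -/
theorem sum_sign_lower_zeta (C : Circuit T s) (R : Type*) [CommRing R] (g : Fin s)
    {Y : Finset (Fin n)} (hY : Disjoint Y (T.forgotten (C.node g))) :
    ∑ Z ∈ (T.forgotten (C.node g)).powerset,
      (-1 : ℤ) ^ (T.forgotten (C.node g) \ Z).card •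
        lower n (T.forgotten (C.node g)).card
          (zeta (C.lift R g) ((Y ∪ Z) ∩ T.bag (C.node g))) = C.passed R g Y := by
  have hD := T.forgotten_subset_bag (C.node g)
  have h0 : (Y ∩ T.bag (C.node g)) \ T.forgotten (C.node g) = Y ∩ T.bag (C.node g) :=
    Finset.sdiff_eq_self_of_disjoint (hY.mono_left Finset.inter_subset_left)
  rw [passed, h0, zeta, ← sum_sign_zeta _ (hY.mono_left Finset.inter_subset_left), map_sum]
  refine Finset.sum_congr rfl fun Z hZ => ?_
  rw [Finset.mem_powerset] at hZ
  rw [Finset.union_inter_distrib_right, Finset.inter_eq_left.2 (hZ.trans hD), map_zsmul]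

/-- At the root all vertices of the bag are forgotten, and the constant coefficient of the passed
series is the output of the circuit at the bag. -/
theorem coeff_passed_root (C : Circuit T s) (R : Type*) [CommRing R] :
    coeff 0 (C.passed R C.out ∅) = (C.value C.out (T.bag T.root) : R) := by
  have hn : (T.bag T.root).card ≤ n := by simpa using Finset.card_le_univ (T.bag T.root)
  have h := (C.isRankedLift_lift R C.out (T.bag T.root) (by rw [C.node_out])).2
  rw [passed, C.node_out, T.forgotten_root, coeff_lower, if_pos (by omega), zero_add, ← h]
  simp [zeta]

end Circuit

/-! ### The traversal of the tree -/

namespace Circuit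

open PowerSeries

variable {n : ℕ} {G : SimpleGraph (Fin n)} {t : ℕ} {T : TreeDecomp G t} {s : ℕ}

/-- A state of the traversal: node `x` is being processed for the current set `Y`, the subtrees of
its children with an index below `k` are done, and `acc` holds what the gates have accumulated for
the parents of their nodes.  The traversal is over when `run` is false. -/
structure Config (n t s : ℕ) (R : Type*) where
  run : Bool
  x : Fin t
  k : ℕ
  Y : Finset (Fin n)
  acc : Fin s → R⟦X⟧

variable (C : Circuit T s) (R : Type*) [CommRing R]

/-- The contribution of the current set `Y` to the accumulator of a gate at `x`. -/
noncomputable def term (x : Fin t) (g : Fin s) (Y : Finset (Fin n)) : R⟦X⟧ :=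
  (-1 : ℤ) ^ (T.forgotten x \ Y).card •
    lower n (T.forgotten x).card (zeta (C.lift R g) (Y ∩ T.bag x))

variable {R}

open Classical in
/-- The value of an accumulator before the contribution of `Y` is added: in the first round, when
`Y` contains no vertex that is forgotten at `x`, the old content is dropped. -/
noncomputable def base (T : TreeDecomp G t) (x : Fin t) (Y : Finset (Fin n)) (p : R⟦X⟧) :
    R⟦X⟧ :=
  if Disjoint (T.forgotten x) Y then 0 else p

open Classical in
/-- The accumulators after the gates at `x` have been evaluated for `Y`. -/
noncomputable def accumulate (x : Fin t) (Y : Finset (Fin n)) (acc : Fin s → R⟦X⟧)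
    (g : Fin s) : R⟦X⟧ :=
  if C.node g = x then base T x Y (acc g) + C.term R x g Y else acc g

/-- The accumulators of all gates at children of `x` are correct for the set `Y`. -/
def Ready (x : Fin t) (Y : Finset (Fin n)) (acc : Fin s → R⟦X⟧) : Prop :=
  ∀ b, T.IsChild (C.node b) x → acc b = C.passed R b Y

/-- One step of the traversal. The subsets of `forgotten x` are enumerated by a binary counter. -/
inductive Step : Config n t s R → Config n t s R → Prop
  | descend {x k : Fin t} {Y acc} : T.IsChild k x →
      Step ⟨true, x, k, Y, acc⟩ ⟨true, k, 0, Y, acc⟩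
  | skip {x k : Fin t} {Y acc} : ¬ T.IsChild k x →
      Step ⟨true, x, k, Y, acc⟩ ⟨true, x, k + 1, Y, acc⟩
  | next {x : Fin t} {Y acc} {v : Fin n} : C.Ready x Y acc → v ∈ T.forgotten x → v ∉ Y →
      (∀ u ∈ T.forgotten x, u < v → u ∈ Y) →
      Step ⟨true, x, t, Y, acc⟩
        ⟨true, x, 0, insert v (Y \ (T.forgotten x).filter (· < v)), C.accumulate x Y acc⟩
  | up {x : Fin t} {Y acc} : C.Ready x Y acc → T.forgotten x ⊆ Y →
      Step ⟨true, x, t, Y, acc⟩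
        ⟨decide (x ≠ T.root), T.parent x, x + 1, Y \ T.forgotten x, C.accumulate x Y acc⟩

/-- `Steps k a b`: the traversal leads from `a` to `b` in `k` steps. -/
inductive Steps : ℕ → Config n t s R → Config n t s R → Prop
  | refl (c) : Steps 0 c c
  | head {k a b c} : C.Step a b → Steps k b c → Steps (k + 1) a c

/-- `b` is reached from `a` in at most `N` steps. -/
def Reach (N : ℕ) (a b : Config n t s R) : Prop := ∃ k ≤ N, C.Steps k a b

variable {C}

theorem Steps.trans {k l : ℕ} {a b c : Config n t s R} (h : C.Steps k a b)
    (h' : C.Steps l b c) : C.Steps (k + l) a c := by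
  induction h with
  | refl => simpa using h'
  | head hs _ ih =>
    have := Steps.head hs (ih h')
    rwa [add_right_comm] at this

theorem Reach.trans {k l : ℕ} {a b c : Config n t s R} (h : C.Reach k a b)
    (h' : C.Reach l b c) : C.Reach (k + l) a c := by
  obtain ⟨i, hi, h⟩ := h
  obtain ⟨j, hj, h'⟩ := h'
  exact ⟨i + j, by omega, h.trans h'⟩

theorem Reach.mono {k l : ℕ} {a b : Config n t s R} (h : C.Reach k a b) (hkl : k ≤ l) :
    C.Reach l a b := by
  obtain ⟨i, hi, h⟩ := h
  exact ⟨i, hi.trans hkl, h⟩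

theorem Reach.refl (a : Config n t s R) : C.Reach 0 a a := ⟨0, le_rfl, .refl a⟩

theorem Step.reach {a b : Config n t s R} (h : C.Step a b) : C.Reach 1 a b :=
  ⟨1, le_rfl, .head h (.refl b)⟩

variable (C)

open Classical in
/-- The binary counter runs through the subsets of `S`, the set of forgotten vertices below `j`.
Just before the round for `Y ∪ S`, the accumulator of a gate at `x` lacks only the contribution of
that set; hence the equation is stated with this contribution added.  The hypothesis is that all
children of `x` can be processed for any current set within `N` steps. -/
theorem reach_forgotten_below {x : Fin t} {N : ℕ}
    (hvisit : ∀ (Y : Finset (Fin n)) (acc : Fin s → R⟦X⟧), Y ⊆ T.pathUnion x →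
      ∃ acc' : Fin s → R⟦X⟧, C.Reach N ⟨true, x, 0, Y, acc⟩ ⟨true, x, t, Y, acc'⟩ ∧
        C.Ready x Y acc' ∧ ∀ g, (C.node g = x ∨ C.node g ∉ T.desc x) → acc' g = acc g)
    (j : ℕ) (Y : Finset (Fin n)) (acc : Fin s → R⟦X⟧) (hY : Y ⊆ T.pathUnion x)
    (hdis : Disjoint Y ((T.forgotten x).filter (fun v : Fin n => (v : ℕ) < j))) :
    ∃ acc' : Fin s → R⟦X⟧,
      C.Reach ((2 ^ ((T.forgotten x).filter (fun v : Fin n => (v : ℕ) < j)).card - 1) * (N + 1))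
        ⟨true, x, 0, Y, acc⟩
        ⟨true, x, 0, Y ∪ (T.forgotten x).filter (fun v : Fin n => (v : ℕ) < j), acc'⟩ ∧
      (∀ g, C.node g = x →
        base T x (Y ∪ (T.forgotten x).filter (fun v : Fin n => (v : ℕ) < j)) (acc' g) +
          C.term R x g (Y ∪ (T.forgotten x).filter (fun v : Fin n => (v : ℕ) < j)) =
        base T x Y (acc g) +
          ∑ W ∈ ((T.forgotten x).filter (fun v : Fin n => (v : ℕ) < j)).powerset,
            C.term R x g (Y ∪ W)) ∧
      ∀ g, C.node g ∉ T.desc x → acc' g = acc g := by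
  induction j generalizing Y acc with
  | zero =>
    refine ⟨acc, ?_, ?_, fun _ _ => rfl⟩
    · simpa using Reach.refl _
    · simp
  | succ j ih =>
    set S := (T.forgotten x).filter (fun v : Fin n => (v : ℕ) < j) with hS
    by_cases hj : ∃ v ∈ T.forgotten x, (v : ℕ) = j
    · obtain ⟨v, hv, rfl⟩ := hj
      have hins : (T.forgotten x).filter (fun u : Fin n => (u : ℕ) < v + 1) = insert v S := by
        ext u
        simp only [hS, Finset.mem_filter, Finset.mem_insert, Nat.lt_succ_iff_lt_or_eq]
        constructor
        · rintro ⟨h1, h2 | h2⟩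
          · exact Or.inr ⟨h1, h2⟩
          · exact Or.inl (Fin.ext h2)
        · rintro (rfl | ⟨h1, h2⟩)
          · exact ⟨hv, Or.inr rfl⟩
          · exact ⟨h1, Or.inl h2⟩
      rw [hins] at hdis ⊢
      have hvS : v ∉ S := by simp [hS]
      have hvY : v ∉ Y := fun h =>
        Finset.disjoint_left.1 hdis h (Finset.mem_insert_self v S)
      have hYS : Disjoint Y S := hdis.mono_right (Finset.subset_insert v S)
      have hSx : S ⊆ T.forgotten x := Finset.filter_subset _ _
      have hSp : S ⊆ T.pathUnion x := hSx.trans (T.forgotten_subset_pathUnion x)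
      obtain ⟨acc₁, hr₁, hs₁, hk₁⟩ := ih Y acc hY hYS
      obtain ⟨acc₂, hr₂, hready, hk₂⟩ := hvisit (Y ∪ S) acc₁ (Finset.union_subset hY hSp)
      have hYv : insert v ((Y ∪ S) \ (T.forgotten x).filter (· < v)) = insert v Y := by
        have : (T.forgotten x).filter (· < v) = S := by
          ext u
          simp [hS]
        rw [this, Finset.union_sdiff_right, Finset.sdiff_eq_self_of_disjoint hYS]
      have hstep : C.Step ⟨true, x, t, Y ∪ S, acc₂⟩
          ⟨true, x, 0, insert v Y, C.accumulate x (Y ∪ S) acc₂⟩ := by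
        have := Step.next (C := C) hready hv (by simp [hvY, hvS]) (fun u hu huv => by
          refine Finset.mem_union_right _ ?_
          simp only [hS, Finset.mem_filter]
          exact ⟨hu, huv⟩)
        rwa [hYv] at this
      obtain ⟨acc₃, hr₃, hs₃, hk₃⟩ := ih (insert v Y) (C.accumulate x (Y ∪ S) acc₂)
        (Finset.insert_subset (T.forgotten_subset_pathUnion x hv) hY)
        (Finset.disjoint_insert_left.2 ⟨hvS, hYS⟩)
      have hun : insert v Y ∪ S = Y ∪ insert v S := by
        rw [Finset.insert_union, Finset.union_insert]
      rw [hun] at hr₃ hs₃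
      refine ⟨acc₃, ?_, ?_, ?_⟩
      · refine (((hr₁.trans hr₂).trans hstep.reach).trans hr₃).mono ?_
        rw [Finset.card_insert_of_notMem hvS, pow_succ]
        have h2 : 1 ≤ 2 ^ S.card := Nat.one_le_two_pow
        obtain ⟨q, hq⟩ := Nat.exists_eq_add_of_le h2
        rw [hq]
        have e1 : 1 + q - 1 = q := by omega
        have e2 : (1 + q) * 2 - 1 = q + 1 + q := by omega
        rw [e1, e2]
        apply le_of_eq
        ring
      · intro g hg
        rw [hs₃ g hg, Finset.sum_powerset_insert hvS]
        have hb : base T x (insert v Y) (C.accumulate x (Y ∪ S) acc₂ g) =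
            base T x (Y ∪ S) (acc₁ g) + C.term R x g (Y ∪ S) := by
          rw [base, if_neg, accumulate, if_pos hg, hk₂ g (Or.inl hg)]
          rw [Finset.disjoint_left]
          exact fun h => h hv (Finset.mem_insert_self v Y)
        rw [hb, hs₁ g hg, add_assoc]
        congr 2
        refine Finset.sum_congr rfl fun W _ => ?_
        rw [Finset.insert_union, Finset.union_insert]
      · intro g hg
        have hgx : C.node g ≠ x := fun h => hg (h ▸ T.self_mem_desc x)
        rw [hk₃ g hg, accumulate, if_neg hgx, hk₂ g (Or.inr hg), hk₁ g hg]
    · have hsame : (T.forgotten x).filter (fun u : Fin n => (u : ℕ) < j + 1) = S := by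
        ext u
        simp only [hS, Finset.mem_filter, Nat.lt_succ_iff_lt_or_eq]
        constructor
        · rintro ⟨h1, h2 | h2⟩
          · exact ⟨h1, h2⟩
          · exact absurd ⟨u, h1, h2⟩ hj
        · rintro ⟨h1, h2⟩
          exact ⟨h1, Or.inl h2⟩
      rw [hsame] at hdis ⊢
      exact ih Y acc hY hdis

/-- A bound on the number of steps in which the subtree of `x` is processed for a single choice of
the current set above `x`. -/
noncomputable def cost (T : TreeDecomp G t) (x : Fin t) : ℕ :=
  (t + 1) * (T.desc x).card * 2 ^ (T.branchSize - (T.above x).card)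

/-- The recursion for the number of steps: the node `x` has `2 ^ |forgotten x|` rounds, in each of
which all children are processed; the factor is paid for by the growth of the union of the bags on
the path from the root. -/
theorem cost_rec (T : TreeDecomp G t) (x : Fin t) :
    2 ^ (T.forgotten x).card * (t + ∑ c ∈ T.children x, cost T c + 1) ≤ cost T x := by
  have h1 := T.card_above_add_card_forgotten x
  have h2 := T.card_pathUnion_le x
  have h3 := T.card_desc_children x
  have hsum : ∑ c ∈ T.children x, cost T c = (t + 1) * 2 ^ (T.branchSize - (T.pathUnion x).card) *
      ∑ c ∈ T.children x, (T.desc c).card := by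
    rw [Finset.mul_sum]
    refine Finset.sum_congr rfl fun c hc => ?_
    rw [cost, T.above_child (T.mem_children.1 hc)]
    ring
  have h4 : 1 ≤ 2 ^ (T.branchSize - (T.pathUnion x).card) := Nat.one_le_two_pow
  have h5 : 2 ^ (T.forgotten x).card * 2 ^ (T.branchSize - (T.pathUnion x).card) ≤
      2 ^ (T.branchSize - (T.above x).card) := by
    rw [← pow_add]
    exact Nat.pow_le_pow_right (by norm_num) (by omega)
  rw [hsum, cost]
  set P := 2 ^ (T.branchSize - (T.pathUnion x).card)
  set S := ∑ c ∈ T.children x, (T.desc c).card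
  calc 2 ^ (T.forgotten x).card * (t + (t + 1) * P * S + 1)
      ≤ 2 ^ (T.forgotten x).card * ((t + 1) * P * (1 + S)) := by
        refine Nat.mul_le_mul_left _ ?_
        have := Nat.mul_le_mul_left (t + 1) h4
        nlinarith
    _ = (t + 1) * (1 + S) * (2 ^ (T.forgotten x).card * P) := by ring
    _ ≤ (t + 1) * (T.desc x).card * 2 ^ (T.branchSize - (T.above x).card) :=
        Nat.mul_le_mul (Nat.mul_le_mul_left _ h3) h5

open Classical in
/-- When node `x` is entered with the current set `Y`, it is left within the bound, with `Y`
unchanged and with the accumulators of its gates equal to the series passed to the parent. -/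
theorem reach_process (x : Fin t) (Y : Finset (Fin n)) (acc : Fin s → R⟦X⟧)
    (hY : Y ⊆ T.above x) :
    ∃ acc' : Fin s → R⟦X⟧,
      C.Reach (cost T x) ⟨true, x, 0, Y, acc⟩
        ⟨decide (x ≠ T.root), T.parent x, x + 1, Y, acc'⟩ ∧
      (∀ g, C.node g = x → acc' g = C.passed R g Y) ∧
      ∀ g, C.node g ∉ T.desc x → acc' g = acc g := by
  induction hd : (T.desc x).card using Nat.strong_induction_on generalizing x Y acc with
  | _ d ih =>
  subst hd
  have hchild : ∀ k : ℕ, k ≤ t → ∀ (Y : Finset (Fin n)) (acc : Fin s → R⟦X⟧),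
      Y ⊆ T.pathUnion x →
      ∃ acc' : Fin s → R⟦X⟧,
        C.Reach (k + ∑ c ∈ (T.children x).filter (fun c : Fin t => (c : ℕ) < k), cost T c)
          ⟨true, x, 0, Y, acc⟩ ⟨true, x, k, Y, acc'⟩ ∧
        (∀ b, T.IsChild (C.node b) x → (C.node b : ℕ) < k → acc' b = C.passed R b Y) ∧
        ∀ g, (C.node g = x ∨ C.node g ∉ T.desc x) → acc' g = acc g := by
    intro k hk Y acc hY
    induction k with
    | zero => exact ⟨acc, by simpa using Reach.refl _, by simp, fun _ _ => rfl⟩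
    | succ k ihk =>
      obtain ⟨acc₁, hr₁, hc₁, hk₁⟩ := ihk (by omega)
      let c : Fin t := ⟨k, hk⟩
      have hck : (c : ℕ) = k := rfl
      by_cases hc : T.IsChild c x
      · obtain ⟨acc₂, hr₂, hc₂, hk₂⟩ := ih _ (Finset.card_lt_card (T.desc_child_ssubset hc)) c Y
          acc₁ (by rwa [T.above_child hc]) rfl
        have hcr := T.isChild_iff.1 hc
        rw [hcr.2, decide_eq_true hcr.1] at hr₂
        refine ⟨acc₂, ?_, ?_, ?_⟩
        · have hstep : C.Step ⟨true, x, k, Y, acc₁⟩ ⟨true, c, 0, Y, acc₁⟩ := Step.descend hc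
          refine ((hr₁.trans hstep.reach).trans hr₂).mono ?_
          have hf : (T.children x).filter (fun e : Fin t => (e : ℕ) < k + 1) =
              insert c ((T.children x).filter (fun e : Fin t => (e : ℕ) < k)) := by
            ext e
            simp only [Finset.mem_filter, Finset.mem_insert, Fin.ext_iff, hck]
            constructor
            · rintro ⟨h1, h2⟩
              by_cases h : (e : ℕ) = k
              · exact Or.inl h
              · exact Or.inr ⟨h1, by omega⟩
            · rintro (h | ⟨h1, h2⟩)
              · have : e = c := Fin.ext h
                rw [this]
                exact ⟨T.mem_children.2 hc, by omega⟩
              · exact ⟨h1, by omega⟩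
          rw [hf, Finset.sum_insert (by simp [hck])]
          omega
        · intro b hb hbk
          by_cases hbc : C.node b = c
          · exact hc₂ b hbc
          · have hlt : (C.node b : ℕ) < k := by
              have : (C.node b : ℕ) ≠ k := fun h => hbc (Fin.ext h)
              omega
            rw [hk₂ b (fun h => Finset.disjoint_left.1 (T.disjoint_desc hb hc hbc)
              (T.self_mem_desc _) h)]
            exact hc₁ b hb hlt
        · intro g hg
          rw [hk₂ g, hk₁ g hg]
          rcases hg with hg | hg
          · rw [hg]
            exact T.not_mem_desc_child hc
          · exact fun h => hg (T.desc_subset hc h)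
      · refine ⟨acc₁, ?_, ?_, hk₁⟩
        · have hstep : C.Step ⟨true, x, k, Y, acc₁⟩ ⟨true, x, k + 1, Y, acc₁⟩ :=
            Step.skip (k := c) hc
          refine (hr₁.trans hstep.reach).mono ?_
          have : ∑ e ∈ (T.children x).filter (fun e : Fin t => (e : ℕ) < k), cost T e ≤
              ∑ e ∈ (T.children x).filter (fun e : Fin t => (e : ℕ) < k + 1), cost T e := by
            refine Finset.sum_le_sum_of_subset fun e he => ?_
            simp only [Finset.mem_filter] at he ⊢
            exact ⟨he.1, by omega⟩
          omega
        · intro b hb hbk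
          refine hc₁ b hb ?_
          have : (C.node b : ℕ) ≠ k := by
            intro h
            have : C.node b = c := Fin.ext h
            exact hc (this ▸ hb)
          omega
  have hvisit : ∀ (Y : Finset (Fin n)) (acc : Fin s → R⟦X⟧), Y ⊆ T.pathUnion x →
      ∃ acc' : Fin s → R⟦X⟧,
        C.Reach (t + ∑ c ∈ T.children x, cost T c)
          ⟨true, x, 0, Y, acc⟩ ⟨true, x, t, Y, acc'⟩ ∧
        C.Ready x Y acc' ∧ ∀ g, (C.node g = x ∨ C.node g ∉ T.desc x) → acc' g = acc g := by
    intro Y acc hY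
    obtain ⟨acc', hr, hc, hk⟩ := hchild t le_rfl Y acc hY
    refine ⟨acc', ?_, fun b hb => hc b hb (C.node b).2, hk⟩
    rwa [Finset.filter_true_of_mem (fun c _ => c.2)] at hr
  have hdis : Disjoint Y (T.forgotten x) :=
    Finset.disjoint_of_subset_left hY (T.disjoint_forgotten_above x).symm
  have hYp : Y ⊆ T.pathUnion x := hY.trans (T.above_subset x)
  have hall : (T.forgotten x).filter (fun v : Fin n => (v : ℕ) < n) = T.forgotten x :=
    Finset.filter_true_of_mem (fun v _ => v.2)
  obtain ⟨acc₁, hr₁, hs₁, hk₁⟩ := C.reach_forgotten_below hvisit n Y acc hYp (by rwa [hall])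
  rw [hall] at hr₁ hs₁
  obtain ⟨acc₂, hr₂, hready, hk₂⟩ := hvisit (Y ∪ T.forgotten x) acc₁
    (Finset.union_subset hYp (T.forgotten_subset_pathUnion x))
  have hstep := Step.up (C := C) hready Finset.subset_union_right
  have hYback : (Y ∪ T.forgotten x) \ T.forgotten x = Y := by
    rw [Finset.union_sdiff_right, Finset.sdiff_eq_self_of_disjoint hdis]
  rw [hYback] at hstep
  refine ⟨_, ((hr₁.trans hr₂).trans hstep.reach).mono ?_, ?_, ?_⟩
  · refine le_trans (le_of_eq ?_) (cost_rec T x)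
    have h2 : 1 ≤ 2 ^ (T.forgotten x).card := Nat.one_le_two_pow
    obtain ⟨q, hq⟩ := Nat.exists_eq_add_of_le h2
    have e1 : 1 + q - 1 = q := by omega
    rw [hq, e1]
    ring
  · intro g hg
    rw [accumulate, if_pos hg, hk₂ g (Or.inl hg), hs₁ g hg, base, if_pos hdis.symm, zero_add,
      ← C.sum_sign_lower_zeta R g (by rwa [hg]), hg]
    refine Finset.sum_congr rfl fun W _ => ?_
    have : T.forgotten x \ (Y ∪ W) = T.forgotten x \ W := by
      ext v
      simp only [Finset.mem_sdiff, Finset.mem_union, not_or]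
      exact ⟨fun h => ⟨h.1, h.2.2⟩,
        fun h => ⟨h.1, fun h' => Finset.disjoint_left.1 hdis h' h.1, h.2⟩⟩
    rw [term, this]
  · intro g hg
    have hgx : C.node g ≠ x := fun h => hg (h ▸ T.self_mem_desc x)
    rw [accumulate, if_neg hgx, hk₂ g (Or.inr hg), hk₁ g hg]

/-- The traversal reaches a final configuration in which the value of the output gate at the full
bag of the root can be read off. -/
theorem reach_final (acc : Fin s → R⟦X⟧) :
    ∃ (k : ℕ) (acc' : Fin s → R⟦X⟧),
      C.Reach ((t + 1) * t * 2 ^ T.branchSize) ⟨true, T.root, 0, ∅, acc⟩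
        ⟨false, T.root, k, ∅, acc'⟩ ∧
      coeff 0 (acc' C.out) = (C.value C.out (T.bag T.root) : R) := by
  obtain ⟨acc', hr, hc, -⟩ := C.reach_process T.root ∅ acc (Finset.empty_subset _)
  refine ⟨T.root + 1, acc', ?_, ?_⟩
  · rw [T.parent_root] at hr
    simp only [ne_eq, not_true_eq_false, decide_false] at hr
    refine hr.mono ?_
    rw [cost, T.above_root, Finset.card_empty, Nat.sub_zero]
    have : (T.desc T.root).card ≤ t := by simpa using Finset.card_le_univ (T.desc T.root)
    gcongr
  · rw [hc _ C.node_out, C.coeff_passed_root R]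

end Circuit

/-! ### Bounded runs of the random access machine -/

namespace RAM

/-- A bound on the number of elementary steps of a program in which every loop is iterated at most
`N` times. -/
def Prog.steps (N : ℕ) : Prog → ℕ
  | .instr _ => 1
  | .seq p q => p.steps N + q.steps N
  | .ite _ p q => 1 + p.steps N + q.steps N
  | .loop _ p => 1 + N * (1 + p.steps N)

/-- The number of steps is bounded by a polynomial in the number of iterations. -/
theorem Prog.exists_steps_le (p : Prog) : ∃ c d : ℕ, ∀ N, 0 < N → p.steps N ≤ c * N ^ d := by
  induction p with
  | instr a => exact ⟨1, 0, fun N _ => by simp [steps]⟩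
  | seq p q hp hq =>
    obtain ⟨c, d, h⟩ := hp
    obtain ⟨c', d', h'⟩ := hq
    refine ⟨c + c', d + d', fun N hN => ?_⟩
    have h1 : N ^ d ≤ N ^ (d + d') := Nat.pow_le_pow_right hN (by omega)
    have h2 : N ^ d' ≤ N ^ (d + d') := Nat.pow_le_pow_right hN (by omega)
    calc p.steps N + q.steps N ≤ c * N ^ d + c' * N ^ d' := add_le_add (h N hN) (h' N hN)
      _ ≤ c * N ^ (d + d') + c' * N ^ (d + d') := by gcongr
      _ = _ := by ring
  | ite i p q hp hq =>
    obtain ⟨c, d, h⟩ := hp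
    obtain ⟨c', d', h'⟩ := hq
    refine ⟨1 + c + c', d + d', fun N hN => ?_⟩
    have h0 : 1 ≤ N ^ (d + d') := Nat.one_le_pow _ _ hN
    have h1 : N ^ d ≤ N ^ (d + d') := Nat.pow_le_pow_right hN (by omega)
    have h2 : N ^ d' ≤ N ^ (d + d') := Nat.pow_le_pow_right hN (by omega)
    calc 1 + p.steps N + q.steps N ≤ 1 + c * N ^ d + c' * N ^ d' :=
          add_le_add (add_le_add le_rfl (h N hN)) (h' N hN)
      _ ≤ N ^ (d + d') + c * N ^ (d + d') + c' * N ^ (d + d') := by gcongr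
      _ = _ := by ring
  | loop i p hp =>
    obtain ⟨c, d, h⟩ := hp
    refine ⟨2 + c, d + 1, fun N hN => ?_⟩
    have h0 : 1 ≤ N ^ (d + 1) := Nat.one_le_pow _ _ hN
    have h1 : N ≤ N ^ (d + 1) := Nat.le_self_pow (by omega) N
    calc 1 + N * (1 + p.steps N) ≤ 1 + N * (1 + c * N ^ d) := by gcongr; exact h N hN
      _ = 1 + N + c * N ^ (d + 1) := by ring
      _ ≤ N ^ (d + 1) + N ^ (d + 1) + c * N ^ (d + 1) := by gcongr
      _ = _ := by ring

/-- The parameters of a run.  The registers below 64 are used for single numbers, and those from 64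
on hold a matrix of numbers below `m`.  The variables are bounded by `Q`, and every loop is iterated
at most `N` times. -/
structure Env where
  inp : List ℕ
  rows : ℕ
  cols : ℕ
  m : ℕ
  Q : ℕ
  N : ℕ
  m_pos : 0 < m
  m_le : m ≤ Q
  dim_le : 64 + rows * cols ≤ Q

namespace Env

variable (E : Env)

/-- The maximum length in bits of the numbers in the registers below 64.  An expression with at most
32 leaves over numbers up to `Q` stays within this length. -/
def bits : ℕ := 32 * (Nat.size E.Q + 1)

/-- A bound on the cost of an instruction, which handles at most three numbers, named by registers
with addresses of at most six bits. -/
def unit : ℕ := 20 + 3 * E.bits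

/-- A bound on the work space. -/
def room : ℕ := 64 * (1 + E.bits) + E.rows * E.cols * (1 + Nat.size E.m)

end Env

variable {E : Env}

/-- All registers obey the bounds of the run. -/
structure Bounded (E : Env) (σ : Store) : Prop where
  top_le : σ.top ≤ 64 + E.rows * E.cols
  reg : ∀ i < 64, Nat.size (σ.mem i) ≤ E.bits
  cell : ∀ i, 64 ≤ i → σ.mem i < E.m

theorem Bounded.space_le {σ : Store} (h : Bounded E σ) : σ.space ≤ E.room := by
  have h1 : σ.space ≤ ∑ i ∈ Finset.range (64 + E.rows * E.cols), (1 + Nat.size (σ.mem i)) :=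
    Finset.sum_le_sum_of_subset (Finset.range_mono h.top_le)
  refine h1.trans ?_
  rw [Finset.sum_range_add, Env.room]
  refine add_le_add ?_ ?_
  · calc ∑ i ∈ Finset.range 64, (1 + Nat.size (σ.mem i))
        ≤ ∑ i ∈ Finset.range 64, (1 + E.bits) :=
          Finset.sum_le_sum fun i hi => Nat.add_le_add_left (h.reg i (Finset.mem_range.1 hi)) 1
      _ = 64 * (1 + E.bits) := by simp
  · calc ∑ i ∈ Finset.range (E.rows * E.cols), (1 + Nat.size (σ.mem (64 + i)))
        ≤ ∑ i ∈ Finset.range (E.rows * E.cols), (1 + Nat.size E.m) :=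
          Finset.sum_le_sum fun i _ =>
            Nat.add_le_add_left (Nat.size_le_size (h.cell (64 + i) (by omega)).le) 1
      _ = E.rows * E.cols * (1 + Nat.size E.m) := by simp

theorem Bounded.write_reg {σ : Store} (h : Bounded E σ) {i v : ℕ} (hi : i < 64)
    (hv : Nat.size v ≤ E.bits) : Bounded E (σ.write i v) := by
  refine ⟨?_, ?_, ?_⟩
  · have := h.top_le
    simp only [Store.write]
    omega
  · intro j hj
    simp only [Store.write, Function.update_apply]
    split_ifs
    · exact hv
    · exact h.reg j hj
  · intro j hj
    simp only [Store.write, Function.update_apply]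
    rw [if_neg (by omega)]
    exact h.cell j hj

theorem Bounded.write_cell {σ : Store} (h : Bounded E σ) {i v : ℕ} (hi : 64 ≤ i)
    (hi' : i < 64 + E.rows * E.cols) (hv : v < E.m) : Bounded E (σ.write i v) := by
  refine ⟨?_, ?_, ?_⟩
  · have := h.top_le
    simp only [Store.write]
    omega
  · intro j hj
    simp only [Store.write, Function.update_apply]
    rw [if_neg (by omega)]
    exact h.reg j hj
  · intro j hj
    simp only [Store.write, Function.update_apply]
    split_ifs
    · exact hv
    · exact h.cell j hj

/-- The registers that are named in an instruction are below 64. -/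
def Instr.Low : Instr → Prop
  | .set i _ => i < 64
  | .arith _ i j k => i < 64 ∧ j < 64 ∧ k < 64
  | .load i j => i < 64 ∧ j < 64
  | .store i j => i < 64 ∧ j < 64
  | .seek i => i < 64
  | .next => True
  | .read i => i < 64

theorem size_le_six {i : ℕ} (hi : i < 64) : Nat.size i ≤ 6 := Nat.size_le.2 (by norm_num; exact hi)

theorem Bounded.cost_le {σ : Store} {a : Instr} (h : Bounded E σ)
    (h' : Bounded E (a.exec E.inp σ)) (ha : a.Low) : a.cost E.inp σ ≤ E.unit := by
  have hreg := h.reg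
  have hreg' := h'.reg
  cases a with
  | set i c =>
    have h1 := hreg' i ha
    have h2 := size_le_six ha
    simp only [Instr.exec, Store.write, Function.update_self] at h1
    simp only [Instr.cost, Env.unit]
    omega
  | arith o i j k =>
    obtain ⟨hi, hj, hk⟩ := ha
    have h1 := hreg' i hi
    have h2 := size_le_six hi
    have h3 := size_le_six hj
    have h4 := size_le_six hk
    have h5 := hreg j hj
    have h6 := hreg k hk
    simp only [Instr.exec, Store.write, Function.update_self] at h1
    simp only [Instr.cost, Env.unit]
    omega
  | load i j =>
    obtain ⟨hi, hj⟩ := ha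
    have h1 := hreg' i hi
    have h2 := size_le_six hi
    have h3 := size_le_six hj
    have h5 := hreg j hj
    simp only [Instr.exec, Store.write, Function.update_self] at h1
    simp only [Instr.cost, Env.unit]
    omega
  | store i j =>
    obtain ⟨hi, hj⟩ := ha
    have h2 := size_le_six hi
    have h3 := size_le_six hj
    have h5 := hreg j hj
    have h6 := hreg i hi
    simp only [Instr.cost, Env.unit]
    omega
  | seek i =>
    have h2 := size_le_six ha
    have h5 := hreg i ha
    simp only [Instr.cost, Env.unit]
    omega
  | next =>
    simp only [Instr.cost, Env.unit]
    omega
  | read i =>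
    have h1 := hreg' i ha
    have h2 := size_le_six ha
    simp only [Instr.exec, Store.write, Function.update_self] at h1
    simp only [Instr.cost, Env.unit]
    omega

/-- The program `p` leads from `σ` to `τ` within the bounds on time and space. -/
def Run (E : Env) (p : Prog) (σ τ : Store) : Prop :=
  ∃ t s, Exec E.inp p σ t s τ ∧ t ≤ E.unit * p.steps E.N ∧ s ≤ E.room

theorem Run.instr {σ : Store} {a : Instr} (ha : a.Low) (h : Bounded E σ)
    (h' : Bounded E (a.exec E.inp σ)) : Run E (.instr a) σ (a.exec E.inp σ) :=
  ⟨_, _, .instr a σ, by simpa [Prog.steps] using h.cost_le h' ha, max_le h.space_le h'.space_le⟩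

theorem Run.seq {p q : Prog} {σ τ υ : Store} (h : Run E p σ τ) (h' : Run E q τ υ) :
    Run E (.seq p q) σ υ := by
  obtain ⟨t, s, he, ht, hs⟩ := h
  obtain ⟨t', s', he', ht', hs'⟩ := h'
  exact ⟨_, _, .seq he he', by rw [Prog.steps, mul_add]; omega, max_le hs hs'⟩

theorem Bounded.test_le {σ : Store} (h : Bounded E σ) {i : ℕ} (hi : i < 64) :
    1 + Nat.size i + Nat.size (σ.mem i) ≤ E.unit := by
  have h1 := h.reg i hi
  have h2 := size_le_six hi
  rw [Env.unit]
  omega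

theorem Run.ite_true {i : ℕ} {p q : Prog} {σ τ : Store} (hi : i < 64) (hσ : Bounded E σ)
    (h0 : σ.mem i ≠ 0) (h : Run E p σ τ) : Run E (.ite i p q) σ τ := by
  obtain ⟨t, s, he, ht, hs⟩ := h
  refine ⟨_, _, .ite_true h0 he, ?_, hs⟩
  have := hσ.test_le hi
  simp only [Prog.steps, mul_add, mul_one]
  omega

theorem Run.ite_false {i : ℕ} {p q : Prog} {σ τ : Store} (hi : i < 64) (hσ : Bounded E σ)
    (h0 : σ.mem i = 0) (h : Run E q σ τ) : Run E (.ite i p q) σ τ := by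
  obtain ⟨t, s, he, ht, hs⟩ := h
  refine ⟨_, _, .ite_false h0 he, ?_, hs⟩
  have := hσ.test_le hi
  simp only [Prog.steps, mul_add, mul_one]
  omega

/-- A run of a loop in which the body is executed `k` times. -/
theorem exec_loop {i : ℕ} {p : Prog} (hi : i < 64) {J : ℕ → Store → Prop}
    (hB : ∀ j σ, J j σ → Bounded E σ) (h0 : ∀ σ, J 0 σ → σ.mem i = 0)
    (hs : ∀ j σ, J (j + 1) σ → σ.mem i ≠ 0 ∧ ∃ τ, Run E p σ τ ∧ J j τ) (k : ℕ) (σ : Store)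
    (h : J k σ) :
    ∃ t s τ, Exec E.inp (.loop i p) σ t s τ ∧ t ≤ E.unit * (1 + k * (1 + p.steps E.N)) ∧
      s ≤ E.room ∧ J 0 τ := by
  induction k generalizing σ with
  | zero =>
    refine ⟨_, _, σ, .loop_false (h0 σ h), ?_, (hB 0 σ h).space_le, h⟩
    have := (hB 0 σ h).test_le hi
    simp only [zero_mul, add_zero, mul_one]
    omega
  | succ k ih =>
    obtain ⟨hne, τ, ⟨t, s, he, ht, hs⟩, hτ⟩ := hs k σ h
    obtain ⟨t', s', υ, he', ht', hs', hυ⟩ := ih τ hτ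
    refine ⟨_, _, υ, .loop_true hne he he', ?_, max_le hs hs', hυ⟩
    have := (hB _ σ h).test_le hi
    have e : E.unit * (1 + (k + 1) * (1 + p.steps E.N)) =
        E.unit + E.unit * p.steps E.N + E.unit * (1 + k * (1 + p.steps E.N)) := by ring
    omega

/-! ### Variables, expressions and commands -/

/-- The part of a configuration that programs refer to: the variables are the registers below 40,
`M` is the matrix, and `hd` is the position of the input head. -/
structure St where
  r : ℕ → ℕ
  M : ℕ → ℕ → ℕ
  hd : ℕ

/-- Assignment to a variable. -/
def St.set (st : St) (i v : ℕ) : St := ⟨fun j => if j = i then v else st.r j, st.M, st.hd⟩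

/-- Assignment to an entry of the matrix. -/
def St.put (st : St) (a b v : ℕ) : St :=
  ⟨st.r, fun a' b' => if a' = a ∧ b' = b then v else st.M a' b', st.hd⟩

/-- Moving the head. -/
def St.seek (st : St) (h : ℕ) : St := ⟨st.r, st.M, h⟩

@[simp] theorem St.set_r (st : St) (i v j : ℕ) :
    (st.set i v).r j = if j = i then v else st.r j := rfl
@[simp] theorem St.set_M (st : St) (i v : ℕ) : (st.set i v).M = st.M := rfl
@[simp] theorem St.set_hd (st : St) (i v : ℕ) : (st.set i v).hd = st.hd := rfl
@[simp] theorem St.put_r (st : St) (a b v : ℕ) : (st.put a b v).r = st.r := rfl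
@[simp] theorem St.put_M (st : St) (a b v a' b' : ℕ) :
    (st.put a b v).M a' b' = if a' = a ∧ b' = b then v else st.M a' b' := rfl
@[simp] theorem St.seek_r (st : St) (h : ℕ) : (st.seek h).r = st.r := rfl
@[simp] theorem St.seek_M (st : St) (h : ℕ) : (st.seek h).M = st.M := rfl
@[simp] theorem St.seek_hd (st : St) (h : ℕ) : (st.seek h).hd = h := rfl

/-- The configuration `σ` holds the data of `st`.  Register 40 contains the number of columns of
the matrix, and the registers from 41 to 63 are temporary. -/
structure Rep (E : Env) (σ : Store) (st : St) : Prop where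
  bounded : Bounded E σ
  var : ∀ i < 40, σ.mem i = st.r i
  var_le : ∀ i < 40, st.r i ≤ E.Q
  cols : σ.mem 40 = E.cols
  cell : ∀ a < E.rows, ∀ b < E.cols, σ.mem (64 + a * E.cols + b) = st.M a b
  head : σ.head = st.hd

theorem address_lt {a b R C : ℕ} (ha : a < R) (hb : b < C) : a * C + b < R * C := by
  have : (a + 1) * C ≤ R * C := Nat.mul_le_mul_right C ha
  rw [add_mul, one_mul] at this
  omega

theorem address_inj {a b a' b' C : ℕ} (hb : b < C) (hb' : b' < C)
    (h : a * C + b = a' * C + b') : a = a' ∧ b = b' := by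
  have hC : 0 < C := by omega
  have h1 : (a * C + b) / C = a := by
    rw [mul_comm, Nat.mul_add_div hC, Nat.div_eq_of_lt hb, add_zero]
  have h2 : (a' * C + b') / C = a' := by
    rw [mul_comm, Nat.mul_add_div hC, Nat.div_eq_of_lt hb', add_zero]
  have h3 : a = a' := by rw [← h1, ← h2, h]
  subst h3
  exact ⟨rfl, by omega⟩

namespace Env

variable (E : Env)

theorem size_le_bits {v : ℕ} (hv : v ≤ E.Q) : Nat.size v ≤ E.bits := by
  have := Nat.size_le_size hv
  rw [bits]
  omega

end Env

namespace Rep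

variable {σ : Store} {st : St}

theorem write_temp (h : Rep E σ st) {i v : ℕ} (hi : 41 ≤ i) (hi' : i < 64)
    (hv : Nat.size v ≤ E.bits) : Rep E (σ.write i v) st := by
  have hne : ∀ j, j ≠ i → (σ.write i v).mem j = σ.mem j := fun j hj => by
    simp [Store.write, hj]
  refine ⟨h.bounded.write_reg hi' hv, ?_, h.var_le, ?_, ?_, h.head⟩
  · intro j hj
    rw [hne j (by omega), h.var j hj]
  · rw [hne 40 (by omega), h.cols]
  · intro a ha b hb
    rw [hne _ (by omega), h.cell a ha b hb]

theorem write_var (h : Rep E σ st) {i v : ℕ} (hi : i < 40) (hv : v ≤ E.Q) :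
    Rep E (σ.write i v) (st.set i v) := by
  have hne : ∀ j, (σ.write i v).mem j = if j = i then v else σ.mem j := fun j => by
    simp [Store.write, Function.update_apply]
  refine ⟨h.bounded.write_reg (by omega) (E.size_le_bits hv), ?_, ?_, ?_, ?_, h.head⟩
  · intro j hj
    rw [hne, h.var j hj, St.set_r]
  · intro j hj
    rw [St.set_r]
    split_ifs
    · exact hv
    · exact h.var_le j hj
  · rw [hne, if_neg (by omega), h.cols]
  · intro a ha b hb
    rw [hne, if_neg (by omega), h.cell a ha b hb, St.set_M]

theorem write_cell (h : Rep E σ st) {a b v : ℕ} (ha : a < E.rows) (hb : b < E.cols)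
    (hv : v < E.m) : Rep E (σ.write (64 + a * E.cols + b) v) (st.put a b v) := by
  have hlt := address_lt ha hb
  have hne : ∀ j, (σ.write (64 + a * E.cols + b) v).mem j =
      if j = 64 + a * E.cols + b then v else σ.mem j := fun j => by
    simp [Store.write, Function.update_apply]
  refine ⟨h.bounded.write_cell (by omega) (by omega) hv, ?_, h.var_le, ?_, ?_, h.head⟩
  · intro j hj
    rw [hne, if_neg (by omega), h.var j hj, St.put_r]
  · rw [hne, if_neg (by omega), h.cols]
  · intro a' ha' b' hb'
    rw [hne, St.put_M]
    by_cases hab : a' = a ∧ b' = b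
    · obtain ⟨rfl, rfl⟩ := hab
      simp
    · rw [if_neg hab, if_neg, h.cell a' ha' b' hb']
      intro he
      exact hab (address_inj hb' hb (by omega))

theorem cell_lt (h : Rep E σ st) {a b : ℕ} (ha : a < E.rows) (hb : b < E.cols) :
    st.M a b < E.m := by
  rw [← h.cell a ha b hb]
  exact h.bounded.cell _ (by omega)

end Rep

/-- Arithmetic expressions. -/
inductive Exp where
  | var (i : ℕ)
  | lit (c : ℕ)
  | op (o : ArithOp) (a b : Exp)
  | cell (a b : Exp)

instance : Add Exp := ⟨.op .add⟩
instance : Sub Exp := ⟨.op .sub⟩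
instance : Mul Exp := ⟨.op .mul⟩
instance : Mod Exp := ⟨.op .mod⟩
instance (c : ℕ) : OfNat Exp c := ⟨.lit c⟩

namespace Exp

/-- The value of an expression. -/
def eval (st : St) : Exp → ℕ
  | var i => st.r i
  | lit c => c
  | op o a b => o.eval (a.eval st) (b.eval st)
  | cell a b => st.M (a.eval st) (b.eval st)

@[simp] theorem eval_var (st : St) (i : ℕ) : (var i).eval st = st.r i := rfl
@[simp] theorem eval_cell (st : St) (a b : Exp) :
    (cell a b).eval st = st.M (a.eval st) (b.eval st) := rfl
@[simp] theorem eval_add (st : St) (a b : Exp) : (a + b).eval st = a.eval st + b.eval st := rfl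
@[simp] theorem eval_sub (st : St) (a b : Exp) : (a - b).eval st = a.eval st - b.eval st := rfl
@[simp] theorem eval_mul (st : St) (a b : Exp) : (a * b).eval st = a.eval st * b.eval st := rfl
@[simp] theorem eval_mod (st : St) (a b : Exp) : (a % b).eval st = a.eval st % b.eval st := rfl
@[simp] theorem eval_ofNat (st : St) (c : ℕ) : (no_index (OfNat.ofNat c : Exp)).eval st = c := rfl
@[simp] theorem eval_zero (st : St) : (0 : Exp).eval st = 0 := rfl
@[simp] theorem eval_one (st : St) : (1 : Exp).eval st = 1 := rfl

/-- All accesses to the matrix are within its bounds. -/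
def InRange (E : Env) (st : St) : Exp → Prop
  | var _ => True
  | lit _ => True
  | op _ a b => a.InRange E st ∧ b.InRange E st
  | cell a b => a.InRange E st ∧ b.InRange E st ∧ a.eval st < E.rows ∧ b.eval st < E.cols

@[simp] theorem inRange_var (st : St) (i : ℕ) : (var i).InRange E st ↔ True := Iff.rfl
@[simp] theorem inRange_cell (st : St) (a b : Exp) : (cell a b).InRange E st ↔
    a.InRange E st ∧ b.InRange E st ∧ a.eval st < E.rows ∧ b.eval st < E.cols := Iff.rfl
@[simp] theorem inRange_add (st : St) (a b : Exp) :
    (a + b).InRange E st ↔ a.InRange E st ∧ b.InRange E st := Iff.rfl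
@[simp] theorem inRange_sub (st : St) (a b : Exp) :
    (a - b).InRange E st ↔ a.InRange E st ∧ b.InRange E st := Iff.rfl
@[simp] theorem inRange_mul (st : St) (a b : Exp) :
    (a * b).InRange E st ↔ a.InRange E st ∧ b.InRange E st := Iff.rfl
@[simp] theorem inRange_mod (st : St) (a b : Exp) :
    (a % b).InRange E st ↔ a.InRange E st ∧ b.InRange E st := Iff.rfl
@[simp] theorem inRange_ofNat (st : St) (c : ℕ) :
    (no_index (OfNat.ofNat c : Exp)).InRange E st ↔ True := Iff.rfl
@[simp] theorem inRange_zero (st : St) : (0 : Exp).InRange E st ↔ True := Iff.rfl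
@[simp] theorem inRange_one (st : St) : (1 : Exp).InRange E st ↔ True := Iff.rfl

/-- The expression uses variables and small constants only. -/
def wf : Exp → Bool
  | var i => decide (i < 40)
  | lit c => decide (c ≤ 64)
  | op _ a b => a.wf && b.wf
  | cell a b => a.wf && b.wf

/-- The number of leaves. -/
def weight : Exp → ℕ
  | var _ => 1
  | lit _ => 1
  | op _ a b => a.weight + b.weight
  | cell a b => a.weight + b.weight

/-- The number of temporary registers that are needed for the evaluation. -/
def height : Exp → ℕ
  | var _ => 1
  | lit _ => 1
  | op _ a b => max a.height (b.height + 1)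
  | cell a b => max a.height (b.height + 1)

/-- The expression is small enough for its values to obey the bounds, and for an evaluation in the
registers from 43 to 63. -/
def good (e : Exp) : Bool := e.wf && decide (e.weight ≤ 32) && decide (e.height ≤ 20)

theorem height_pos (e : Exp) : 0 < e.height := by
  cases e <;> simp only [height] <;> omega

theorem weight_pos (e : Exp) : 0 < e.weight := by
  induction e <;> simp only [weight] <;> omega

/-- A program that evaluates an expression into register `d`; it uses the registers from `d` on. -/
def comp : Exp → ℕ → Prog
  | var i, d => .seq (.instr (.set d 0)) (.instr (.arith .add d i d))
  | lit c, d => .instr (.set d c)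
  | op o a b, d => .seq (a.comp d) (.seq (b.comp (d + 1)) (.instr (.arith o d d (d + 1))))
  | cell a b, d =>
      .seq (a.comp d) (.seq (b.comp (d + 1)) (.seq (.instr (.arith .mul d d 40))
        (.seq (.instr (.arith .add d d (d + 1))) (.seq (.instr (.set (d + 1) 64))
          (.seq (.instr (.arith .add d (d + 1) d)) (.instr (.load d d)))))))

end Exp

theorem size_add_le (a b : ℕ) : Nat.size (a + b) ≤ Nat.size a + Nat.size b + 1 := by
  rw [Nat.size_le]
  have h1 := Nat.lt_size_self a
  have h2 := Nat.lt_size_self b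
  have h3 : 2 ^ Nat.size a ≤ 2 ^ (Nat.size a + Nat.size b) :=
    Nat.pow_le_pow_right (by norm_num) (by omega)
  have h4 : 2 ^ Nat.size b ≤ 2 ^ (Nat.size a + Nat.size b) :=
    Nat.pow_le_pow_right (by norm_num) (by omega)
  rw [pow_succ]
  omega

theorem size_mul_le (a b : ℕ) : Nat.size (a * b) ≤ Nat.size a + Nat.size b := by
  rw [Nat.size_le, pow_add]
  exact Nat.mul_lt_mul'' (Nat.lt_size_self a) (Nat.lt_size_self b)

theorem ArithOp.size_eval_le (o : ArithOp) (a b : ℕ) :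
    Nat.size (o.eval a b) ≤ Nat.size a + Nat.size b + 1 := by
  cases o with
  | add => exact size_add_le a b
  | sub =>
    have := Nat.size_le_size (Nat.sub_le a b)
    simp only [eval]
    omega
  | mul =>
    have := size_mul_le a b
    simp only [eval]
    omega
  | div =>
    have := Nat.size_le_size (Nat.div_le_self a b)
    simp only [eval]
    omega
  | mod =>
    have := Nat.size_le_size (Nat.mod_le a b)
    simp only [eval]
    omega

theorem Exp.size_eval_le {σ : Store} {st : St} (h : Rep E σ st) (e : Exp) (hwf : e.wf = true)
    (hr : e.InRange E st) : Nat.size (e.eval st) + 1 ≤ e.weight * (Nat.size E.Q + 1) := by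
  induction e with
  | var i =>
    have := Nat.size_le_size (h.var_le i (by simpa [wf] using hwf))
    simp only [eval, weight]
    omega
  | lit c =>
    have hc : c ≤ 64 := by simpa [wf] using hwf
    have := Nat.size_le_size (hc.trans (by have := E.dim_le; omega : 64 ≤ E.Q))
    simp only [eval, weight]
    omega
  | op o a b iha ihb =>
    simp only [wf, Bool.and_eq_true] at hwf
    have h1 := iha hwf.1 hr.1
    have h2 := ihb hwf.2 hr.2
    have h3 := o.size_eval_le (a.eval st) (b.eval st)
    simp only [eval, weight, add_mul]
    omega
  | cell a b iha ihb =>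
    obtain ⟨-, -, ha, hb⟩ := hr
    have h1 := Nat.size_le_size ((h.cell_lt ha hb).le.trans E.m_le)
    have h2 := a.weight_pos
    simp only [eval, weight]
    nlinarith [Nat.zero_le (b.weight * (Nat.size E.Q + 1))]

theorem Exp.run_comp {st : St} (e : Exp) (d : ℕ) (σ : Store) (h : Rep E σ st)
    (hwf : e.wf = true) (hr : e.InRange E st) (hw : e.weight ≤ 32) (hd : 41 ≤ d)
    (hh : d + e.height ≤ 64) :
    ∃ τ, Run E (e.comp d) σ τ ∧ Rep E τ st ∧ τ.mem d = e.eval st ∧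
      ∀ i < d, τ.mem i = σ.mem i := by
  have hsize : ∀ e' : Exp, e'.wf = true → e'.InRange E st → e'.weight ≤ 32 →
      Nat.size (e'.eval st) ≤ E.bits := by
    intro e' h1 h2 h3
    have h4 := e'.size_eval_le h h1 h2
    have h5 : e'.weight * (Nat.size E.Q + 1) ≤ 32 * (Nat.size E.Q + 1) :=
      Nat.mul_le_mul_right _ h3
    rw [Env.bits]
    omega
  have hwrite : ∀ (σ : Store) (i v : ℕ), (σ.write i v).mem i = v := fun σ i v => by
    simp [Store.write]
  have hwrite' : ∀ (σ : Store) (i v j : ℕ), j ≠ i → (σ.write i v).mem j = σ.mem j :=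
    fun σ i v j hj => by simp [Store.write, hj]
  induction e generalizing d σ with
  | var i =>
    have hi : i < 40 := by simpa [wf] using hwf
    simp only [height] at hh
    have h1 : Rep E (σ.write d 0) st := h.write_temp hd (by omega) (by simp)
    have h2 : Rep E ((σ.write d 0).write d (st.r i + 0)) st :=
      h1.write_temp hd (by omega) (E.size_le_bits (h.var_le i hi))
    have e2 : (Instr.arith .add d i d).exec E.inp (σ.write d 0) =
        (σ.write d 0).write d (st.r i + 0) := by
      simp only [Instr.exec, ArithOp.eval, h1.var i hi, hwrite]
    refine ⟨_, .seq (τ := σ.write d 0)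
      (.instr (a := .set d 0) (by simp only [Instr.Low]; omega) h.bounded
      h1.bounded) ?_, h2, ?_, ?_⟩
    · rw [← e2]
      exact .instr (by simp only [Instr.Low]; omega) h1.bounded (by rw [e2]; exact h2.bounded)
    · simp [hwrite]
    · intro j hj
      rw [hwrite' _ _ _ _ (by omega), hwrite' _ _ _ _ (by omega)]
  | lit c =>
    simp only [height] at hh
    have h1 : Rep E (σ.write d c) st := h.write_temp hd (by omega) (hsize _ hwf hr hw)
    exact ⟨_, .instr (a := .set d c) (by simp only [Instr.Low]; omega) h.bounded h1.bounded, h1,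
      hwrite _ _ _, fun j hj => hwrite' _ _ _ _ (by omega)⟩
  | op o a b iha ihb =>
    have hsz := hsize _ hwf hr hw
    simp only [wf, Bool.and_eq_true] at hwf
    simp only [height] at hh
    simp only [weight] at hw
    have hpos := b.height_pos
    obtain ⟨σ₁, hr₁, h₁, hv₁, hf₁⟩ := iha d σ h hwf.1 hr.1 (by omega) hd (by omega)
    obtain ⟨σ₂, hr₂, h₂, hv₂, hf₂⟩ :=
      ihb (d + 1) σ₁ h₁ hwf.2 hr.2 (by omega) (by omega) (by omega)
    have h₃ : Rep E (σ₂.write d (o.eval (a.eval st) (b.eval st))) st :=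
      h₂.write_temp hd (by omega) hsz
    have e3 : (Instr.arith o d d (d + 1)).exec E.inp σ₂ =
        σ₂.write d (o.eval (a.eval st) (b.eval st)) := by
      simp only [Instr.exec, hv₂, hf₂ d (by omega), hv₁]
    refine ⟨_, .seq hr₁ (.seq hr₂ (.instr (a := .arith o d d (d + 1)) ?_ h₂.bounded ?_)), ?_, ?_,
      ?_⟩
    · simp only [Instr.Low]
      omega
    · rw [e3]
      exact h₃.bounded
    · rw [e3]
      exact h₃
    · rw [e3, hwrite]
      rfl
    · intro j hj
      rw [e3, hwrite' _ _ _ _ (by omega), hf₂ j (by omega), hf₁ j hj]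
  | cell a b iha ihb =>
    simp only [wf, Bool.and_eq_true] at hwf
    simp only [height] at hh
    simp only [weight] at hw
    have hpos := b.height_pos
    obtain ⟨hra, hrb, ha, hb⟩ := hr
    obtain ⟨σ₁, hr₁, h₁, hv₁, hf₁⟩ := iha d σ h hwf.1 hra (by omega) hd (by omega)
    obtain ⟨σ₂, hr₂, h₂, hv₂, hf₂⟩ :=
      ihb (d + 1) σ₁ h₁ hwf.2 hrb (by omega) (by omega) (by omega)
    set x := a.eval st
    set y := b.eval st
    have hlt := address_lt ha hb
    have hdim := E.dim_le
    have h₃ : Rep E (σ₂.write d (x * E.cols)) st :=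
      h₂.write_temp hd (by omega) (E.size_le_bits (by omega))
    have e3 : (Instr.arith .mul d d 40).exec E.inp σ₂ = σ₂.write d (x * E.cols) := by
      simp only [Instr.exec, ArithOp.eval, hf₂ d (by omega), hv₁, h₂.cols]
    set σ₃ := σ₂.write d (x * E.cols) with hσ₃
    have h₄ : Rep E (σ₃.write d (x * E.cols + y)) st :=
      h₃.write_temp hd (by omega) (E.size_le_bits (by omega))
    have e4 : (Instr.arith .add d d (d + 1)).exec E.inp σ₃ = σ₃.write d (x * E.cols + y) := by
      simp only [Instr.exec, ArithOp.eval, hσ₃, hwrite, hwrite' _ d _ (d + 1) (by omega), hv₂]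
    set σ₄ := σ₃.write d (x * E.cols + y) with hσ₄
    have h₅ : Rep E (σ₄.write (d + 1) 64) st :=
      h₄.write_temp (by omega) (by omega) (E.size_le_bits (by omega))
    set σ₅ := σ₄.write (d + 1) 64 with hσ₅
    have h₆ : Rep E (σ₅.write d (64 + x * E.cols + y)) st :=
      h₅.write_temp hd (by omega) (E.size_le_bits (by omega))
    have e6 : (Instr.arith .add d (d + 1) d).exec E.inp σ₅ =
        σ₅.write d (64 + x * E.cols + y) := by
      simp only [Instr.exec, ArithOp.eval, hσ₅, hwrite, hwrite' _ (d + 1) _ d (by omega), hσ₄,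
        add_assoc]
    set σ₆ := σ₅.write d (64 + x * E.cols + y) with hσ₆
    have h₇ : Rep E (σ₆.write d (st.M x y)) st :=
      h₆.write_temp hd (by omega) (E.size_le_bits ((h.cell_lt ha hb).le.trans E.m_le))
    have e7 : (Instr.load d d).exec E.inp σ₆ = σ₆.write d (st.M x y) := by
      have hv : σ₆.mem d = 64 + x * E.cols + y := by rw [hσ₆, hwrite]
      simp only [Instr.exec, hv, h₆.cell x ha y hb]
    refine ⟨σ₆.write d (st.M x y), .seq hr₁ (.seq hr₂ (.seq (τ := σ₃) ?_ (.seq (τ := σ₄) ?_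
      (.seq (τ := σ₅) ?_ (.seq (τ := σ₆) ?_ ?_))))), h₇, ?_, ?_⟩
    · rw [← e3]
      exact .instr (by simp only [Instr.Low]; omega) h₂.bounded (by rw [e3]; exact h₃.bounded)
    · rw [← e4]
      exact .instr (by simp only [Instr.Low]; omega) h₃.bounded (by rw [e4]; exact h₄.bounded)
    · exact .instr (a := .set (d + 1) 64) (by simp only [Instr.Low]; omega) h₄.bounded h₅.bounded
    · rw [← e6]
      exact .instr (by simp only [Instr.Low]; omega) h₅.bounded (by rw [e6]; exact h₆.bounded)
    · rw [← e7]
      exact .instr (by simp only [Instr.Low]; omega) h₆.bounded (by rw [e7]; exact h₇.bounded)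
    · rw [hwrite]
      rfl
    · intro j hj
      rw [hwrite' _ _ _ _ (by omega), hσ₆, hwrite' _ _ _ _ (by omega), hσ₅,
        hwrite' _ _ _ _ (by omega), hσ₄, hwrite' _ _ _ _ (by omega), hσ₃,
        hwrite' _ _ _ _ (by omega), hf₂ j (by omega), hf₁ j hj]

/-- `x := e` -/
def asg (x : ℕ) (e : Exp) : Prog :=
  .seq (e.comp 41) (.seq (.instr (.set 42 0)) (.instr (.arith .add x 41 42)))

/-- `M a b := e` -/
def put (a b e : Exp) : Prog :=
  .seq (e.comp 41) (.seq (a.comp 42) (.seq (b.comp 43) (.seq (.instr (.arith .mul 42 42 40))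
    (.seq (.instr (.arith .add 42 42 43)) (.seq (.instr (.set 43 64))
      (.seq (.instr (.arith .add 42 43 42)) (.instr (.store 42 41))))))))

/-- Put the input head at position `e`. -/
def seekTo (e : Exp) : Prog := .seq (e.comp 41) (.instr (.seek 41))

/-- `x :=` the input entry at position `e` -/
def readAt (x : ℕ) (e : Exp) : Prog := .seq (seekTo e) (.instr (.read x))

/-- if `e ≠ 0` then `p` else `q` -/
def cond (e : Exp) (p q : Prog) : Prog := .seq (e.comp 41) (.ite 41 p q)

/-- while `e ≠ 0` do `p` -/
def while' (e : Exp) (p : Prog) : Prog := .seq (e.comp 41) (.loop 41 (.seq p (e.comp 41)))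

/-- for `x = 0, …, e - 1` do `p` -/
def for' (x : ℕ) (e : Exp) (p : Prog) : Prog :=
  .seq (asg x 0) (while' (e - .var x) (.seq p (asg x (.var x + 1))))

/-- Nothing is done. -/
def skip : Prog := .instr (.set 41 0)

/-- From every configuration that holds `st`, the program `p` leads within the bounds of the run to
a configuration that holds some `st'` with `P st'`. -/
def WP (E : Env) (p : Prog) (P : St → Prop) (st : St) : Prop :=
  ∀ σ, Rep E σ st → ∃ τ st', Run E p σ τ ∧ Rep E τ st' ∧ P st'

theorem WP.mono {p : Prog} {P P' : St → Prop} {st : St} (h : WP E p P st)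
    (hP : ∀ st', P st' → P' st') : WP E p P' st := by
  intro σ hσ
  obtain ⟨τ, st', h1, h2, h3⟩ := h σ hσ
  exact ⟨τ, st', h1, h2, hP _ h3⟩

/-- The bounds of the run may be used at any point. -/
theorem WP.of_bounds {p : Prog} {P : St → Prop} {st : St}
    (h : (∀ i < 40, st.r i ≤ E.Q) → (∀ a < E.rows, ∀ b < E.cols, st.M a b < E.m) →
      WP E p P st) : WP E p P st := by
  intro σ hσ
  exact h hσ.var_le (fun a ha b hb => hσ.cell_lt ha hb) σ hσ

theorem WP.seq {p q : Prog} {P : St → Prop} {st : St} (h : WP E p (WP E q P) st) :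
    WP E (.seq p q) P st := by
  intro σ hσ
  obtain ⟨τ, st', h1, h2, h3⟩ := h σ hσ
  obtain ⟨υ, st'', h4, h5, h6⟩ := h3 τ h2
  exact ⟨υ, st'', h1.seq h4, h5, h6⟩

theorem Exp.run_comp_of_good {st : St} {e : Exp} {d : ℕ} {σ : Store} (h : Rep E σ st)
    (hg : e.good = true) (hr : e.InRange E st) (hd : 41 ≤ d) (hd' : d ≤ 43) :
    ∃ τ, Run E (e.comp d) σ τ ∧ Rep E τ st ∧ τ.mem d = e.eval st ∧
      ∀ i < d, τ.mem i = σ.mem i := by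
  simp only [Exp.good, Bool.and_eq_true, decide_eq_true_eq] at hg
  exact e.run_comp d σ h hg.1.1 hr hg.1.2 hd (by omega)

theorem WP.asg {x : ℕ} {e : Exp} {P : St → Prop} {st : St} (hx : x < 40) (hg : e.good = true)
    (hr : e.InRange E st) (hv : e.eval st ≤ E.Q) (hP : P (st.set x (e.eval st))) :
    WP E (asg x e) P st := by
  intro σ hσ
  obtain ⟨σ₁, hr₁, h₁, hv₁, -⟩ := Exp.run_comp_of_good (d := 41) hσ hg hr le_rfl (by norm_num)
  have h₂ : Rep E (σ₁.write 42 0) st := h₁.write_temp (by norm_num) (by norm_num) (by simp)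
  have h₃ := h₂.write_var hx hv
  have e3 : (Instr.arith .add x 41 42).exec E.inp (σ₁.write 42 0) =
      (σ₁.write 42 0).write x (e.eval st) := by
    simp [Instr.exec, ArithOp.eval, Store.write, hv₁]
  refine ⟨_, _, .seq hr₁ (.seq (τ := σ₁.write 42 0)
    (.instr (a := .set 42 0) ?_ h₁.bounded h₂.bounded) ?_), h₃, hP⟩
  · simp [Instr.Low]
  · rw [← e3]
    exact .instr (by simp only [Instr.Low]; omega) h₂.bounded (by rw [e3]; exact h₃.bounded)

theorem WP.put {a b e : Exp} {P : St → Prop} {st : St} (hg : e.good = true)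
    (hga : a.good = true) (hgb : b.good = true)
    (hr : e.InRange E st) (hra : a.InRange E st) (hrb : b.InRange E st)
    (ha : a.eval st < E.rows) (hb : b.eval st < E.cols) (hv : e.eval st < E.m)
    (hP : P (st.put (a.eval st) (b.eval st) (e.eval st))) :
    WP E (put a b e) P st := by
  intro σ hσ
  have hwrite : ∀ (σ : Store) (i v : ℕ), (σ.write i v).mem i = v := fun σ i v => by
    simp [Store.write]
  have hwrite' : ∀ (σ : Store) (i v j : ℕ), j ≠ i → (σ.write i v).mem j = σ.mem j :=
    fun σ i v j hj => by simp [Store.write, hj]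
  obtain ⟨σ₀, hr₀, h₀, hv₀, -⟩ := Exp.run_comp_of_good (d := 41) hσ hg hr le_rfl (by norm_num)
  obtain ⟨σ₁, hr₁, h₁, hv₁, hf₁⟩ :=
    Exp.run_comp_of_good (d := 42) h₀ hga hra (by norm_num) (by norm_num)
  obtain ⟨σ₂, hr₂, h₂, hv₂, hf₂⟩ :=
    Exp.run_comp_of_good (d := 43) h₁ hgb hrb (by norm_num) (by norm_num)
  set x := a.eval st
  set y := b.eval st
  set z := e.eval st
  have hlt := address_lt ha hb
  have hdim := E.dim_le
  have h₃ : Rep E (σ₂.write 42 (x * E.cols)) st :=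
    h₂.write_temp (by norm_num) (by norm_num) (E.size_le_bits (by omega))
  have e3 : (Instr.arith .mul 42 42 40).exec E.inp σ₂ = σ₂.write 42 (x * E.cols) := by
    simp only [Instr.exec, ArithOp.eval, hf₂ 42 (by omega), hv₁, h₂.cols]
  set σ₃ := σ₂.write 42 (x * E.cols) with hσ₃
  have h₄ : Rep E (σ₃.write 42 (x * E.cols + y)) st :=
    h₃.write_temp (by norm_num) (by norm_num) (E.size_le_bits (by omega))
  have e4 : (Instr.arith .add 42 42 43).exec E.inp σ₃ = σ₃.write 42 (x * E.cols + y) := by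
    simp only [Instr.exec, ArithOp.eval, hσ₃, hwrite, hwrite' _ 42 _ 43 (by omega), hv₂]
  set σ₄ := σ₃.write 42 (x * E.cols + y) with hσ₄
  have h₅ : Rep E (σ₄.write 43 64) st :=
    h₄.write_temp (by norm_num) (by norm_num) (E.size_le_bits (by omega))
  set σ₅ := σ₄.write 43 64 with hσ₅
  have h₆ : Rep E (σ₅.write 42 (64 + x * E.cols + y)) st :=
    h₅.write_temp (by norm_num) (by norm_num) (E.size_le_bits (by omega))
  have e6 : (Instr.arith .add 42 43 42).exec E.inp σ₅ =
      σ₅.write 42 (64 + x * E.cols + y) := by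
    simp only [Instr.exec, ArithOp.eval, hσ₅, hwrite, hwrite' _ 43 _ 42 (by omega), hσ₄,
      add_assoc]
  set σ₆ := σ₅.write 42 (64 + x * E.cols + y) with hσ₆
  have h₇ := h₆.write_cell ha hb hv
  have e7 : (Instr.store 42 41).exec E.inp σ₆ = σ₆.write (64 + x * E.cols + y) z := by
    have hz : σ₆.mem 41 = z := by
      rw [hσ₆, hwrite' _ _ _ _ (by omega), hσ₅, hwrite' _ _ _ _ (by omega), hσ₄,
        hwrite' _ _ _ _ (by omega), hσ₃, hwrite' _ _ _ _ (by omega), hf₂ _ (by omega),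
        hf₁ _ (by omega), hv₀]
    have hv : σ₆.mem 42 = 64 + x * E.cols + y := by rw [hσ₆, hwrite]
    simp only [Instr.exec, hv, hz]
  refine ⟨σ₆.write (64 + x * E.cols + y) z, _, .seq hr₀ (.seq hr₁ (.seq hr₂ (.seq (τ := σ₃) ?_
    (.seq (τ := σ₄) ?_ (.seq (τ := σ₅) ?_ (.seq (τ := σ₆) ?_ ?_)))))), h₇, hP⟩
  · rw [← e3]
    exact .instr (by simp only [Instr.Low]; omega) h₂.bounded (by rw [e3]; exact h₃.bounded)
  · rw [← e4]
    exact .instr (by simp only [Instr.Low]; omega) h₃.bounded (by rw [e4]; exact h₄.bounded)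
  · exact .instr (a := .set 43 64) (by simp only [Instr.Low]; omega) h₄.bounded h₅.bounded
  · rw [← e6]
    exact .instr (by simp only [Instr.Low]; omega) h₅.bounded (by rw [e6]; exact h₆.bounded)
  · rw [← e7]
    exact .instr (by simp only [Instr.Low]; omega) h₆.bounded (by rw [e7]; exact h₇.bounded)

theorem WP.seekTo {e : Exp} {P : St → Prop} {st : St} (hg : e.good = true)
    (hr : e.InRange E st) (hP : P (st.seek (e.eval st))) : WP E (seekTo e) P st := by
  intro σ hσ
  obtain ⟨σ₁, hr₁, h₁, hv₁, -⟩ := Exp.run_comp_of_good (d := 41) hσ hg hr le_rfl (by norm_num)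
  have h₂ : Rep E ⟨σ₁.mem, σ₁.top, e.eval st⟩ (st.seek (e.eval st)) :=
    ⟨⟨h₁.bounded.top_le, h₁.bounded.reg, h₁.bounded.cell⟩, h₁.var, h₁.var_le, h₁.cols, h₁.cell,
      rfl⟩
  have e2 : (Instr.seek 41).exec E.inp σ₁ = ⟨σ₁.mem, σ₁.top, e.eval st⟩ := by
    simp only [Instr.exec, hv₁]
  refine ⟨_, _, .seq hr₁ ?_, h₂, hP⟩
  rw [← e2]
  exact .instr (by simp [Instr.Low]) h₁.bounded (by rw [e2]; exact h₂.bounded)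

theorem WP.read {x : ℕ} {P : St → Prop} {st : St} (hx : x < 40)
    (hv : E.inp.getD st.hd 0 ≤ E.Q) (hP : P (st.set x (E.inp.getD st.hd 0))) :
    WP E (.instr (.read x)) P st := by
  intro σ hσ
  have h₁ := hσ.write_var hx hv
  have e1 : (Instr.read x).exec E.inp σ = σ.write x (E.inp.getD st.hd 0) := by
    simp only [Instr.exec, hσ.head]
  refine ⟨_, _, ?_, h₁, hP⟩
  rw [← e1]
  exact .instr (by simp only [Instr.Low]; omega) hσ.bounded (by rw [e1]; exact h₁.bounded)

theorem WP.next {P : St → Prop} {st : St} (hP : P (st.seek (st.hd + 1))) :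
    WP E (.instr .next) P st := by
  intro σ hσ
  have h₁ : Rep E ⟨σ.mem, σ.top, σ.head + 1⟩ (st.seek (st.hd + 1)) :=
    ⟨⟨hσ.bounded.top_le, hσ.bounded.reg, hσ.bounded.cell⟩, hσ.var, hσ.var_le, hσ.cols, hσ.cell,
      by simp [hσ.head]⟩
  exact ⟨_, _, .instr (a := .next) trivial hσ.bounded h₁.bounded, h₁, hP⟩

theorem WP.readAt {x : ℕ} {e : Exp} {P : St → Prop} {st : St} (hx : x < 40)
    (hg : e.good = true) (hr : e.InRange E st) (v : ℕ) (hv : E.inp.getD (e.eval st) 0 = v)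
    (hvQ : v ≤ E.Q) (hP : P ((st.seek (e.eval st)).set x v)) :
    WP E (readAt x e) P st := by
  subst hv
  exact WP.seq (WP.seekTo hg hr (WP.read hx hvQ hP))

theorem WP.skip {P : St → Prop} {st : St} (hP : P st) : WP E skip P st := by
  intro σ hσ
  have h₁ : Rep E (σ.write 41 0) st := hσ.write_temp (by norm_num) (by norm_num) (by simp)
  exact ⟨_, _, .instr (a := .set 41 0) (by simp [Instr.Low]) hσ.bounded h₁.bounded, h₁, hP⟩

theorem WP.cond {e : Exp} {p q : Prog} {P : St → Prop} {st : St} (hg : e.good = true)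
    (hr : e.InRange E st) (hp : e.eval st ≠ 0 → WP E p P st) (hq : e.eval st = 0 → WP E q P st) :
    WP E (cond e p q) P st := by
  intro σ hσ
  obtain ⟨σ₁, hr₁, h₁, hv₁, -⟩ := Exp.run_comp_of_good (d := 41) hσ hg hr le_rfl (by norm_num)
  by_cases h0 : e.eval st = 0
  · obtain ⟨τ, st', h2, h3, h4⟩ := hq h0 σ₁ h₁
    exact ⟨τ, st', .seq hr₁ (.ite_false (by norm_num) h₁.bounded (by rw [hv₁, h0]) h2), h3, h4⟩
  · obtain ⟨τ, st', h2, h3, h4⟩ := hp h0 σ₁ h₁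
    exact ⟨τ, st', .seq hr₁ (.ite_true (by norm_num) h₁.bounded (by rwa [hv₁]) h2), h3, h4⟩

/-- The rule for loops; the invariant `I` is indexed by the number of iterations that remain. -/
theorem WP.while' {e : Exp} {p : Prog} {P : St → Prop} {st : St} (I : ℕ → St → Prop) (k : ℕ)
    (hk : k ≤ E.N) (hg : e.good = true) (hr : ∀ j st, I j st → e.InRange E st) (hI : I k st)
    (h0 : ∀ st, I 0 st → e.eval st = 0 ∧ P st)
    (hs : ∀ j st, I (j + 1) st → e.eval st ≠ 0 ∧ WP E p (I j) st) :
    WP E (while' e p) P st := by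
  intro σ hσ
  obtain ⟨σ₁, hr₁, h₁, hv₁, -⟩ :=
    Exp.run_comp_of_good (d := 41) hσ hg (hr _ _ hI) le_rfl (by norm_num)
  obtain ⟨t, s, τ, he, ht, hs', st', hτ, -, hI0⟩ := exec_loop (E := E) (i := 41)
    (p := .seq p (e.comp 41)) (by norm_num)
    (J := fun j σ => ∃ st, Rep E σ st ∧ σ.mem 41 = e.eval st ∧ I j st)
    (fun j σ ⟨st, h, _⟩ => h.bounded)
    (fun σ ⟨st, _, h, hI⟩ => by rw [h, (h0 st hI).1])
    (fun j σ ⟨st, h, hv, hI⟩ => by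
      obtain ⟨hne, hwp⟩ := hs j st hI
      obtain ⟨τ, st', h2, h3, h4⟩ := hwp σ h
      obtain ⟨τ', h5, h6, h7, -⟩ :=
        Exp.run_comp_of_good (d := 41) h3 hg (hr _ _ h4) le_rfl (by norm_num)
      exact ⟨by rwa [hv], τ', h2.seq h5, st', h6, h7, h4⟩)
    k σ₁ ⟨st, h₁, hv₁, hI⟩
  refine ⟨τ, st', .seq hr₁ ⟨t, s, he, ht.trans ?_, hs'⟩, hτ, (h0 st' hI0).2⟩
  simp only [Prog.steps]
  gcongr

/-- The rule for counting loops. -/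
theorem WP.for' {x : ℕ} {e : Exp} {p : Prog} {P : St → Prop} {st : St} (I : ℕ → St → Prop)
    (k : ℕ) (hx : x < 40) (hk : k ≤ E.N) (hkQ : k ≤ E.Q) (hg : (e - .var x).good = true)
    (he : ∀ i st, I i st → e.InRange E st ∧ e.eval st = k)
    (h0 : I 0 (st.set x 0))
    (hs : ∀ i < k, ∀ st, I i st → st.r x = i →
      WP E p (fun st' => st'.r x = i ∧ I (i + 1) (st'.set x (i + 1))) st)
    (hP : ∀ st, I k st → st.r x = k → P st) : WP E (for' x e p) P st := by
  refine WP.seq (WP.asg hx rfl trivial (Nat.zero_le _) ?_)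
  refine WP.while' (fun j st => j ≤ k ∧ st.r x = k - j ∧ I (k - j) st) k hk hg ?_ ?_ ?_ ?_
  · rintro j st ⟨-, -, hI⟩
    exact ⟨(he _ _ hI).1, trivial⟩
  · refine ⟨le_rfl, ?_, ?_⟩
    · simp
    · simpa using h0
  · rintro st ⟨-, hx, hI⟩
    rw [Nat.sub_zero] at hx hI
    refine ⟨?_, hP st hI hx⟩
    rw [Exp.eval_sub, (he _ _ hI).2, Exp.eval_var, hx, Nat.sub_self]
  · rintro j st ⟨hj, hxj, hI⟩
    refine ⟨?_, WP.seq ((hs (k - (j + 1)) (by omega) st hI hxj).mono ?_)⟩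
    · rw [Exp.eval_sub, (he _ _ hI).2, Exp.eval_var, hxj]
      omega
    · rintro st' ⟨hx', hI'⟩
      have hsum : k - (j + 1) + 1 = k - j := by omega
      have hev : (Exp.var x + 1).eval st' = k - j := by
        rw [Exp.eval_add, Exp.eval_var, hx', Exp.eval_one, hsum]
      have hgood : (Exp.var x + 1).good = true := by
        show Exp.good (.op .add (.var x) (.lit 1)) = true
        simp [Exp.good, Exp.wf, Exp.weight, Exp.height, hx]
      refine WP.asg hx hgood ⟨trivial, trivial⟩ (by omega) ?_
      rw [hev]
      rw [hsum] at hI'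
      exact ⟨by omega, by simp, hI'⟩

end RAM

/-! ### Reading the input -/

namespace RAM

theorem getD_append_add (l r : List ℕ) (i : ℕ) :
    (l ++ r).getD (l.length + i) 0 = r.getD i 0 := by
  rw [List.getD_append_right _ _ _ _ (by omega)]
  congr 1
  omega

theorem getD_ofFn_append {k : ℕ} (f : Fin k → ℕ) (r : List ℕ) (i : Fin k) :
    (List.ofFn f ++ r).getD i 0 = f i := by
  rw [List.getD_append _ _ _ _ (by simp)]
  simp

theorem length_flatten_of_forall {w : ℕ} (l : List (List ℕ)) (hl : ∀ a ∈ l, a.length = w) :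
    l.flatten.length = l.length * w := by
  induction l with
  | nil => simp
  | cons a l ih =>
    rw [List.flatten_cons, List.length_append, hl a (by simp),
      ih fun b hb => hl b (by simp [hb]), List.length_cons, add_mul, one_mul, add_comm]

theorem getD_flatten {w : ℕ} (l : List (List ℕ)) (hl : ∀ a ∈ l, a.length = w) (r : List ℕ)
    {i j : ℕ} (hi : i < l.length) (hj : j < w) :
    (l.flatten ++ r).getD (i * w + j) 0 = l[i].getD j 0 := by
  induction l generalizing i with
  | nil => simp at hi
  | cons a l ih =>
    have ha : a.length = w := hl a (by simp)
    rw [List.flatten_cons, List.append_assoc]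
    cases i with
    | zero =>
      rw [zero_mul, zero_add, List.getD_append _ _ _ _ (by omega)]
      rfl
    | succ i =>
      have e : (i + 1) * w + j = a.length + (i * w + j) := by rw [ha]; ring
      rw [e, getD_append_add]
      exact ih (fun b hb => hl b (by simp [hb])) (by simpa using hi)

theorem getD_flatten_ofFn {k w : ℕ} (f : Fin k → List ℕ) (hf : ∀ i, (f i).length = w)
    (r : List ℕ) (i : Fin k) {j : ℕ} (hj : j < w) :
    ((List.ofFn f).flatten ++ r).getD (i * w + j) 0 = (f i).getD j 0 := by
  rw [getD_flatten (List.ofFn f) (w := w) (by simpa using hf) r (by simp) hj]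
  simp

theorem length_flatten_ofFn {k w : ℕ} (f : Fin k → List ℕ) (hf : ∀ i, (f i).length = w) :
    (List.ofFn f).flatten.length = k * w := by
  rw [length_flatten_of_forall (w := w) _ (by simpa using hf), List.length_ofFn]

theorem length_encodeSet {n : ℕ} (A : Finset (Fin n)) : (encodeSet A).length = n := by
  simp [encodeSet]

theorem length_gate_encode {n s : ℕ} (g : Gate n s) : g.encode.length = n + 5 := by
  cases g <;> simp only [Gate.encode, List.length_append, List.length_cons, List.length_nil,
    length_encodeSet] <;> omega

theorem getD_encodeSet {n : ℕ} (A : Finset (Fin n)) (v : Fin n) :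
    (encodeSet A).getD v 0 = if v ∈ A then 1 else 0 := by
  simp [encodeSet]

section Instance

variable {n : ℕ} {G : SimpleGraph (Fin n)} {t : ℕ} {T : TreeDecomp G t} {s : ℕ}
  (C : Circuit T s) (m : ℕ)

theorem length_encodeGraph (G : SimpleGraph (Fin n)) : (encodeGraph G).length = n * n :=
  length_flatten_ofFn _ fun _ => length_encodeSet _

/-- The instance without the header and the graph. -/
theorem getD_instance_tree (i : ℕ) :
    (encodeInstance G T C m).getD (6 + n * n + i) 0 =
      (encodeTree T ++ encodeCircuit C).getD i 0 := by
  have h := getD_append_add ([n, t, s, m, (T.root : ℕ), (C.out : ℕ)] ++ encodeGraph G)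
    (encodeTree T ++ encodeCircuit C) i
  rw [List.length_append, length_encodeGraph] at h
  rw [encodeInstance, List.append_assoc _ (encodeTree T)]
  exact h

theorem getD_instance_parent (x : Fin t) :
    (encodeInstance G T C m).getD (6 + n * n + x) 0 = T.parent x := by
  rw [getD_instance_tree, encodeTree, List.append_assoc]
  exact getD_ofFn_append (fun x => (T.parent x : ℕ)) _ x

theorem getD_instance_bag (x : Fin t) (v : Fin n) :
    (encodeInstance G T C m).getD (6 + n * n + t + x * n + v) 0 =
      if v ∈ T.bag x then 1 else 0 := by
  have h := getD_append_add (List.ofFn fun x => (T.parent x : ℕ))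
    ((List.ofFn fun x => encodeSet (T.bag x)).flatten ++ encodeCircuit C) (x * n + v)
  rw [List.length_ofFn] at h
  rw [add_assoc (6 + n * n + t), add_assoc (6 + n * n), getD_instance_tree, encodeTree,
    List.append_assoc, h, getD_flatten_ofFn _ (fun x => length_encodeSet (T.bag x)) _ _ v.2,
    getD_encodeSet]

theorem length_encodeTree (T : TreeDecomp G t) : (encodeTree T).length = t + t * n := by
  rw [encodeTree, List.length_append, List.length_ofFn,
    length_flatten_ofFn _ fun x => length_encodeSet (T.bag x)]

theorem getD_instance_circuit (i : ℕ) :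
    (encodeInstance G T C m).getD (6 + n * n + t + t * n + i) 0 = (encodeCircuit C).getD i 0 := by
  have h := getD_append_add (encodeTree T) (encodeCircuit C) i
  rw [length_encodeTree] at h
  rw [← h, ← getD_instance_tree C m (t + t * n + i)]
  congr 1
  omega

theorem getD_instance_gate (g : Fin s) {i : ℕ} (hi : i < n + 6) :
    (encodeInstance G T C m).getD (6 + n * n + t + t * n + g * (n + 6) + i) 0 =
      ((C.node g : ℕ) :: (C.gate g).encode).getD i 0 := by
  rw [add_assoc (6 + n * n + t + t * n), getD_instance_circuit, encodeCircuit,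
    getD_flatten_ofFn _ (fun g => by rw [List.length_cons, length_gate_encode]) _ g hi]

theorem getD_instance_node (g : Fin s) :
    (encodeInstance G T C m).getD (6 + n * n + t + t * n + g * (n + 6) + 0) 0 = C.node g := by
  rw [getD_instance_gate C m g (by omega)]
  rfl

theorem getD_instance_constSet {g : Fin s} {A : Finset (Fin n)} {a : ℤ}
    (hg : C.gate g = .const A a) (v : Fin n) :
    (encodeInstance G T C m).getD (6 + n * n + t + t * n + g * (n + 6) + (6 + v)) 0 =
      if v ∈ A then 1 else 0 := by
  rw [getD_instance_gate C m g (by omega), hg, Gate.encode, ← List.cons_append]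
  have h := getD_append_add ((C.node g : ℕ) :: [0, 0, 0, 0, 0]) (encodeSet A) v
  rw [← getD_encodeSet A v]
  exact h

/-- The part of the input that holds the values of the constants of the gates from `g` on. -/
def coeffs (C : Circuit T s) (g : ℕ) : List ℕ :=
  ((List.ofFn fun g => encodeInt (C.gate g).coeff).drop g).flatten

theorem coeffs_eq (g : Fin s) :
    coeffs C g = encodeInt (C.gate g).coeff ++ coeffs C (g + 1) := by
  rw [coeffs, coeffs, List.drop_eq_getElem_cons (by simp)]
  simp

theorem drop_instance_coeffs :
    (encodeInstance G T C m).drop (6 + n * n + t + t * n + s * (n + 6)) = coeffs C 0 := by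
  have hlen : ([n, t, s, m, (T.root : ℕ), (C.out : ℕ)] ++ encodeGraph G ++ encodeTree T ++
      (List.ofFn fun g => (C.node g : ℕ) :: (C.gate g).encode).flatten).length =
      6 + n * n + t + t * n + s * (n + 6) := by
    rw [List.length_append, List.length_append, List.length_append, length_encodeGraph,
      length_encodeTree,
      length_flatten_ofFn _ (fun g => show ((C.node g : ℕ) :: (C.gate g).encode).length = n + 6 by
        rw [List.length_cons, length_gate_encode])]
    simp only [List.length_cons, List.length_nil]
    omega
  rw [encodeInstance, encodeCircuit, ← List.append_assoc, ← hlen, List.drop_left, coeffs,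
    List.drop_zero]

theorem length_le_bitLength (l : List ℕ) : l.length ≤ bitLength l := by
  induction l with
  | nil => simp
  | cons a l ih =>
    simp only [bitLength, List.map_cons, List.sum_cons, List.length_cons] at ih ⊢
    omega

theorem size_le_bitLength {l : List ℕ} {a : ℕ} (h : a ∈ l) : Nat.size a ≤ bitLength l := by
  induction l with
  | nil => simp at h
  | cons b l ih =>
    simp only [bitLength, List.map_cons, List.sum_cons]
    rcases List.mem_cons.1 h with rfl | h
    · omega
    · have := ih h
      rw [bitLength] at this
      omega

theorem le_length_instance :
    6 + n * n + t + t * n + s * (n + 6) ≤ (encodeInstance G T C m).length := by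
  rw [encodeInstance, encodeCircuit]
  simp only [List.length_append, length_encodeGraph, length_encodeTree,
    length_flatten_ofFn (k := s) _
      (fun g => show ((C.node g : ℕ) :: (C.gate g).encode).length = n + 6 by
        rw [List.length_cons, length_gate_encode]), List.length_cons, List.length_nil]
  omega

theorem card_nodes_le (C : Circuit T s) : t ≤ s := by
  simpa using Fintype.card_le_of_surjective C.node C.node_surjective

end Instance

end RAM

/-! ### The program

Variables:
* 1–6: the header `n`, `t`, `s`, `m`, the root and the output gate;
* 7, 8, 9: the current node, the next child to be considered, and whether the traversal goes on;
* 10–13: the parent of the current node, and the numbers of forgotten vertices;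
* 14–19: loops over vertices and gates; 20–38: the evaluation of a single gate.

Rows of the matrix:
* 0: the current set; 1 and 2: the operands of the current gate;
* `3 + g`: the zeta transform of gate `g` at the current set; `3 + s + g`: its accumulator. -/

namespace RAM

/-- `§i` is the variable `i`. -/
prefix:max "§" => RAM.Exp.var

/-- The value of `neExp a b` is `0` if `a` and `b` have the same value, and `1` otherwise. -/
def neExp (a b : Exp) : Exp := 1 - (1 - ((a - b) + (b - a)))

/-- The value of `eqExp a b` is `1` if `a` and `b` have the same value, and `0` otherwise. -/
def eqExp (a b : Exp) : Exp := 1 - ((a - b) + (b - a))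

@[simp] theorem eval_neExp (st : St) (a b : Exp) :
    (neExp a b).eval st = if a.eval st = b.eval st then 0 else 1 := by
  simp only [neExp, Exp.eval_sub, Exp.eval_add, Exp.eval_one]
  split_ifs <;> omega

@[simp] theorem eval_eqExp (st : St) (a b : Exp) :
    (eqExp a b).eval st = if a.eval st = b.eval st then 1 else 0 := by
  simp only [eqExp, Exp.eval_sub, Exp.eval_add, Exp.eval_one]
  split_ifs <;> omega

@[simp] theorem inRange_neExp {E : Env} (st : St) (a b : Exp) :
    (neExp a b).InRange E st ↔ a.InRange E st ∧ b.InRange E st := by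
  simp [neExp]
  tauto

@[simp] theorem inRange_eqExp {E : Env} (st : St) (a b : Exp) :
    (eqExp a b).InRange E st ↔ a.InRange E st ∧ b.InRange E st := by
  simp [eqExp]
  tauto

/-- The position of the parent of node `x` in the input. -/
def parentPos (x : Exp) : Exp := 6 + §1 * §1 + x

/-- The position of the entry for vertex `v` in the bag of node `x`. -/
def bagPos (x v : Exp) : Exp := 6 + §1 * §1 + §2 + x * §1 + v

/-- The position of entry `i` in the description of gate `g`. -/
def gatePos (g i : Exp) : Exp := 6 + §1 * §1 + §2 + §2 * §1 + g * (§1 + 6) + i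

/-- The position where the values of the constants begin. -/
def coeffPos : Exp := 6 + §1 * §1 + §2 + §2 * §1 + §3 * (§1 + 6)

/-- Variable 15 becomes `1` if vertex 14 is forgotten at node 7, and `0` otherwise; variable 10 is
the parent of node 7. -/
def testForgotten : Prog :=
  .seq (readAt 15 (bagPos §7 §14)) <| .seq (readAt 16 (bagPos §10 §14)) <|
    asg 15 (§15 - §16 * neExp §7 §5)

/-- Variables 11, 12 and 13 count the vertices that are forgotten at node 7, those outside the
current set, those in the current set, and all of them, respectively. -/
def countForgotten : Prog :=
  .seq (asg 11 0) <| .seq (asg 12 0) <| .seq (asg 13 0) <| for' 14 §1 <|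
    .seq testForgotten <| .seq (asg 11 (§11 + §15 * (1 - .cell 0 §14))) <|
      .seq (asg 12 (§12 + §15 * .cell 0 §14)) (asg 13 (§13 + §15))

/-- Execute `p` for every digit of a number; variable 31 holds the digit under the head. -/
def scanDigits (p : Prog) : Prog :=
  .seq (.instr (.read 31)) (while' (2 - §31) (.seq p (.seq (.instr .next) (.instr (.read 31)))))

/-- Variable 28 becomes the value of the constant gate 18 modulo `m`.  The positions of the digits
are not stored, since they need not fit into the work space. -/
def readCoeff : Prog :=
  .seq (seekTo coeffPos) <|
  .seq (for' 30 §18 (.seq (.instr .next) <| .seq (scanDigits skip) (.instr .next))) <|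
  .seq (.instr (.read 33)) <| .seq (.instr .next) <| .seq (asg 28 0) <| .seq (asg 32 1) <|
  .seq (scanDigits (.seq (asg 28 ((§28 + §31 * §32) % §4)) (asg 32 ((2 * §32) % §4)))) <|
  cond §33 (asg 28 ((§4 - §28) % §4)) skip

/-- Row 36 becomes the operand at gate 37 of a gate at node 7; variable 38 tells whether introduced
vertices are disregarded. -/
def readOperand : Prog :=
  .seq (readAt 30 (gatePos §37 0)) <|
  .seq (for' 31 (§1 + 1) (put §36 §31 (.cell (3 + §37 + §3 * neExp §30 §7) §31))) <|
  for' 32 §1 <| .seq (readAt 33 (bagPos §7 §32)) <| .seq (readAt 34 (bagPos §30 §32)) <|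
    cond (§38 * §33 * (1 - §34) * .cell 0 §32)
      (for' 35 §1 (put §36 (§1 - §35)
        ((.cell §36 (§1 - §35) + .cell §36 (§1 - §35 - 1)) % §4)))
      skip

/-- Row `3 + g` becomes the zeta transform of the constant gate `g`, where `g` is variable 18. -/
def evalConst : Prog :=
  .seq readCoeff <| .seq (asg 23 §28) <| .seq (asg 20 0) <| .seq (asg 21 0) <|
  .seq (for' 26 §1 <| .seq (readAt 22 (gatePos §18 (6 + §26))) <| .seq (asg 20 (§20 + §22)) <|
    asg 21 (§21 + §22 * (1 - .cell 0 §26))) <|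
  for' 25 (§1 + 1) (put (3 + §18) §25 (§23 * eqExp §25 §20 * (1 - §21)))

/-- Row `3 + g` becomes the sum of the rows 1 and 2, the latter multiplied by one less than
variable 20. -/
def evalAdd : Prog :=
  for' 25 (§1 + 1) (put (3 + §18) §25 ((.cell 1 §25 + (§20 - 1) * .cell 2 §25) % §4))

/-- Row `3 + g` becomes the product of the power series in the rows 1 and 2. -/
def evalMul : Prog :=
  for' 25 (§1 + 1) <| .seq (asg 27 0) <|
    .seq (for' 26 (§25 + 1) (asg 27 ((§27 + .cell 1 §26 * .cell 2 (§25 - §26)) % §4))) <|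
    put (3 + §18) §25 §27

/-- Row `3 + g` becomes the zeta transform of gate `g` at the current set. -/
def evalGate : Prog :=
  .seq (readAt 20 (gatePos §18 1)) <| .seq (readAt 21 (gatePos §18 2)) <|
  .seq (readAt 22 (gatePos §18 3)) <| .seq (readAt 23 (gatePos §18 4)) <|
  .seq (readAt 24 (gatePos §18 5)) <|
  cond §20
    (.seq (asg 36 1) <| .seq (asg 37 §22) <| .seq (asg 38 §21) <| .seq readOperand <|
      .seq (asg 36 2) <| .seq (asg 37 §24) <| .seq (asg 38 §23) <| .seq readOperand <|
      cond (3 - §20) evalAdd evalMul)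
    evalConst

/-- The accumulator of gate `g` is updated. -/
def accumulate : Prog :=
  for' 25 (§1 + 1) <|
    .seq (cond (§1 + 1 - (§25 + §13)) (asg 27 (.cell (3 + §18) (§25 + §13))) (asg 27 0)) <|
    .seq (cond (§11 % 2) (asg 27 (§4 - §27)) skip) <|
    put (3 + §3 + §18) §25 ((.cell (3 + §3 + §18) §25 * (1 - (1 - §12)) + §27) % §4)

/-- All gates at node 7 are evaluated. -/
def evalGates : Prog :=
  for' 18 §3 <| .seq (readAt 19 (gatePos §18 0)) <|
    cond (eqExp §19 §7) (.seq evalGate accumulate) skip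

/-- The counter is increased; variable 17 tells whether there is an overflow. -/
def increment : Prog :=
  .seq (asg 17 1) <| for' 14 §1 <| .seq testForgotten <|
    cond (§15 * §17) (.seq (asg 17 (.cell 0 §14)) (put 0 §14 (1 - §17))) skip

/-- A round of the traversal: a child of node 7 is entered or skipped or, when all children are
done, the gates are evaluated. -/
def round : Prog :=
  cond (§2 - §8)
    (.seq (readAt 10 (parentPos §8)) <|
      cond (eqExp §10 §7 * neExp §8 §5) (.seq (asg 7 §8) (asg 8 0)) (asg 8 (§8 + 1)))
    (.seq (readAt 10 (parentPos §7)) <| .seq countForgotten <| .seq evalGates <|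
      .seq increment <| cond §17
        (.seq (asg 8 (§7 + 1)) <| .seq (asg 9 (neExp §7 §5)) (asg 7 §10)) (asg 8 0))

/-- The header of the input is read into the variables from 1 to 6. -/
def readHeader : Prog :=
  .seq (readAt 1 0) <| .seq (readAt 2 1) <| .seq (readAt 3 2) <| .seq (readAt 4 3) <|
  .seq (readAt 5 4) <| .seq (readAt 6 5) <| .seq (asg 7 §5) <| .seq (asg 8 0) (asg 9 1)

/-- Register 40 becomes the number of columns of the matrix. -/
def initCols : Prog :=
  .seq (.instr (.read 40)) <| .seq (.instr (.set 41 1)) (.instr (.arith .add 40 40 41))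

/-- The program. -/
def evaluator : Prog :=
  .seq initCols <| .seq readHeader <| .seq (.loop 9 round) (asg 0 (.cell (3 + §3 + §6) 0))

/-! ### Correctness of the parts of the program -/

variable {n : ℕ} {G : SimpleGraph (Fin n)} {t : ℕ} {T : TreeDecomp G t} {s : ℕ}

/-- The parameters of the run on an instance. -/
noncomputable def env (C : Circuit T s) (m : ℕ) (hm : 1 < m) : Env where
  inp := encodeInstance G T C m
  rows := 3 + s + s
  cols := n + 1
  m := m
  Q := 64 + (3 + s + s) * (n + 1) + m
  N := bitLength (encodeInstance G T C m)
  m_pos := by omega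
  m_le := by omega
  dim_le := by omega

/-- The variables up to 6 contain the header. -/
structure Glob (C : Circuit T s) (m : ℕ) (st : St) : Prop where
  n_eq : st.r 1 = n
  t_eq : st.r 2 = t
  s_eq : st.r 3 = s
  m_eq : st.r 4 = m
  root_eq : st.r 5 = T.root
  out_eq : st.r 6 = C.out

/-- Node `x` is being processed, and row 0 contains the set `Y`. -/
structure At (C : Circuit T s) (m : ℕ) (x : Fin t) (Y : Finset (Fin n)) (st : St) : Prop
    extends Glob C m st where
  x_eq : st.r 7 = x
  set_eq : ∀ v : Fin n, st.M 0 v = if v ∈ Y then 1 else 0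

/-- The variables below `b` and the rows outside `S` are the same. -/
structure Frame (b : ℕ) (S : ℕ → Prop) (st st' : St) : Prop where
  r : ∀ i < b, st'.r i = st.r i
  M : ∀ a, ¬ S a → ∀ c, st'.M a c = st.M a c

theorem Frame.refl (b : ℕ) (S : ℕ → Prop) (st : St) : Frame b S st st :=
  ⟨fun _ _ => rfl, fun _ _ _ => rfl⟩

theorem Frame.trans {b b' : ℕ} {S S' : ℕ → Prop} {st st' st'' : St} (h : Frame b S st st')
    (h' : Frame b' S' st' st'') (hb : b ≤ b') (hS : ∀ a, S' a → S a) : Frame b S st st'' :=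
  ⟨fun i hi => (h'.r i (by omega)).trans (h.r i hi),
    fun a ha c => (h'.M a (fun h => ha (hS a h)) c).trans (h.M a ha c)⟩

theorem Frame.mono {b b' : ℕ} {S S' : ℕ → Prop} {st st' : St} (h : Frame b' S' st st')
    (hb : b ≤ b') (hS : ∀ a, S' a → S a) : Frame b S st st' :=
  (Frame.refl b S st).trans h hb hS

theorem Frame.set {b : ℕ} {S : ℕ → Prop} {st st' : St} (h : Frame b S st st') {i v : ℕ}
    (hi : b ≤ i) : Frame b S st (st'.set i v) :=
  ⟨fun j hj => by rw [St.set_r, if_neg (by omega), h.r j hj], h.M⟩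

theorem Frame.put {b : ℕ} {S : ℕ → Prop} {st st' : St} (h : Frame b S st st') {a c v : ℕ}
    (ha : S a) : Frame b S st (st'.put a c v) :=
  ⟨h.r, fun a' ha' c' => by
    rw [St.put_M, if_neg (by rintro ⟨rfl, -⟩; exact ha' ha), h.M a' ha' c']⟩

theorem Frame.seek {b : ℕ} {S : ℕ → Prop} {st st' : St} (h : Frame b S st st') {k : ℕ} :
    Frame b S st (st'.seek k) := ⟨h.r, h.M⟩

theorem Glob.frame {C : Circuit T s} {m b : ℕ} {S : ℕ → Prop} {st st' : St} (h : Glob C m st)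
    (hf : Frame b S st st') (hb : 7 ≤ b) : Glob C m st' :=
  ⟨(hf.r 1 (by omega)).trans h.n_eq, (hf.r 2 (by omega)).trans h.t_eq,
    (hf.r 3 (by omega)).trans h.s_eq, (hf.r 4 (by omega)).trans h.m_eq,
    (hf.r 5 (by omega)).trans h.root_eq, (hf.r 6 (by omega)).trans h.out_eq⟩

theorem At.frame {C : Circuit T s} {m b : ℕ} {S : ℕ → Prop} {x : Fin t} {Y : Finset (Fin n)}
    {st st' : St} (h : At C m x Y st) (hf : Frame b S st st') (hb : 8 ≤ b) (hS : ¬ S 0) :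
    At C m x Y st' :=
  ⟨h.toGlob.frame hf (by omega), (hf.r 7 (by omega)).trans h.x_eq,
    fun v => (hf.M 0 hS v).trans (h.set_eq v)⟩

section Bounds

variable (C : Circuit T s) (m : ℕ) (hm : 1 < m)

theorem env_n_lt : n + 1 ≤ (env C m hm).N ∧ n + 1 ≤ (env C m hm).Q := by
  have h1 := length_le_bitLength (encodeInstance G T C m)
  have h2 := le_length_instance C m
  constructor
  · show n + 1 ≤ bitLength _
    nlinarith [Nat.le_mul_self n]
  · show n + 1 ≤ 64 + (3 + s + s) * (n + 1) + m
    nlinarith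

theorem env_s_le : s ≤ (env C m hm).N ∧ s ≤ (env C m hm).Q := by
  have h1 := length_le_bitLength (encodeInstance G T C m)
  have h2 := le_length_instance C m
  constructor
  · show s ≤ bitLength _
    nlinarith
  · show s ≤ 64 + (3 + s + s) * (n + 1) + m
    nlinarith

theorem env_t_lt : t + 1 ≤ (env C m hm).Q := by
  have := card_nodes_le C
  show t + 1 ≤ 64 + (3 + s + s) * (n + 1) + m
  nlinarith

theorem env_const_le : 64 ≤ (env C m hm).Q := by
  show 64 ≤ 64 + (3 + s + s) * (n + 1) + m
  omega

theorem env_m_le : m ≤ (env C m hm).Q := (env C m hm).m_le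

end Bounds

/-- The number of elements of `S` below `i`. -/
def countBelow (S : Finset (Fin n)) (i : ℕ) : ℕ := (S.filter fun v : Fin n => (v : ℕ) < i).card

theorem countBelow_zero (S : Finset (Fin n)) : countBelow S 0 = 0 := by simp [countBelow]

theorem countBelow_all (S : Finset (Fin n)) : countBelow S n = S.card := by
  rw [countBelow, Finset.filter_true_of_mem fun v _ => v.2]

theorem countBelow_succ (S : Finset (Fin n)) (i : Fin n) :
    countBelow S (i + 1) = countBelow S i + if i ∈ S then 1 else 0 := by
  have hi : i ∉ S.filter fun v : Fin n => (v : ℕ) < i := by simp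
  split_ifs with h
  · rw [countBelow, countBelow, ← Finset.card_insert_of_notMem hi]
    congr 1
    ext v
    simp only [Finset.mem_filter, Finset.mem_insert, Fin.ext_iff]
    constructor
    · rintro ⟨h1, h2⟩
      by_cases hv : (v : ℕ) = i
      · exact Or.inl hv
      · exact Or.inr ⟨h1, by omega⟩
    · rintro (h1 | ⟨h1, h2⟩)
      · exact ⟨(Fin.ext h1 : v = i) ▸ h, by omega⟩
      · exact ⟨h1, by omega⟩
  · rw [countBelow, countBelow, add_zero]
    congr 1
    ext v
    simp only [Finset.mem_filter]
    constructor
    · rintro ⟨h1, h2⟩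
      refine ⟨h1, ?_⟩
      have : (v : ℕ) ≠ i := fun hv => h ((Fin.ext hv : v = i) ▸ h1)
      omega
    · rintro ⟨h1, h2⟩
      exact ⟨h1, by omega⟩

theorem countBelow_le (S : Finset (Fin n)) (i : ℕ) : countBelow S i ≤ n :=
  (Finset.card_le_univ _).trans (by simp)

variable {C : Circuit T s} {m : ℕ} {hm : 1 < m}

open Classical in
theorem wp_testForgotten {st : St} {x : Fin t} (hg : Glob C m st) (hx : st.r 7 = x)
    (hp : st.r 10 = T.parent x) (v : Fin n) (hv : st.r 14 = v) :
    WP (env C m hm) testForgotten (fun st' => st'.r 15 = (if v ∈ T.forgotten x then 1 else 0) ∧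
      (∀ i, i ≠ 15 → i ≠ 16 → st'.r i = st.r i) ∧ st'.M = st.M) st := by
  have h64 := env_const_le C m hm
  refine WP.seq (WP.readAt (by norm_num) rfl (by simp [bagPos])
    (if v ∈ T.bag x then 1 else 0) ?_ (by split_ifs <;> omega) ?_)
  · simp only [bagPos, Exp.eval_add, Exp.eval_mul, Exp.eval_var, Exp.eval_ofNat, hg.n_eq,
      hg.t_eq, hx, hv]
    exact getD_instance_bag C m x v
  refine WP.seq (WP.readAt (by norm_num) rfl (by simp [bagPos])
    (if v ∈ T.bag (T.parent x) then 1 else 0) ?_ (by split_ifs <;> omega) ?_)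
  · simp [bagPos, hg.n_eq, hg.t_eq, hp, hv]
    exact getD_instance_bag C m (T.parent x) v
  refine WP.asg (by norm_num) rfl (by simp) ?_ ?_
  · simp only [Exp.eval_sub, Exp.eval_var, St.set_r]
    split_ifs <;> simp <;> omega
  · refine ⟨?_, ?_, rfl⟩
    · simp only [Exp.eval_sub, Exp.eval_mul, eval_neExp, Exp.eval_var, St.set_r, St.seek_r,
        hg.root_eq, hx, if_true, Fin.val_inj, TreeDecomp.forgotten, Nat.reduceEqDiff, if_false]
      by_cases h : x = T.root
      · simp [h]
      · simp only [h, if_false, Finset.mem_sdiff]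
        by_cases h1 : v ∈ T.bag x <;> by_cases h2 : v ∈ T.bag (T.parent x) <;> simp [h1, h2]
    · intro i h1 h2
      simp [h1, h2]

open Classical in
theorem wp_countForgotten {st : St} {x : Fin t} {Y : Finset (Fin n)} (ha : At C m x Y st)
    (hp : st.r 10 = T.parent x) :
    WP (env C m hm) countForgotten (fun st' =>
      st'.r 11 = (T.forgotten x \ Y).card ∧ st'.r 12 = (T.forgotten x ∩ Y).card ∧
      st'.r 13 = (T.forgotten x).card ∧ Frame 11 (fun _ => False) st st') st := by
  have h64 := env_const_le C m hm
  obtain ⟨hnN, hnQ⟩ := env_n_lt C m hm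
  refine WP.seq (WP.asg (by norm_num) rfl (by simp) (by simp) ?_)
  refine WP.seq (WP.asg (by norm_num) rfl (by simp) (by simp) ?_)
  refine WP.seq (WP.asg (by norm_num) rfl (by simp) (by simp) ?_)
  refine WP.for' (fun i st' => st'.r 11 = countBelow (T.forgotten x \ Y) i ∧
    st'.r 12 = countBelow (T.forgotten x ∩ Y) i ∧ st'.r 13 = countBelow (T.forgotten x) i ∧
    Frame 11 (fun _ => False) st st') n (by norm_num) (by omega) (by omega) rfl ?_ ?_ ?_ ?_
  · rintro i st' ⟨-, -, -, hf⟩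
    exact ⟨by simp, by simpa using (ha.toGlob.frame hf (by norm_num)).n_eq⟩
  · refine ⟨by simp [countBelow_zero], by simp [countBelow_zero], by simp [countBelow_zero], ?_⟩
    exact ((((Frame.refl _ _ _).set (by norm_num)).set (by norm_num)).set (by norm_num)).set
      (by norm_num)
  · rintro i hi st' ⟨h1, h2, h3, hf⟩ hv
    have ha' := ha.frame hf (by norm_num) not_false
    refine WP.seq ((wp_testForgotten ha'.toGlob ha'.x_eq
      ((hf.r 10 (by norm_num)).trans hp) ⟨i, hi⟩ hv).mono ?_)
    rintro st₁ ⟨h15, hr, hM⟩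
    have hY : st₁.M 0 i = if (⟨i, hi⟩ : Fin n) ∈ Y then 1 else 0 := by
      rw [hM]
      exact ha'.set_eq ⟨i, hi⟩
    have hv₁ : st₁.r 14 = i := (hr 14 (by norm_num) (by norm_num)).trans hv
    have e1 := (hr 11 (by norm_num) (by norm_num)).trans h1
    have e2 := (hr 12 (by norm_num) (by norm_num)).trans h2
    have e3 := (hr 13 (by norm_num) (by norm_num)).trans h3
    have hsucc := fun S : Finset (Fin n) => countBelow_succ S ⟨i, hi⟩
    simp only at hsucc
    have hle := fun S : Finset (Fin n) => countBelow_le S i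
    have hcol : (0 : ℕ) < (env C m hm).rows ∧ i < (env C m hm).cols :=
      ⟨show 0 < 3 + s + s by omega, show i < n + 1 by omega⟩
    have hf₁ : Frame 11 (fun _ => False) st st₁ :=
      ⟨fun j hj => (hr j (by omega) (by omega)).trans (hf.r j hj),
        fun a h c => by rw [hM]; exact hf.M a h c⟩
    refine WP.seq (WP.asg (by norm_num) rfl (by simpa [hv₁] using hcol) ?_ ?_)
    · have := hle (T.forgotten x \ Y)
      simp only [Exp.eval_add, Exp.eval_mul, Exp.eval_var, Exp.eval_sub, Exp.eval_one, h15, e1]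
      split_ifs <;> simp <;> omega
    refine WP.seq (WP.asg (by norm_num) rfl (by simpa [hv₁] using hcol) ?_ ?_)
    · have := hle (T.forgotten x ∩ Y)
      simp [h15, e2, hv₁, hY]
      split_ifs <;> simp <;> omega
    refine WP.asg (by norm_num) rfl (by simp) ?_ ?_
    · have := hle (T.forgotten x)
      simp [h15, e3]
      split_ifs <;> simp <;> omega
    refine ⟨by simp [hv₁], ?_, ?_, ?_, ?_⟩
    · simp only [St.set_r, hsucc, Finset.mem_sdiff]
      simp [h15, e1, hv₁, hY]
      split_ifs <;> simp_all
    · simp only [St.set_r, hsucc, Finset.mem_inter]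
      simp [h15, e2, hv₁, hY]
      split_ifs <;> simp_all
    · simp only [St.set_r, hsucc]
      simp [h15, e3]
    · exact (((hf₁.set (by norm_num)).set (by norm_num)).set (by norm_num)).set (by norm_num)
  · rintro st' ⟨h1, h2, h3, hf⟩ -
    simp only [countBelow_all] at h1 h2 h3
    exact ⟨h1, h2, h3, hf⟩

end RAM

/-! ### Constants and operands -/

namespace RAM

variable {n : ℕ} {G : SimpleGraph (Fin n)} {t : ℕ} {T : TreeDecomp G t} {s : ℕ}

theorem getD_of_drop {l r : List ℕ} {i a : ℕ} (h : l.drop i = a :: r) : l.getD i 0 = a := by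
  have h1 : (l.drop i).getD 0 0 = l.getD i 0 := by
    simp [List.getD_eq_getElem?_getD, List.getElem?_drop]
  rw [← h1, h]
  rfl

theorem drop_succ_of_drop {l r : List ℕ} {i a : ℕ} (h : l.drop i = a :: r) :
    l.drop (i + 1) = r := by
  rw [← List.drop_drop, h, List.drop_one, List.tail_cons]

variable {C : Circuit T s} {m : ℕ} {hm : 1 < m}

theorem length_le_env_N {h : ℕ} {l : List ℕ} (hl : (env C m hm).inp.drop h = l) :
    l.length ≤ (env C m hm).N := by
  rw [← hl, List.length_drop]
  have : (env C m hm).inp.length ≤ (env C m hm).N := length_le_bitLength _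
  omega

/-- The loops over the digits of a number: `I` is indexed by the digits that remain. -/
theorem wp_scanDigits {p : Prog} {P : St → Prop} {st : St} {ds rest : List ℕ}
    (I : List ℕ → St → Prop) (hd : (env C m hm).inp.drop st.hd = ds ++ 2 :: rest)
    (hds : ∀ d ∈ ds, d < 2) (hI : ∀ v, I ds (st.set 31 v))
    (hs : ∀ d ds' st', d < 2 → st'.r 31 = d → I (d :: ds') st' → WP (env C m hm) p
      (fun st'' => st''.hd = st'.hd ∧ ∀ v, I ds' ((st''.seek (st''.hd + 1)).set 31 v)) st')
    (hP : ∀ st', (env C m hm).inp.drop st'.hd = 2 :: rest → I [] st' → P st') :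
    WP (env C m hm) (scanDigits p) P st := by
  have h64 := env_const_le C m hm
  have hhead : ∀ ds : List ℕ, (∀ d ∈ ds, d < 2) → ∀ h,
      (env C m hm).inp.drop h = ds ++ 2 :: rest → (env C m hm).inp.getD h 0 ≤ 2 ∧
        (2 - (env C m hm).inp.getD h 0 = 0 ↔ ds = []) := by
    intro ds hds h hh
    cases ds with
    | nil =>
      rw [getD_of_drop hh]
      simp
    | cons d ds =>
      rw [getD_of_drop hh]
      have := hds d (by simp)
      constructor
      · omega
      · simp
        omega
  have hv := hhead ds hds st.hd hd
  refine WP.seq (WP.read (by norm_num) (by omega) ?_)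
  refine WP.while' (fun j st' => ∃ ds', ds'.length = j ∧ (∀ d ∈ ds', d < 2) ∧
    (env C m hm).inp.drop st'.hd = ds' ++ 2 :: rest ∧
    st'.r 31 = (env C m hm).inp.getD st'.hd 0 ∧ I ds' st') ds.length ?_ rfl ?_ ?_ ?_ ?_
  · have := length_le_env_N hd
    simp only [List.length_append, List.length_cons] at this
    omega
  · intros
    simp
  · exact ⟨ds, rfl, hds, hd, by simp, hI _⟩
  · rintro st' ⟨ds', hl, hds', hd', hr, hI'⟩
    obtain rfl := List.length_eq_zero_iff.1 hl
    refine ⟨?_, hP st' hd' hI'⟩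
    rw [Exp.eval_sub, Exp.eval_ofNat, Exp.eval_var, hr]
    exact (hhead [] hds' _ hd').2.2 rfl
  · rintro j st' ⟨ds', hl, hds', hd', hr, hI'⟩
    cases ds' with
    | nil => simp at hl
    | cons d ds' =>
      have hdlt := hds' d (by simp)
      rw [getD_of_drop hd'] at hr
      refine ⟨?_, WP.seq ((hs d ds' st' hdlt hr hI').mono ?_)⟩
      · show 2 - st'.r 31 ≠ 0
        omega
      · rintro st'' ⟨hh, hI''⟩
        have hd'' : (env C m hm).inp.drop (st'.hd + 1) = ds' ++ 2 :: rest :=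
          drop_succ_of_drop hd'
        have hds'' : ∀ d ∈ ds', d < 2 := fun e he => hds' e (by simp [he])
        have hv' := hhead ds' hds'' _ hd''
        refine WP.seq (WP.next (WP.read (by norm_num) ?_ ?_))
        · rw [St.seek_hd, hh]
          omega
        · refine ⟨ds', by simpa using hl, hds'', ?_, ?_, ?_⟩
          · simpa [hh] using hd''
          · simp [hh]
          · exact hI'' _

theorem wp_skipDigits {st : St} {ds rest : List ℕ}
    (hd : (env C m hm).inp.drop st.hd = ds ++ 2 :: rest) (hds : ∀ d ∈ ds, d < 2) :
    WP (env C m hm) (scanDigits skip) (fun st' => (env C m hm).inp.drop st'.hd = 2 :: rest ∧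
      Frame 31 (fun _ => False) st st') st := by
  have h64 := env_const_le C m hm
  refine wp_scanDigits (fun _ st' => Frame 31 (fun _ => False) st st') hd hds ?_ ?_ ?_
  · exact fun v => (Frame.refl _ _ _).set (by norm_num)
  · intro d ds' st' hdlt hr hf
    exact WP.skip ⟨rfl, fun v => hf.seek.set (by norm_num)⟩
  · exact fun st' h hf => ⟨h, hf⟩

theorem encodeInt_eq (a : ℤ) (rest : List ℕ) : encodeInt a ++ rest =
    (if a < 0 then 1 else 0) :: (Nat.digits 2 a.natAbs ++ 2 :: rest) := by
  simp [encodeInt]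

/-- The loop over the digits keeps `28 + 32 * d` fixed modulo `m`, where `d` is the number that
consists of the digits that remain. -/
theorem wp_readCoeff {st : St} (hg : Glob C m st) (g : Fin s) (h18 : st.r 18 = g) :
    WP (env C m hm) readCoeff (fun st' => (st'.r 28 : ZMod m) = ((C.gate g).coeff : ZMod m) ∧
      st'.r 28 < m ∧ Frame 28 (fun _ => False) st st') st := by
  have h64 := env_const_le C m hm
  have hmQ := env_m_le C m hm
  obtain ⟨hsN, hsQ⟩ := env_s_le C m hm
  have hdig : ∀ a : ℕ, ∀ d ∈ Nat.digits 2 a, d < 2 := fun a d hd =>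
    Nat.digits_lt_base (by norm_num) hd
  refine WP.seq (WP.seekTo rfl (by simp [coeffPos]) ?_)
  refine WP.seq (WP.for' (fun i st' => (env C m hm).inp.drop st'.hd = coeffs C i ∧
    Frame 29 (fun _ => False) st st') g (by norm_num) (by omega) (by omega) rfl ?_ ?_ ?_ ?_)
  · rintro i st' ⟨-, hf⟩
    exact ⟨by simp, by simpa using (hf.r 18 (by norm_num)).trans h18⟩
  · refine ⟨?_, ((Frame.refl _ _ _).seek).set (by norm_num)⟩
    rw [St.set_hd, St.seek_hd, ← drop_instance_coeffs C m]
    simp [coeffPos, hg.n_eq, hg.t_eq, hg.s_eq, env]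
  · rintro i hi st' ⟨hd, hf⟩ hx
    have hd' := coeffs_eq C ⟨i, by omega⟩
    simp only at hd'
    rw [hd', encodeInt_eq] at hd
    have hd1 := drop_succ_of_drop hd
    refine WP.seq (WP.next (WP.seq ((wp_skipDigits (st := st'.seek (st'.hd + 1)) hd1
      (hdig _)).mono ?_)))
    rintro st'' ⟨hd'', hf'⟩
    refine WP.next ⟨?_, ?_, ?_⟩
    · rw [St.seek_r, hf'.r 30 (by norm_num)]
      exact hx
    · exact drop_succ_of_drop hd''
    · exact (((hf.seek).trans hf' (by norm_num) (fun _ h => h)).seek).set (by norm_num)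
  rintro st' ⟨hd, hf⟩ -
  rw [coeffs_eq C g, encodeInt_eq] at hd
  set a := (C.gate g).coeff with ha
  have hsgn := getD_of_drop hd
  refine WP.seq (WP.read (by norm_num) ?_ ?_)
  · rw [hsgn]
    split_ifs <;> omega
  rw [hsgn]
  refine WP.seq (WP.next ?_)
  refine WP.seq (WP.asg (by norm_num) rfl (by simp) (by simp) ?_)
  refine WP.seq (WP.asg (by norm_num) rfl (by simp) (by simp; omega) ?_)
  have key : ∀ st₂ : St, (env C m hm).inp.drop st₂.hd = Nat.digits 2 a.natAbs ++ 2 ::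
      coeffs C (g + 1) → st₂.r 33 = (if a < 0 then 1 else 0) → st₂.r 28 = 0 → st₂.r 32 = 1 →
      Frame 28 (fun _ => False) st st₂ →
      WP (env C m hm) (scanDigits (.seq (asg 28 ((§28 + §31 * §32) % §4))
        (asg 32 ((2 * §32) % §4))))
        (WP (env C m hm) (cond §33 (asg 28 ((§4 - §28) % §4)) skip) fun st' =>
          (st'.r 28 : ZMod m) = (a : ZMod m) ∧ st'.r 28 < m ∧
            Frame 28 (fun _ => False) st st') st₂ := by
    intro st₂ hd₂ h33 h28 h32 hf₂
    refine wp_scanDigits (fun ds st' => st'.r 33 = (if a < 0 then 1 else 0) ∧ st'.r 28 < m ∧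
      ((st'.r 28 + st'.r 32 * Nat.ofDigits 2 ds : ℕ) : ZMod m) = (a.natAbs : ZMod m) ∧
      Frame 28 (fun _ => False) st st') hd₂ (hdig _) ?_ ?_ ?_
    · intro v
      refine ⟨by simpa using h33, ?_, ?_, hf₂.set (by norm_num)⟩
      · simp [h28]
        omega
      · simp [h28, h32, Nat.ofDigits_digits]
    · rintro d ds st₃ hd h31 ⟨e33, e28, hval, hf₃⟩
      have h4 := (hg.frame hf₃ (by norm_num)).m_eq
      refine WP.seq (WP.asg (by norm_num) rfl (by simp) ?_ ?_)
      · have := Nat.mod_lt (st₃.r 28 + st₃.r 31 * st₃.r 32) (by omega : 0 < m)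
        simp only [Exp.eval_mod, Exp.eval_add, Exp.eval_mul, Exp.eval_var, h4]
        omega
      refine WP.asg (by norm_num) rfl (by simp) ?_ ?_
      · have := Nat.mod_lt (2 * st₃.r 32) (by omega : 0 < m)
        simp [h4]
        omega
      refine ⟨rfl, fun v => ⟨?_, ?_, ?_, ?_⟩⟩
      · simpa using e33
      · simp [h4]
        exact Nat.mod_lt _ (by omega)
      · rw [← hval]
        simp [h4, h31, Nat.ofDigits_cons]
        ring
      · exact (((hf₃.set (by norm_num)).set (by norm_num)).seek).set (by norm_num)
    · rintro st₃ - ⟨e33, e28, hval, hf₃⟩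
      have h4 := (hg.frame hf₃ (by norm_num)).m_eq
      simp only [Nat.ofDigits_nil, mul_zero, add_zero] at hval
      refine WP.cond rfl (by simp) (fun hne => ?_) (fun h0 => ?_)
      · rw [Exp.eval_var, e33] at hne
        have hneg : a < 0 := by
          by_contra h
          simp [h] at hne
        refine WP.asg (by norm_num) rfl (by simp) ?_ ?_
        · have := Nat.mod_lt (m - st₃.r 28) (by omega : 0 < m)
          simp only [Exp.eval_mod, Exp.eval_sub, Exp.eval_var, h4]
          omega
        · refine ⟨?_, ?_, hf₃.set (by norm_num)⟩
          · simp [h4, Nat.cast_sub e28.le, hval]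
            have : (a : ℤ) = -(a.natAbs : ℤ) := by omega
            rw [this]
            simp
          · simp [h4]
            exact Nat.mod_lt _ (by omega)
      · rw [Exp.eval_var, e33] at h0
        have hpos : 0 ≤ a := by
          by_contra h
          simp [not_le.1 h] at h0
        refine WP.skip ⟨?_, e28, hf₃⟩
        rw [hval]
        have : (a : ℤ) = (a.natAbs : ℤ) := by omega
        rw [this]
        simp
  refine WP.seq (key _ ?_ ?_ ?_ ?_ ?_)
  · exact drop_succ_of_drop hd
  · simp
  · simp
  · simp
  · exact ((((hf.mono (by norm_num) (fun _ h => h)).set (by norm_num)).seek).set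
      (by norm_num)).set (by norm_num)

open PowerSeries in
/-- Row `a` of the matrix contains the coefficients of `p` up to degree `n`. -/
def Row (n m : ℕ) (st : St) (a : ℕ) (p : (ZMod m)⟦X⟧) : Prop :=
  ∀ j ≤ n, (st.M a j : ZMod m) = coeff j p

theorem Row.frame {b : ℕ} {S : ℕ → Prop} {st st' : St} {a : ℕ} {p : PowerSeries (ZMod m)}
    (h : Row n m st a p) (hf : Frame b S st st') (ha : ¬ S a) : Row n m st' a p :=
  fun j hj => by rw [hf.M a ha j, h j hj]

theorem env_mod_le (k : ℕ) : k % m < m ∧ k % m ≤ (env C m hm).Q := by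
  have h1 : k % m < m := Nat.mod_lt _ (by omega)
  exact ⟨h1, h1.le.trans (env_m_le C m hm)⟩

open PowerSeries in
theorem coeff_one_add_X_mul {R : Type*} [CommRing R] (j : ℕ) (q : R⟦X⟧) :
    coeff (j + 1) ((1 + X) * q) = coeff (j + 1) q + coeff j q := by
  rw [add_mul, one_mul, map_add, coeff_succ_X_mul]

open PowerSeries in
/-- A row is multiplied by `1 + X` in place, from the highest coefficient downwards. -/
theorem wp_mulOneAddX {st : St} {row : ℕ} (hg : Glob C m st) (h36 : st.r 36 = row)
    (hrow : row < 3) {q : (ZMod m)⟦X⟧} (hq : Row n m st row q) :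
    WP (env C m hm) (for' 35 §1 (put §36 (§1 - §35)
      ((.cell §36 (§1 - §35) + .cell §36 (§1 - §35 - 1)) % §4)))
      (fun st' => Row n m st' row ((1 + X) * q) ∧
        Frame 35 (fun a => a = row) st st' ∧ ∀ i, i ≠ 35 → st'.r i = st.r i) st := by
  obtain ⟨hnN, hnQ⟩ := env_n_lt C m hm
  refine WP.for' (fun i st' => (∀ c ≤ n, (st'.M row c : ZMod m) =
      if n - i < c then coeff c ((1 + X) * q) else coeff c q) ∧
    Frame 35 (fun a => a = row) st st' ∧ ∀ i, i ≠ 35 → st'.r i = st.r i) n (by norm_num)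
    (by omega) (by omega) rfl ?_ ?_ ?_ ?_
  · rintro i st' ⟨-, hf, -⟩
    exact ⟨by simp, by simpa using (hg.frame hf (by norm_num)).n_eq⟩
  · refine ⟨fun c hc => ?_, (Frame.refl _ _ _).set (by norm_num), fun i hi => by simp [hi]⟩
    rw [if_neg (by omega)]
    exact hq c hc
  · rintro i hi st' ⟨hc, hf, hr⟩ hx
    have hg' := hg.frame hf (by norm_num)
    have e36 : st'.r 36 = row := (hr 36 (by norm_num)).trans h36
    have hrows : row < (env C m hm).rows := show row < 3 + s + s by omega
    have hcols : n - i < (env C m hm).cols := show n - i < n + 1 by omega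
    have hcols' : n - i - 1 < (env C m hm).cols := show n - i - 1 < n + 1 by omega
    refine WP.put rfl rfl rfl ?_ ?_ ?_ ?_ ?_ ?_ ?_
    · simp [e36, hx, hg'.n_eq, hrows, hcols, hcols']
    · simp
    · simp
    · simpa [e36] using hrows
    · simpa [hx, hg'.n_eq] using hcols
    · simp only [Exp.eval_mod, Exp.eval_var, hg'.m_eq]
      exact (env_mod_le (C := C) (hm := hm) _).1
    · refine ⟨by simpa using hx, ?_, ?_, ?_⟩
      · intro c hcn
        simp only [St.set_M, St.put_M, Exp.eval_mod, Exp.eval_var, Exp.eval_add, Exp.eval_cell,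
          Exp.eval_sub, Exp.eval_one, hg'.m_eq, hg'.n_eq, hx, e36, true_and]
        by_cases h : c = n - i
        · obtain ⟨d, hd⟩ : ∃ d, n - i = d + 1 := ⟨n - i - 1, by omega⟩
          have h1 := hc (d + 1) (by omega)
          have h2 := hc d (by omega)
          rw [if_neg (by omega)] at h1 h2
          rw [if_pos h, if_pos (by omega), h, hd, coeff_one_add_X_mul, Nat.add_sub_cancel,
            ZMod.natCast_mod, Nat.cast_add, h1, h2]
        · rw [if_neg h, hc c hcn]
          by_cases h' : n - i < c
          · rw [if_pos h', if_pos (by omega)]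
          · rw [if_neg h', if_neg (by omega)]
      · exact (hf.put e36).set (by norm_num)
      · intro j hj
        simp [hj, hr j hj]
  · rintro st' ⟨hc, hf, hr⟩ -
    refine ⟨fun c hcn => ?_, hf, hr⟩
    rw [hc c hcn]
    by_cases h : c = 0
    · subst h
      rw [if_neg (by omega)]
      simp [add_mul]
    · rw [if_pos (by omega)]

open PowerSeries in
/-- The row of the operand is copied, and then multiplied by `1 + X` for every vertex of the current
set that is introduced at the node, if the operand disregards introduced vertices. -/
theorem wp_readOperand {st : St} {x : Fin t} {Y : Finset (Fin n)} (ha : At C m x Y st)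
    {row : ℕ} (h36 : st.r 36 = row) (hrow : 1 ≤ row) (hrow' : row < 3) (b : Fin s)
    (h37 : st.r 37 = b) (keep : Bool) (h38 : st.r 38 = keep.toNat) {p : (ZMod m)⟦X⟧}
    (hp : Row n m st (if C.node b = x then 3 + b else 3 + b + s) p) :
    WP (env C m hm) readOperand (fun st' => Row n m st' row
      ((if keep = true then (1 + X) ^ ((Y ∩ T.bag x) \ T.bag (C.node b)).card else 1) * p) ∧
      Frame 30 (fun a => a = row) st st') st := by
  have h64 := env_const_le C m hm
  have htQ := env_t_lt C m hm
  obtain ⟨hnN, hnQ⟩ := env_n_lt C m hm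
  set src : ℕ := if C.node b = x then 3 + b else 3 + b + s with hsrc
  have hsrc3 : 3 ≤ src := by rw [hsrc]; split_ifs <;> omega
  have hsrclt : src < (env C m hm).rows := by
    show src < 3 + s + s
    rw [hsrc]
    split_ifs <;> omega
  have hrows : row < (env C m hm).rows := show row < 3 + s + s by omega
  refine WP.seq (WP.readAt (by norm_num) rfl (by simp [gatePos]) (C.node b) ?_ (by omega) ?_)
  · simp [gatePos, ha.n_eq, ha.t_eq, h37]
    exact getD_instance_node C m b
  set st₁ := (st.seek ((gatePos §37 0).eval st)).set 30 (C.node b) with hst₁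
  have hf₁ : Frame 30 (fun a => a = row) st st₁ :=
    ((Frame.refl _ _ _).seek).set (by norm_num)
  have ha₁ := ha.frame hf₁ (by norm_num) (by omega)
  have e36 : st₁.r 36 = row := by simp [hst₁, h36]
  have e37 : st₁.r 37 = b := by simp [hst₁, h37]
  have e38 : st₁.r 38 = keep.toNat := by simp [hst₁, h38]
  have e30 : st₁.r 30 = C.node b := by simp [hst₁]
  have hM₁ : st₁.M = st.M := rfl
  refine WP.seq (WP.for' (fun i st' => (∀ j < i, st'.M row j = st.M src j) ∧
    Frame 31 (fun a => a = row) st₁ st' ∧ (∀ i, i ≠ 31 → st'.r i = st₁.r i)) (n + 1)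
    (by norm_num) (by omega) (by omega) rfl ?_ ?_ ?_ ?_)
  · rintro i st' ⟨-, hf, -⟩
    exact ⟨by simp, by simpa using (ha₁.toGlob.frame hf (by norm_num)).n_eq⟩
  · exact ⟨by simp, (Frame.refl _ _ _).set (by norm_num), fun i hi => by simp [hi]⟩
  · rintro i hi st' ⟨hc, hf, hr⟩ hx
    have ha' := ha₁.frame hf (by norm_num) (by omega)
    have hev : (3 + §37 + §3 * neExp §30 §7 : Exp).eval st' = src := by
      simp only [Exp.eval_add, Exp.eval_mul, eval_neExp, Exp.eval_var, Exp.eval_ofNat, ha'.s_eq,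
        ha'.x_eq, (hr 37 (by norm_num)).trans e37, (hr 30 (by norm_num)).trans e30, Fin.val_inj,
        hsrc]
      split_ifs <;> simp
    have hcols : i < (env C m hm).cols := hi
    have hMsrc : ∀ c, st'.M src c = st.M src c := fun c => hf.M src (by omega) c
    refine WP.of_bounds fun _ hMlt => ?_
    refine WP.put rfl rfl rfl ?_ ?_ ?_ ?_ ?_ ?_ ?_
    · rw [Exp.inRange_cell, hev]
      simp [hx, hsrclt, hcols]
    · simp
    · simp
    · simpa [(hr 36 (by norm_num)).trans e36] using hrows
    · simpa [hx] using hcols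
    · rw [Exp.eval_cell, hev, Exp.eval_var, hx]
      exact hMlt src hsrclt i hcols
    · refine ⟨by simpa using hx, ?_, ?_, ?_⟩
      · intro j hj
        simp only [St.set_M, St.put_M, Exp.eval_cell, hev, Exp.eval_var, hx,
          (hr 36 (by norm_num)).trans e36, true_and]
        split_ifs with h
        · rw [h, hMsrc]
        · exact hc j (by omega)
      · exact (hf.put ((hr 36 (by norm_num)).trans e36)).set (by norm_num)
      · intro j hj
        simp [hj, hr j hj]
  rintro st₂ ⟨hc, hf₂, hr₂⟩ -
  have ha₂ := ha₁.frame hf₂ (by norm_num) (by omega)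
  have e36₂ := (hr₂ 36 (by norm_num)).trans e36
  have e38₂ := (hr₂ 38 (by norm_num)).trans e38
  have e30₂ := (hr₂ 30 (by norm_num)).trans e30
  have hf₂' : Frame 30 (fun a => a = row) st st₂ :=
    hf₁.trans hf₂ (by norm_num) (fun _ h => h)
  set S := (Y ∩ T.bag x) \ T.bag (C.node b) with hS
  refine WP.for' (fun i st' => Row n m st' row
    ((if keep = true then (1 + X) ^ countBelow S i else 1) * p) ∧
    Frame 30 (fun a => a = row) st st' ∧ st'.r 30 = C.node b ∧ st'.r 36 = row ∧
    st'.r 38 = keep.toNat) n (by norm_num) (by omega) (by omega) rfl ?_ ?_ ?_ ?_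
  · rintro i st' ⟨-, hf, -⟩
    exact ⟨by simp, by simpa using (ha.toGlob.frame hf (by norm_num)).n_eq⟩
  · refine ⟨?_, hf₂'.set (by norm_num), by simpa using e30₂, by simpa using e36₂,
      by simpa using e38₂⟩
    intro j hj
    have : (if keep = true then (1 + X) ^ countBelow S 0 else 1) * p = p := by
      simp [countBelow_zero]
    rw [this, St.set_M, hc j (by omega)]
    exact hp j hj
  · rintro i hi st' ⟨hq, hf, h30', h36', h38'⟩ hx
    have ha' := ha.frame hf (by norm_num) (by omega)
    refine WP.seq (WP.readAt (by norm_num) rfl (by simp [bagPos])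
      (if (⟨i, hi⟩ : Fin n) ∈ T.bag x then 1 else 0) ?_ (by split_ifs <;> omega) ?_)
    · simp [bagPos, ha'.n_eq, ha'.t_eq, ha'.x_eq, hx]
      exact getD_instance_bag C m x ⟨i, hi⟩
    refine WP.seq (WP.readAt (by norm_num) rfl (by simp [bagPos])
      (if (⟨i, hi⟩ : Fin n) ∈ T.bag (C.node b) then 1 else 0) ?_ (by split_ifs <;> omega) ?_)
    · simp [bagPos, ha'.n_eq, ha'.t_eq, h30', hx]
      exact getD_instance_bag C m (C.node b) ⟨i, hi⟩
    set st₃ := ((st'.seek _).set 33 _).seek _ |>.set 34 _ with hst₃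
    have hY : st₃.M 0 i = if (⟨i, hi⟩ : Fin n) ∈ Y then 1 else 0 := ha'.set_eq ⟨i, hi⟩
    have hf₃ : Frame 30 (fun a => a = row) st st₃ :=
      (((hf.seek).set (by norm_num)).seek).set (by norm_num)
    have hM₃ : st₃.M = st'.M := rfl
    have e30 : st₃.r 30 = C.node b := by simpa [hst₃] using h30'
    have e36 : st₃.r 36 = row := by simpa [hst₃] using h36'
    have e38 : st₃.r 38 = keep.toNat := by simpa [hst₃] using h38'
    have e32 : st₃.r 32 = i := by simpa [hst₃] using hx
    have e33 : st₃.r 33 = if (⟨i, hi⟩ : Fin n) ∈ T.bag x then 1 else 0 := by simp [hst₃]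
    have e34 : st₃.r 34 = if (⟨i, hi⟩ : Fin n) ∈ T.bag (C.node b) then 1 else 0 := by
      simp [hst₃]
    have hsucc := countBelow_succ S ⟨i, hi⟩
    simp only at hsucc
    have hval : (§38 * §33 * (1 - §34) * .cell 0 §32 : Exp).eval st₃ =
        if keep = true ∧ (⟨i, hi⟩ : Fin n) ∈ S then 1 else 0 := by
      simp only [Exp.eval_mul, Exp.eval_sub, Exp.eval_one, Exp.eval_var, Exp.eval_cell,
        Exp.eval_zero, e32, e33, e34, e38, hY, hS, Finset.mem_sdiff, Finset.mem_inter]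
      by_cases h1 : (⟨i, hi⟩ : Fin n) ∈ T.bag x <;>
        by_cases h2 : (⟨i, hi⟩ : Fin n) ∈ T.bag (C.node b) <;>
        by_cases h3 : (⟨i, hi⟩ : Fin n) ∈ Y <;> cases keep <;> simp [h1, h2, h3]
    have hq₃ : Row n m st₃ row ((if keep = true then (1 + X) ^ countBelow S i else 1) * p) := hq
    refine WP.cond rfl ?_ (fun hne => ?_) (fun h0 => ?_)
    · simp only [Exp.inRange_mul, Exp.inRange_var, Exp.inRange_sub, Exp.inRange_one,
        Exp.inRange_cell, Exp.inRange_zero, Exp.eval_zero, Exp.eval_var, e32, true_and]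
      exact ⟨show 0 < 3 + s + s by omega, show i < n + 1 by omega⟩
    · rw [hval] at hne
      have hk : keep = true ∧ (⟨i, hi⟩ : Fin n) ∈ S := by
        by_contra h
        rw [if_neg h] at hne
        exact hne rfl
      refine (wp_mulOneAddX (ha.toGlob.frame hf₃ (by norm_num)) e36 hrow' hq₃).mono ?_
      rintro st₄ ⟨hq₄, hf₄, hr₄⟩
      refine ⟨by simpa using (hr₄ 32 (by norm_num)).trans e32, ?_, ?_, ?_, ?_, ?_⟩
      · have : (1 + X) * ((if keep = true then (1 + X) ^ countBelow S i else 1) * p) =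
            (if keep = true then (1 + X) ^ countBelow S (i + 1) else 1) * p := by
          rw [if_pos hk.1, if_pos hk.1, hsucc, if_pos hk.2]
          ring
        rw [← this]
        exact hq₄
      · exact (hf₃.trans hf₄ (by norm_num) (fun _ h => h)).set (by norm_num)
      · simpa using (hr₄ 30 (by norm_num)).trans e30
      · simpa using (hr₄ 36 (by norm_num)).trans e36
      · simpa using (hr₄ 38 (by norm_num)).trans e38
    · rw [hval] at h0
      have hk : ¬ (keep = true ∧ (⟨i, hi⟩ : Fin n) ∈ S) := by
        intro h
        rw [if_pos h] at h0
        cases h0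
      refine WP.skip ⟨e32, ?_, hf₃.set (by norm_num), by simpa using e30, by simpa using e36,
        by simpa using e38⟩
      have : (if keep = true then ((1 : (ZMod m)⟦X⟧) + X) ^ countBelow S (i + 1) else 1) =
          (if keep = true then (1 + X) ^ countBelow S i else 1) := by
        by_cases h : keep = true
        · rw [if_pos h, if_pos h, hsucc, if_neg (fun h' => hk ⟨h, h'⟩), add_zero]
        · rw [if_neg h, if_neg h]
      rw [this]
      exact hq₃
  · rintro st' ⟨hq, hf, -⟩ -
    rw [countBelow_all] at hq
    exact ⟨hq, hf⟩

end RAM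

/-! ### The evaluation of a gate -/

namespace RAM

open PowerSeries

variable {n : ℕ} {G : SimpleGraph (Fin n)} {t : ℕ} {T : TreeDecomp G t} {s : ℕ}
variable {C : Circuit T s} {m : ℕ} {hm : 1 < m}

theorem row_lt_rows (g : Fin s) :
    3 + (g : ℕ) < (env C m hm).rows ∧ 3 + s + (g : ℕ) < (env C m hm).rows :=
  ⟨show 3 + (g : ℕ) < 3 + s + s by omega, show 3 + s + (g : ℕ) < 3 + s + s by omega⟩

/-- The rule for a loop that computes the entries of row `a` one by one. -/
theorem wp_fillRow {st : St} (hg : Glob C m st) {p : Prog} (a : ℕ) (q : (ZMod m)⟦X⟧)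
    (hs : ∀ j ≤ n, ∀ st', Frame 25 (fun b => b = a) st st' → st'.r 25 = j →
      (∀ i, j ≤ i → st'.M a i = st.M a i) →
      WP (env C m hm) p (fun st'' => st''.r 25 = j ∧ Frame 25 (fun b => b = a) st' st'' ∧
        (st''.M a j : ZMod m) = coeff j q ∧ ∀ i, i ≠ j → st''.M a i = st'.M a i) st') :
    WP (env C m hm) (for' 25 (§1 + 1) p)
      (fun st' => Row n m st' a q ∧ Frame 25 (fun b => b = a) st st') st := by
  obtain ⟨hnN, hnQ⟩ := env_n_lt C m hm
  refine WP.for' (fun i st' => (∀ j < i, (st'.M a j : ZMod m) = coeff j q) ∧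
    (∀ j, i ≤ j → st'.M a j = st.M a j) ∧ Frame 25 (fun b => b = a) st st') (n + 1)
    (by norm_num) hnN hnQ rfl ?_ ?_ ?_ ?_
  · rintro i st' ⟨-, -, hf⟩
    exact ⟨by simp, by simpa using (hg.frame hf (by norm_num)).n_eq⟩
  · exact ⟨by simp, fun _ _ => rfl, (Frame.refl _ _ _).set (by norm_num)⟩
  · rintro i hi st' ⟨hj, hj', hf⟩ hx
    refine (hs i (by omega) st' hf hx hj').mono ?_
    rintro st'' ⟨hx', hf', hi', hne⟩
    refine ⟨hx', fun j hji => ?_, fun j hij => ?_,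
      (hf.trans hf' le_rfl (fun _ h => h)).set (by norm_num)⟩
    · rw [St.set_M]
      by_cases h : j = i
      · rw [h, hi']
      · rw [hne j h]
        exact hj j (by omega)
    · rw [St.set_M, hne j (by omega), hj' j (by omega)]
  · rintro st' ⟨hj, -, hf⟩ -
    exact ⟨fun j hjn => hj j (by omega), hf⟩

theorem wp_evalAdd {st : St} (hg : Glob C m st) (g : Fin s) (h18 : st.r 18 = g) (k : ℕ)
    (h20 : st.r 20 = k) {p q : (ZMod m)⟦X⟧} (hp : Row n m st 1 p) (hq : Row n m st 2 q) :
    WP (env C m hm) evalAdd (fun st' => Row n m st' (3 + g) (p + ((k - 1 : ℕ) : ZMod m) • q) ∧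
      Frame 25 (fun a => a = 3 + g) st st') st := by
  refine wp_fillRow hg _ _ ?_
  rintro j hj st' hf hx -
  have hg' := hg.frame hf (by norm_num)
  have e18 := (hf.r 18 (by norm_num)).trans h18
  have e20 := (hf.r 20 (by norm_num)).trans h20
  have hcol : j < (env C m hm).cols := show j < n + 1 by omega
  have hrow : 2 < (env C m hm).rows := show 2 < 3 + s + s by omega
  have hrow1 : 1 < (env C m hm).rows := show 1 < 3 + s + s by omega
  refine WP.put rfl rfl rfl ?_ ?_ ?_ ?_ ?_ ?_ ?_
  · simp [hx, hcol, hrow, hrow1]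
  · simp
  · simp
  · simpa [e18] using (row_lt_rows g).1
  · simpa [hx] using hcol
  · simp only [Exp.eval_mod, Exp.eval_var, hg'.m_eq]
    exact (env_mod_le (C := C) (hm := hm) _).1
  · refine ⟨hx, ⟨fun _ _ => rfl, fun a h c => ?_⟩, ?_, ?_⟩
    · simp [e18, h]
    · have h1 := hp j hj
      have h2 := hq j hj
      rw [← hf.M 1 (by omega) j] at h1
      rw [← hf.M 2 (by omega) j] at h2
      simp [e18, hx, hg'.m_eq, e20, h1, h2]
    · intro i hi
      simp [hx, hi]

theorem wp_evalMul {st : St} (hg : Glob C m st) (g : Fin s) (h18 : st.r 18 = g)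
    {p q : (ZMod m)⟦X⟧} (hp : Row n m st 1 p) (hq : Row n m st 2 q) :
    WP (env C m hm) evalMul (fun st' => Row n m st' (3 + g) (p * q) ∧
      Frame 25 (fun a => a = 3 + g) st st') st := by
  obtain ⟨hnN, hnQ⟩ := env_n_lt C m hm
  refine wp_fillRow hg _ _ ?_
  rintro j hj st' hf hx -
  have e18 := (hf.r 18 (by norm_num)).trans h18
  have hcol : ∀ j ≤ n, j < (env C m hm).cols := fun j hj => show j < n + 1 by omega
  have hrow : 2 < (env C m hm).rows := show 2 < 3 + s + s by omega
  have hrow1 : 1 < (env C m hm).rows := show 1 < 3 + s + s by omega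
  refine WP.seq (WP.asg (by norm_num) rfl (by simp) (by simp) ?_)
  refine WP.seq (WP.for' (fun i st'' => st''.r 27 < m ∧ (st''.r 27 : ZMod m) =
    ∑ l ∈ Finset.range i, coeff l p * coeff (j - l) q ∧ st''.r 25 = j ∧
    Frame 25 (fun _ => False) st' st'') (j + 1) (by norm_num) (by omega) (by omega) rfl
    ?_ ?_ ?_ ?_)
  · rintro i st'' ⟨-, -, h25, -⟩
    exact ⟨by simp, by simp [h25]⟩
  · refine ⟨?_, by simp, by simpa using hx, ?_⟩
    · simp
      omega
    · exact ((Frame.refl _ _ _).set (by norm_num)).set (by norm_num)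
  · rintro i hi st'' ⟨hlt, hsum, h25, hf'⟩ h26
    have hf'' := hf.trans hf' le_rfl (fun _ h => h.elim)
    have hg' := hg.frame hf'' (by norm_num)
    have h1 := hp i (by omega)
    have h2 := hq (j - i) (by omega)
    rw [← hf''.M 1 (by omega) i] at h1
    rw [← hf''.M 2 (by omega) (j - i)] at h2
    have hmod := env_mod_le (C := C) (hm := hm)
      (st''.r 27 + st''.M 1 i * st''.M 2 (j - i))
    refine WP.asg (by norm_num) rfl ?_ ?_ ?_
    · simp [h25, h26, hrow, hrow1, hcol i (by omega), hcol (j - i) (by omega)]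
    · simpa [h25, h26, hg'.m_eq] using hmod.2
    · refine ⟨by simpa using h26, ?_, ?_, by simpa using h25,
        (hf'.set (by norm_num)).set (by norm_num)⟩
      · simpa [h25, h26, hg'.m_eq] using hmod.1
      · rw [Finset.sum_range_succ, ← hsum]
        simp [h25, h26, hg'.m_eq, h1, h2]
  rintro st'' ⟨hlt, hsum, h25, hf'⟩ -
  have h18' := (hf'.r 18 (by norm_num)).trans e18
  refine WP.put rfl rfl rfl (by simp) (by simp) (by simp) ?_ ?_ ?_ ?_
  · simpa [h18'] using (row_lt_rows g).1
  · simpa [h25] using hcol j hj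
  · exact hlt
  · refine ⟨h25, ⟨fun i hi => ?_, fun a h c => ?_⟩, ?_, ?_⟩
    · exact hf'.r i hi
    · simp [h18', h, hf'.M a not_false c]
    · rw [coeff_mul, Finset.Nat.sum_antidiagonal_eq_sum_range_succ
        (fun i j => coeff i p * coeff j q), ← hsum]
      simp [h18', h25]
    · intro i hi
      simp [h25, hi, hf'.M _ not_false]

theorem wp_evalConst {st : St} {x : Fin t} {Y : Finset (Fin n)} (ha : At C m x Y st)
    (g : Fin s) (h18 : st.r 18 = g) (hx : C.node g = x) {A : Finset (Fin n)} {a : ℤ}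
    (hgate : C.gate g = .const A a) :
    WP (env C m hm) evalConst (fun st' =>
      Row n m st' (3 + g) (zeta (C.lift (ZMod m) g) (Y ∩ T.bag x)) ∧
      Frame 20 (fun b => b = 3 + g) st st') st := by
  have h64 := env_const_le C m hm
  obtain ⟨hnN, hnQ⟩ := env_n_lt C m hm
  refine WP.seq ((wp_readCoeff ha.toGlob g h18).mono ?_)
  rintro st₁ ⟨hc, hlt, hf₁⟩
  have hcoeff : (C.gate g).coeff = a := by rw [hgate]; rfl
  rw [hcoeff] at hc
  have hmQ := env_m_le C m hm
  refine WP.seq (WP.asg (by norm_num) rfl (by simp) (by simp; omega) ?_)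
  refine WP.seq (WP.asg (by norm_num) rfl (by simp) (by simp) ?_)
  refine WP.seq (WP.asg (by norm_num) rfl (by simp) (by simp) ?_)
  refine WP.seq (WP.for' (fun i st' => st'.r 20 = countBelow A i ∧
    st'.r 21 = countBelow (A \ Y) i ∧ st'.r 23 = st₁.r 28 ∧
    Frame 20 (fun _ => False) st st') n (by norm_num) (by omega) (by omega) rfl ?_ ?_ ?_ ?_)
  · rintro i st' ⟨-, -, -, hf⟩
    exact ⟨by simp, by simpa using (ha.toGlob.frame hf (by norm_num)).n_eq⟩
  · refine ⟨by simp [countBelow_zero], by simp [countBelow_zero], by simp, ?_⟩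
    exact ((((hf₁.mono (by norm_num) (fun _ h => h)).set (by norm_num)).set (by norm_num)).set
      (by norm_num)).set (by norm_num)
  · rintro i hi st' ⟨h20, h21, h28, hf⟩ h26
    have ha' := ha.frame hf (by norm_num) not_false
    have h18' := (hf.r 18 (by norm_num)).trans h18
    have hsucc := fun S : Finset (Fin n) => countBelow_succ S ⟨i, hi⟩
    simp only at hsucc
    have hle := fun S : Finset (Fin n) => countBelow_le S i
    have hY : st'.M 0 i = if (⟨i, hi⟩ : Fin n) ∈ Y then 1 else 0 := ha'.set_eq ⟨i, hi⟩
    refine WP.seq (WP.readAt (by norm_num) rfl (by simp [gatePos])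
      (if (⟨i, hi⟩ : Fin n) ∈ A then 1 else 0) ?_ (by split_ifs <;> omega) ?_)
    · simp [gatePos, ha'.n_eq, ha'.t_eq, h18', h26]
      exact getD_instance_constSet C m hgate ⟨i, hi⟩
    refine WP.seq (WP.asg (by norm_num) rfl (by simp) ?_ ?_)
    · have := hle A
      simp [h20]
      split_ifs <;> omega
    refine WP.asg (by norm_num) rfl ?_ ?_ ?_
    · simp [h26]
      exact ⟨show 0 < 3 + s + s by omega, show i < n + 1 by omega⟩
    · have := hle (A \ Y)
      simp [h21, h26, hY]
      split_ifs <;> simp <;> omega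
    · refine ⟨by simpa using h26, ?_, ?_, by simpa using h28, ?_⟩
      · simp [h20, hsucc]
      · rw [hsucc]
        simp [h21, h26, hY]
        split_ifs <;> simp_all
      · exact (((hf.seek.set (by norm_num)).set (by norm_num)).set (by norm_num)).set
          (by norm_num)
  rintro st₂ ⟨h20, h21, h28, hf₂⟩ -
  rw [countBelow_all] at h20 h21
  rw [← h28] at hc hlt
  have hg₂ := ha.toGlob.frame hf₂ (by norm_num)
  refine (wp_fillRow hg₂ (3 + g) (zeta (C.lift (ZMod m) g) (Y ∩ T.bag x)) ?_).mono ?_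
  · rintro j hj st' hf h25 -
    have e18 := (hf.r 18 (by norm_num)).trans ((hf₂.r 18 (by norm_num)).trans h18)
    have e20 := (hf.r 20 (by norm_num)).trans h20
    have e21 := (hf.r 21 (by norm_num)).trans h21
    have e23 := hf.r 23 (by norm_num)
    have hAx : A ⊆ T.bag x := hx ▸ C.const_subset g A a hgate
    have hcol : j < (env C m hm).cols := show j < n + 1 by omega
    have hsub : A ⊆ Y ∩ T.bag x ↔ (A \ Y).card = 0 := by
      rw [Finset.card_eq_zero, Finset.sdiff_eq_empty_iff_subset]
      exact ⟨fun h => h.trans Finset.inter_subset_left, fun h => Finset.subset_inter h hAx⟩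
    refine WP.put rfl rfl rfl (by simp) (by simp) (by simp) ?_ ?_ ?_ ?_
    · simpa [e18] using (row_lt_rows g).1
    · simpa [h25] using hcol
    · have hle : st'.r 23 * (if j = A.card then 1 else 0) * (1 - (A \ Y).card) ≤
          st'.r 23 * 1 * 1 := by
        gcongr
        · split_ifs <;> omega
        · omega
      rw [mul_one, mul_one, e23] at hle
      simp only [Exp.eval_mul, Exp.eval_var, eval_eqExp, Exp.eval_sub, Exp.eval_one, e20, e21, h25,
        e23]
      exact lt_of_le_of_lt hle hlt
    · refine ⟨h25, ⟨fun _ _ => rfl, fun b hb c => by simp [e18, hb]⟩, ?_, ?_⟩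
      · rw [C.zeta_lift_const _ hgate]
        by_cases h : (A \ Y).card = 0
        · rw [if_pos (hsub.2 h), coeff_C_mul, coeff_X_pow]
          simp [e18, e20, e21, e23, h25, h, hc]
        · rw [if_neg (fun h' => h (hsub.1 h'))]
          have : 1 - (A \ Y).card = 0 := by omega
          simp [e18, e20, e21, e23, h25, this]
      · intro i hi
        simp [h25, hi]
  · rintro st' ⟨hr, hf⟩
    exact ⟨hr, (hf₂.mono le_rfl (fun _ h => h.elim)).trans hf (by norm_num) (fun _ h => h)⟩

end RAM

namespace RAM

open PowerSeries

variable {n : ℕ} {G : SimpleGraph (Fin n)} {t : ℕ} {T : TreeDecomp G t} {s : ℕ}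
variable {C : Circuit T s} {m : ℕ} {hm : 1 < m}

/-- The row of the matrix that is used when gate `b` is an operand of a gate at node `x`. -/
def sourceRow (C : Circuit T s) (x : Fin t) (b : Fin s) : ℕ :=
  if C.node b = x then 3 + b else 3 + b + s

theorem row_exists (st : St) (a : ℕ) : ∃ p : (ZMod m)⟦X⟧, Row n m st a p :=
  ⟨PowerSeries.mk fun j => (st.M a j : ZMod m), fun j _ => by simp⟩

/-- The operands of a gate are loaded into the rows 1 and 2. -/
theorem wp_readOperands {P : Prog} {Q : St → Prop} {st : St} {x : Fin t} {Y : Finset (Fin n)}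
    (ha : At C m x Y st) {b c : Fin s} {kb kc : Bool} (h21 : st.r 21 = kb.toNat)
    (h22 : st.r 22 = b) (h23 : st.r 23 = kc.toNat) (h24 : st.r 24 = c) {p q : (ZMod m)⟦X⟧}
    (hp : Row n m st (sourceRow C x b) p) (hq : Row n m st (sourceRow C x c) q)
    (hP : ∀ st', Row n m st' 1 ((if kb = true then
        (1 + X) ^ ((Y ∩ T.bag x) \ T.bag (C.node b)).card else 1) * p) →
      Row n m st' 2 ((if kc = true then
        (1 + X) ^ ((Y ∩ T.bag x) \ T.bag (C.node c)).card else 1) * q) →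
      Frame 30 (fun a => a = 1 ∨ a = 2) st st' → WP (env C m hm) P Q st') :
    WP (env C m hm) (.seq (asg 36 1) <| .seq (asg 37 §22) <| .seq (asg 38 §21) <|
      .seq readOperand <| .seq (asg 36 2) <| .seq (asg 37 §24) <| .seq (asg 38 §23) <|
      .seq readOperand P) Q st := by
  have h64 := env_const_le C m hm
  have hsrc : ∀ b, 3 ≤ sourceRow C x b := fun b => by rw [sourceRow]; split_ifs <;> omega
  have hb : ∀ b : Bool, b.toNat ≤ 1 := fun b => Bool.toNat_le b
  have hQs : ∀ b : Fin s, (b : ℕ) ≤ (env C m hm).Q := fun b => by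
    have := (env_s_le C m hm).2
    omega
  refine WP.seq (WP.asg (by norm_num) rfl (by simp) (by simp; omega) ?_)
  refine WP.seq (WP.asg (by norm_num) rfl (by simp) (by simp [h22, hQs]) ?_)
  refine WP.seq (WP.asg (by norm_num) rfl (by simp) (by have := hb kb; simp [h21]; omega) ?_)
  refine WP.seq ((wp_readOperand (x := x) (Y := Y) (row := 1) (p := p) ?_ ?_ le_rfl (by norm_num) b
    ?_ kb ?_ ?_).mono ?_)
  · exact ha.frame ((((Frame.refl 30 (fun _ => False) st).set (by norm_num)).set
      (by norm_num)).set (by norm_num)) (by norm_num) not_false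
  · simp
  · simp [h22]
  · simp [h21]
  · exact hp
  rintro st₁ ⟨hr₁, hf₁⟩
  have hf₁' : Frame 30 (fun a => a = 1) st st₁ :=
    ((((Frame.refl 30 _ st).set (by norm_num)).set (by norm_num)).set (by norm_num)).trans hf₁
      (by norm_num) (fun _ h => h)
  have ha₁ := ha.frame hf₁' (by norm_num) (by norm_num)
  have e23 := (hf₁'.r 23 (by norm_num)).trans h23
  have e24 := (hf₁'.r 24 (by norm_num)).trans h24
  refine WP.seq (WP.asg (by norm_num) rfl (by simp) (by simp; omega) ?_)
  refine WP.seq (WP.asg (by norm_num) rfl (by simp) (by simp [e24, hQs]) ?_)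
  refine WP.seq (WP.asg (by norm_num) rfl (by simp) (by have := hb kc; simp [e23]; omega) ?_)
  refine WP.seq ((wp_readOperand (x := x) (Y := Y) (row := 2) (p := q) ?_ ?_ (by norm_num)
    (by norm_num) c ?_ kc ?_ ?_).mono ?_)
  · exact ha₁.frame ((((Frame.refl 30 (fun _ => False) st₁).set (by norm_num)).set
      (by norm_num)).set (by norm_num)) (by norm_num) not_false
  · simp
  · simp [e24]
  · simp [e23]
  · exact (Row.frame hq hf₁' (by have := hsrc c; omega) : Row n m st₁ _ _)
  rintro st₂ ⟨hr₂, hf₂⟩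
  have hf₂' : Frame 30 (fun a => a = 2) st₁ st₂ :=
    ((((Frame.refl 30 _ st₁).set (by norm_num)).set (by norm_num)).set (by norm_num)).trans hf₂
      (by norm_num) (fun _ h => h)
  exact hP st₂ (hr₁.frame hf₂' (by norm_num)) hr₂
    ((hf₁'.mono le_rfl (fun _ h => Or.inl h)).trans hf₂' le_rfl (fun _ h => Or.inr h))

/-- The rows of the operands of gate `g` are correct for the current set. -/
def Sources (C : Circuit T s) (m : ℕ) (x : Fin t) (Y : Finset (Fin n)) (g : Fin s) (st : St) :
    Prop :=
  ∀ b < g, C.node b = x ∨ T.IsChild (C.node b) x → Row n m st (sourceRow C x b)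
    (if C.node b = x then zeta (C.lift (ZMod m) b) (Y ∩ T.bag x) else C.passed (ZMod m) b Y)

theorem Row.congr {st : St} {a : ℕ} {p q : (ZMod m)⟦X⟧} (h : Row n m st a p)
    (hpq : ∀ j ≤ n, coeff j q = coeff j p) : Row n m st a q :=
  fun j hj => (h j hj).trans (hpq j hj).symm

/-- All kinds of gates share the code that reads the operands; for a gate with a single operand, the
second one is an arbitrary series that is multiplied by zero. -/
theorem wp_evalGate {st : St} {x : Fin t} {Y : Finset (Fin n)} (ha : At C m x Y st)
    (g : Fin s) (h18 : st.r 18 = g) (hx : C.node g = x) (hsrc : Sources C m x Y g st) :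
    WP (env C m hm) evalGate (fun st' =>
      Row n m st' (3 + g) (zeta (C.lift (ZMod m) g) (Y ∩ T.bag x)) ∧
      Frame 20 (fun b => b = 1 ∨ b = 2 ∨ b = 3 + g) st st') st := by
  have h64 := env_const_le C m hm
  have hsQ := (env_s_le C m hm).2
  have hb : ∀ b : Bool, b.toNat ≤ 1 := fun b => Bool.toNat_le b
  have hentry : ∀ i < n + 6, ∀ v, ((C.node g : ℕ) :: (C.gate g).encode).getD i 0 = v →
      (encodeInstance G T C m).getD (6 + n * n + t + t * n + g * (n + 6) + i) 0 = v :=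
    fun i hi v hv => (getD_instance_gate C m g hi).trans hv
  -- the first five entries of the description of a gate
  obtain ⟨k, kb, b, kc, c, h1, h2, h3, h4, h5, hk, hgate⟩ : ∃ (k : ℕ) (kb : Bool) (b : Fin s)
      (kc : Bool) (c : Fin s),
      ((C.node g : ℕ) :: (C.gate g).encode).getD 1 0 = k ∧
      ((C.node g : ℕ) :: (C.gate g).encode).getD 2 0 = kb.toNat ∧
      ((C.node g : ℕ) :: (C.gate g).encode).getD 3 0 = b ∧
      ((C.node g : ℕ) :: (C.gate g).encode).getD 4 0 = kc.toNat ∧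
      ((C.node g : ℕ) :: (C.gate g).encode).getD 5 0 = c ∧ k ≤ 3 ∧
      ((k = 0 ∧ ∃ A a, C.gate g = .const A a) ∨ (k = 1 ∧ C.gate g = .move kb b) ∨
        (k = 2 ∧ C.gate g = .add kb b kc c) ∨
        (k = 3 ∧ kb = false ∧ kc = false ∧ C.gate g = .conv b c)) := by
    have hs : 0 < s := g.pos
    cases hg : C.gate g with
    | const A a =>
      exact ⟨0, false, ⟨0, hs⟩, false, ⟨0, hs⟩, rfl, rfl, rfl, rfl, rfl, by norm_num,
        Or.inl ⟨rfl, A, a, rfl⟩⟩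
    | move kb b =>
      exact ⟨1, kb, b, false, ⟨0, hs⟩, rfl, rfl, rfl, rfl, rfl, by norm_num,
        Or.inr (Or.inl ⟨rfl, rfl⟩)⟩
    | add kb b kc c =>
      exact ⟨2, kb, b, kc, c, rfl, rfl, rfl, rfl, rfl, by norm_num,
        Or.inr (Or.inr (Or.inl ⟨rfl, rfl⟩))⟩
    | conv b c =>
      exact ⟨3, false, b, false, c, rfl, rfl, rfl, rfl, rfl, by norm_num,
        Or.inr (Or.inr (Or.inr ⟨rfl, rfl, rfl, rfl⟩))⟩
  refine WP.seq (WP.readAt (by norm_num) rfl (by simp [gatePos]) k ?_ (by omega) ?_)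
  · simp [gatePos, ha.n_eq, ha.t_eq, h18]
    exact hentry 1 (by omega) _ h1
  refine WP.seq (WP.readAt (by norm_num) rfl (by simp [gatePos]) kb.toNat ?_
    (by have := hb kb; omega) ?_)
  · simp [gatePos, ha.n_eq, ha.t_eq, h18]
    exact hentry 2 (by omega) _ h2
  refine WP.seq (WP.readAt (by norm_num) rfl (by simp [gatePos]) b ?_ (by omega) ?_)
  · simp [gatePos, ha.n_eq, ha.t_eq, h18]
    exact hentry 3 (by omega) _ h3
  refine WP.seq (WP.readAt (by norm_num) rfl (by simp [gatePos]) kc.toNat ?_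
    (by have := hb kc; omega) ?_)
  · simp [gatePos, ha.n_eq, ha.t_eq, h18]
    exact hentry 4 (by omega) _ h4
  refine WP.seq (WP.readAt (by norm_num) rfl (by simp [gatePos]) c ?_ (by omega) ?_)
  · simp [gatePos, ha.n_eq, ha.t_eq, h18]
    exact hentry 5 (by omega) _ h5
  set st₁ := (((((((((st.seek _).set 20 _).seek _).set 21 _).seek _).set 22 _).seek _).set 23
    _).seek _).set 24 _ with hst₁
  have hf₁ : Frame 20 (fun _ => False) st st₁ :=
    (((((((((Frame.refl _ _ st).seek.set (by norm_num)).seek).set (by norm_num)).seek).set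
      (by norm_num)).seek).set (by norm_num)).seek).set (by norm_num)
  have ha₁ := ha.frame hf₁ (by norm_num) not_false
  have e18 := (hf₁.r 18 (by norm_num)).trans h18
  have e20 : st₁.r 20 = k := by simp [hst₁]
  have e21 : st₁.r 21 = kb.toNat := by simp [hst₁]
  have e22 : st₁.r 22 = b := by simp [hst₁]
  have e23 : st₁.r 23 = kc.toNat := by simp [hst₁]
  have e24 : st₁.r 24 = c := by simp [hst₁]
  have hM : st₁.M = st.M := rfl
  have hsrc₁ : Sources C m x Y g st₁ := hsrc
  clear_value st₁
  refine WP.cond rfl (by simp) (fun hne => ?_) (fun h0 => ?_)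
  · rw [Exp.eval_var, e20] at hne
    -- both operands, with an arbitrary second operand in case of a single one
    have hop : ∀ (b : Fin s), ∃ p : (ZMod m)⟦X⟧, Row n m st₁ (sourceRow C x b) p ∧
        ((b < g ∧ (C.node b = x ∨ T.IsChild (C.node b) x)) → p = if C.node b = x then
          zeta (C.lift (ZMod m) b) (Y ∩ T.bag x) else C.passed (ZMod m) b Y) := by
      intro b
      by_cases h : b < g ∧ (C.node b = x ∨ T.IsChild (C.node b) x)
      · exact ⟨_, hsrc₁ b h.1 h.2, fun _ => rfl⟩
      · obtain ⟨p, hp⟩ := row_exists (n := n) (m := m) st₁ (sourceRow C x b)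
        exact ⟨p, hp, fun h' => absurd h' h⟩
    obtain ⟨p, hp, hp'⟩ := hop b
    obtain ⟨q, hq, hq'⟩ := hop c
    refine wp_readOperands ha₁ e21 e22 e23 e24 hp hq ?_
    intro st₂ hr1 hr2 hf₂
    have ha₂ := ha₁.frame hf₂ (by norm_num) (by norm_num)
    have e18₂ := (hf₂.r 18 (by norm_num)).trans e18
    have e20₂ := (hf₂.r 20 (by norm_num)).trans e20
    have hframe : ∀ st₃, Frame 25 (fun a => a = 3 + g) st₂ st₃ →
        Frame 20 (fun b => b = 1 ∨ b = 2 ∨ b = 3 + g) st st₃ := by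
      intro st₃ hf₃
      refine ((hf₁.mono le_rfl (fun _ h => h.elim)).trans hf₂ (by norm_num) ?_).trans hf₃
        (by norm_num) (fun _ h => Or.inr (Or.inr h))
      rintro a (h | h)
      · exact Or.inl h
      · exact Or.inr (Or.inl h)
    refine WP.cond rfl (by simp) (fun h3 => ?_) (fun h3 => ?_)
    · refine (wp_evalAdd ha₂.toGlob g e18₂ k e20₂ hr1 hr2).mono ?_
      rintro st₃ ⟨hr, hf₃⟩
      refine ⟨hr.congr fun j hj => ?_, hframe st₃ hf₃⟩
      rcases hgate with ⟨rfl, -⟩ | ⟨rfl, hgate⟩ | ⟨rfl, hgate⟩ | ⟨rfl, -⟩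
      · exact absurd rfl hne
      · have hw := C.move_wire g kb b hgate
        have h := C.coeff_zeta_lift_move (ZMod m) hgate Y hj
        rw [hx] at h hw
        rw [hp' hw, h, Circuit.operand]
        simp
      · have hw := C.add_wire g kb b kc c hgate
        have h := C.coeff_zeta_lift_add (ZMod m) hgate Y hj
        rw [hx] at h hw
        rw [hp' hw.1, hq' hw.2, h, Circuit.operand, Circuit.operand]
        simp
      · rw [Exp.eval_sub, Exp.eval_var, e20₂] at h3
        exact absurd rfl h3
    · rw [Exp.eval_sub, Exp.eval_var, e20₂] at h3
      have h3' : 3 - k = 0 := h3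
      refine (wp_evalMul ha₂.toGlob g e18₂ hr1 hr2).mono ?_
      rintro st₃ ⟨hr, hf₃⟩
      refine ⟨hr.congr fun j hj => ?_, hframe st₃ hf₃⟩
      rcases hgate with ⟨rfl, -⟩ | ⟨rfl, -⟩ | ⟨rfl, -⟩ | ⟨rfl, rfl, rfl, hgate⟩
      · omega
      · omega
      · omega
      · have hw := C.conv_wire g b c hgate
        have h := C.coeff_zeta_lift_conv (ZMod m) hgate Y hj
        rw [hx] at h hw
        rw [hp' ⟨hw.1.1, hw.1.2.1⟩, hq' ⟨hw.2.1, hw.2.2.1⟩, h, Circuit.operand, Circuit.operand]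
  · rw [Exp.eval_var, e20] at h0
    rcases hgate with ⟨-, A, a, hgate⟩ | ⟨rfl, -⟩ | ⟨rfl, -⟩ | ⟨rfl, -⟩
    · refine (wp_evalConst ha₁ g e18 hx hgate).mono ?_
      rintro st₂ ⟨hr, hf⟩
      exact ⟨hr, (hf₁.mono le_rfl (fun _ h => h.elim)).trans hf le_rfl
        (fun _ h => Or.inr (Or.inr h))⟩
    all_goals omega

theorem base_coeff (T : TreeDecomp G t) (x : Fin t) (Y : Finset (Fin n)) (p : (ZMod m)⟦X⟧)
    (j k : ℕ) (hk : k = (T.forgotten x ∩ Y).card) :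
    coeff j (Circuit.base T x Y p) = coeff j p * ((1 - (1 - k) : ℕ) : ZMod m) := by
  classical
  subst hk
  rw [Circuit.base]
  split_ifs with h
  · have : (T.forgotten x ∩ Y).card = 0 := by
      rw [Finset.card_eq_zero, ← Finset.disjoint_iff_inter_eq_empty]
      exact h
    rw [this]
    simp
  · have : (T.forgotten x ∩ Y).card ≠ 0 := by
      rw [Ne, Finset.card_eq_zero, ← Finset.disjoint_iff_inter_eq_empty]
      exact h
    have : 1 - (1 - (T.forgotten x ∩ Y).card) = 1 := by omega
    rw [this]
    simp

theorem wp_accumulate {st : St} {x : Fin t} {Y : Finset (Fin n)} (hg : Glob C m st)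
    (g : Fin s) (h18 : st.r 18 = g) (h11 : st.r 11 = (T.forgotten x \ Y).card)
    (h12 : st.r 12 = (T.forgotten x ∩ Y).card) (h13 : st.r 13 = (T.forgotten x).card)
    {p q : (ZMod m)⟦X⟧} (hp : Row n m st (3 + g) p) (hq : Row n m st (3 + s + g) q) :
    WP (env C m hm) accumulate (fun st' =>
      Row n m st' (3 + s + g) (Circuit.base T x Y q + (-1 : ℤ) ^ (T.forgotten x \ Y).card •
        lower n (T.forgotten x).card p) ∧
      Frame 20 (fun b => b = 3 + s + g) st st') st := by
  have hmQ := env_m_le C m hm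
  have hrows := row_lt_rows (C := C) (m := m) (hm := hm) g
  refine (wp_fillRow hg (3 + s + g) (Circuit.base T x Y q +
    (-1 : ℤ) ^ (T.forgotten x \ Y).card • lower n (T.forgotten x).card p) ?_).mono ?_
  · intro j hj st' hf hx hun
    have hg' := hg.frame hf (by norm_num)
    have e18 := (hf.r 18 (by norm_num)).trans h18
    have e11 := (hf.r 11 (by norm_num)).trans h11
    have e12 := (hf.r 12 (by norm_num)).trans h12
    have e13 := (hf.r 13 (by norm_num)).trans h13
    set d := (T.forgotten x).card with hd
    set k := (T.forgotten x \ Y).card with hk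
    have hcol : j < (env C m hm).cols := show j < n + 1 by omega
    refine WP.of_bounds fun _ hMlt => ?_
    -- the term without its sign
    have step1 : WP (env C m hm) (cond (§1 + 1 - (§25 + §13))
        (asg 27 (.cell (3 + §18) (§25 + §13))) (asg 27 0)) (fun st₁ =>
          st₁.r 27 < m ∧ (st₁.r 27 : ZMod m) = coeff j (lower n d p) ∧ st₁.r 25 = j ∧
          Frame 25 (fun _ => False) st' st₁) st' := by
      have hcond : (§1 + 1 - (§25 + §13) : Exp).eval st' = n + 1 - (j + d) := by
        simp [hg'.n_eq, hx, e13]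
      refine WP.cond rfl (by simp) (fun hne => ?_) (fun h0 => ?_)
      · rw [hcond] at hne
        have hcol' : j + d < (env C m hm).cols := show j + d < n + 1 by omega
        have hlt : st'.M (3 + g) (j + d) < m := hMlt _ hrows.1 _ hcol'
        refine WP.asg (by norm_num) rfl ?_ ?_ ?_
        · simp [e18, hx, e13, hrows.1, hcol']
        · simp [e18, hx, e13]
          omega
        · refine ⟨by simpa [e18, hx, e13] using hlt, ?_, by simpa using hx,
            (Frame.refl _ _ _).set (by norm_num)⟩
          rw [coeff_lower, if_pos (by omega), ← hp (j + d) (by omega),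
            ← hf.M (3 + g) (show ¬ (3 + (g : ℕ) = 3 + s + g) by omega)]
          simp [e18, hx, e13]
      · rw [hcond] at h0
        refine WP.asg (by norm_num) rfl (by simp) (by simp) ⟨by simp; omega, ?_,
          by simpa using hx, (Frame.refl _ _ _).set (by norm_num)⟩
        rw [coeff_lower, if_neg (by omega)]
        simp
    refine WP.seq (step1.mono ?_)
    rintro st₁ ⟨hlt₁, hv₁, h25₁, hf₁⟩
    have hg₁ := hg'.frame hf₁ (by norm_num)
    have e11₁ := (hf₁.r 11 (by norm_num)).trans e11
    have step2 : WP (env C m hm) (cond (§11 % 2) (asg 27 (§4 - §27)) skip) (fun st₂ =>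
          (st₂.r 27 : ZMod m) = (-1) ^ k * coeff j (lower n d p) ∧ st₂.r 25 = j ∧
          Frame 25 (fun _ => False) st' st₂) st₁ := by
      refine WP.cond rfl (by simp) (fun hne => ?_) (fun h0 => ?_)
      · have hodd : k % 2 = 1 := by
          have : k % 2 ≠ 0 := by simpa [e11₁] using hne
          omega
        refine WP.asg (by norm_num) rfl (by simp) ?_ ⟨?_, by simpa using h25₁,
          hf₁.set (by norm_num)⟩
        · simp [hg₁.m_eq]
          omega
        · simp [hg₁.m_eq, Nat.cast_sub hlt₁.le, hv₁, (Nat.odd_iff.2 hodd).neg_one_pow]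
      · have heven : k % 2 = 0 := by
          have : k % 2 = 0 := by
            have h0' : st₁.r 11 % 2 = 0 := h0
            rwa [e11₁] at h0'
          exact this
        exact WP.skip ⟨by simp [hv₁, (Nat.even_iff.2 heven).neg_one_pow], h25₁, hf₁⟩
    refine WP.seq (step2.mono ?_)
    rintro st₂ ⟨hv₂, h25₂, hf₂⟩
    have hg₂ := hg'.frame hf₂ (by norm_num)
    have e18₂ := (hf₂.r 18 (by norm_num)).trans e18
    have e12₂ := (hf₂.r 12 (by norm_num)).trans e12
    have hold : (st₂.M (3 + s + g) j : ZMod m) = (st'.M (3 + s + g) j : ZMod m) := by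
      rw [hf₂.M _ not_false]
    refine WP.put rfl rfl rfl ?_ (by simp) (by simp) ?_ ?_ ?_ ?_
    · simp [e18₂, hg₂.s_eq, h25₂, hrows.2, hcol]
    · simpa [e18₂, hg₂.s_eq] using hrows.2
    · simpa [h25₂] using hcol
    · simp only [Exp.eval_mod, Exp.eval_var, hg₂.m_eq]
      exact (env_mod_le (C := C) (hm := hm) _).1
    · refine ⟨h25₂, ⟨hf₂.r, fun a h c => ?_⟩, ?_, ?_⟩
      · simp [e18₂, hg₂.s_eq, h, hf₂.M a not_false]
      · have hold' : (st₂.M (3 + s + g) j : ZMod m) = coeff j q := by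
          rw [hold, hun j le_rfl, hq j hj]
        rw [map_add, base_coeff T x Y q j _ rfl, map_zsmul, zsmul_eq_mul]
        simp [e18₂, hg₂.s_eq, h25₂, hg₂.m_eq, e12₂, hold', hv₂]
      · intro i hi
        simp [h25₂, hi, hf₂.M _ not_false]
  · rintro st' ⟨hr, hf⟩
    exact ⟨hr, hf.mono (by norm_num) (fun _ h => h)⟩

end RAM

/-! ### The rounds of the traversal -/

namespace RAM

open PowerSeries

variable {n : ℕ} {G : SimpleGraph (Fin n)} {t : ℕ} {T : TreeDecomp G t} {s : ℕ}
variable {C : Circuit T s} {m : ℕ} {hm : 1 < m}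

/-- The operands at the current node precede the gate, so their zeta transforms are present when it
is evaluated; the operands at children are the accumulators, which are not changed here. -/
theorem wp_evalGates {st : St} {x : Fin t} {Y : Finset (Fin n)} (ha : At C m x Y st)
    (h11 : st.r 11 = (T.forgotten x \ Y).card) (h12 : st.r 12 = (T.forgotten x ∩ Y).card)
    (h13 : st.r 13 = (T.forgotten x).card) {acc : Fin s → (ZMod m)⟦X⟧}
    (hready : C.Ready x Y acc) (hacc : ∀ g : Fin s, Row n m st (3 + s + g) (acc g)) :
    WP (env C m hm) evalGates (fun st' =>
      (∀ g : Fin s, Row n m st' (3 + s + g) (C.accumulate x Y acc g)) ∧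
      Frame 18 (fun a => a ≠ 0) st st') st := by
  have h64 := env_const_le C m hm
  obtain ⟨hsN, hsQ⟩ := env_s_le C m hm
  have htQ := env_t_lt C m hm
  refine WP.for' (fun i st' => Frame 18 (fun a => a ≠ 0) st st' ∧
    (∀ b : Fin s, b < i → C.node b = x →
      Row n m st' (3 + b) (zeta (C.lift (ZMod m) b) (Y ∩ T.bag x))) ∧
    ∀ b : Fin s, Row n m st' (3 + s + b)
      (if (b : ℕ) < i then C.accumulate x Y acc b else acc b))
    s (by norm_num) hsN hsQ rfl ?_ ?_ ?_ ?_
  · rintro i st' ⟨hf, -, -⟩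
    exact ⟨by simp, by simpa using (ha.toGlob.frame hf (by norm_num)).s_eq⟩
  · exact ⟨(Frame.refl _ _ _).set (by norm_num), fun b hb => absurd hb (by omega),
      fun b => by
        rw [if_neg (Nat.not_lt_zero _)]
        exact hacc b⟩
  · rintro i hi st' ⟨hf, hz, hr⟩ h18
    have ha' := ha.frame hf (by norm_num) (by simp)
    set g : Fin s := ⟨i, hi⟩ with hg
    have hgi : (g : ℕ) = i := rfl
    refine WP.seq (WP.readAt (by norm_num) rfl (by simp [gatePos]) (C.node g : ℕ) ?_
      (by have := (C.node g).2; omega) ?_)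
    · have := getD_instance_node C m g
      simp [gatePos, ha'.n_eq, ha'.t_eq, h18]
      exact this
    set st₁ := (st'.seek _).set 19 _ with hst₁
    have hf₁ : Frame 19 (fun _ => False) st' st₁ := ((Frame.refl _ _ _).seek).set (by norm_num)
    have e18 := (hf₁.r 18 (by norm_num)).trans h18
    have ha₁ := ha'.frame hf₁ (by norm_num) not_false
    have hz₁ : ∀ b : Fin s, b < i → C.node b = x →
      Row n m st₁ (3 + b) (zeta (C.lift (ZMod m) b) (Y ∩ T.bag x)) := hz
    have hr₁ : ∀ b : Fin s, Row n m st₁ (3 + s + b)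
      (if (b : ℕ) < i then C.accumulate x Y acc b else acc b) := hr
    have e19 : st₁.r 19 = C.node g := by simp [hst₁]
    have hf₁' : Frame 18 (fun a => a ≠ 0) st st₁ :=
      hf.trans hf₁ (by norm_num) (fun _ h => h.elim)
    clear_value st₁
    have hcond : (eqExp §19 §7).eval st₁ = if C.node g = x then 1 else 0 := by
      simp [e19, ha₁.x_eq, Fin.ext_iff]
    refine WP.cond rfl (by simp) (fun hne => ?_) (fun h0 => ?_)
    · rw [hcond] at hne
      have hgx : C.node g = x := by
        by_contra h
        simp [h] at hne
      have hsrc : Sources C m x Y g st₁ := by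
        intro b hb hbx
        by_cases h : C.node b = x
        · rw [sourceRow, if_pos h, if_pos h]
          exact hz₁ b hb h
        · rw [sourceRow, if_neg h, if_neg h]
          have hchild : T.IsChild (C.node b) x := hbx.resolve_left h
          have := hr₁ b
          rw [Circuit.accumulate, if_neg h, ite_self, hready b hchild] at this
          rwa [add_right_comm] at this
      refine WP.seq ((wp_evalGate ha₁ g e18 hgx hsrc).mono ?_)
      rintro st₂ ⟨hr₂, hf₂⟩
      have ha₂ := ha₁.frame hf₂ (by norm_num) (by omega)
      have hold : Row n m st₂ (3 + s + g) (acc g) := by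
        have := Row.frame (hr₁ g) hf₂ (by omega)
        rwa [if_neg (by omega)] at this
      have e : ∀ j < 18, st₂.r j = st.r j := fun j hj =>
        (hf₂.r j (by omega)).trans (hf₁'.r j hj)
      refine (wp_accumulate ha₂.toGlob g ((hf₂.r 18 (by norm_num)).trans e18)
        ((e 11 (by norm_num)).trans h11) ((e 12 (by norm_num)).trans h12)
        ((e 13 (by norm_num)).trans h13) hr₂ hold).mono ?_
      rintro st₃ ⟨hr₃, hf₃⟩
      have hf₂₃ : Frame 20 (fun b => b = 1 ∨ b = 2 ∨ b = 3 + g ∨ b = 3 + s + g) st₁ st₃ :=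
        (hf₂.mono le_rfl (by omega)).trans hf₃ le_rfl (by omega)
      refine ⟨(hf₂₃.r 18 (by norm_num)).trans e18, ?_, ?_, ?_⟩
      · exact (hf₁'.trans hf₂₃ (by norm_num) (by omega)).set le_rfl
      · intro b hb hbx
        show Row n m st₃ _ _
        by_cases hbg : b = g
        · subst hbg
          exact Row.frame hr₂ hf₃ (by omega)
        · have hne : (b : ℕ) ≠ g := fun h => hbg (Fin.ext h)
          exact Row.frame (hz₁ b (by omega) hbx) hf₂₃ (by omega)
      · intro b
        show Row n m st₃ _ _
        by_cases hbg : b = g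
        · subst hbg
          rw [if_pos (by omega), Circuit.accumulate, if_pos hgx]
          exact hr₃
        · have hne : (b : ℕ) ≠ g := fun h => hbg (Fin.ext h)
          have := Row.frame (hr₁ b) hf₂₃ (by omega)
          have hiff : (b : ℕ) < i + 1 ↔ (b : ℕ) < i := by omega
          simpa only [hiff] using this
    · rw [hcond] at h0
      have hgx : C.node g ≠ x := by
        intro h
        simp [h] at h0
      refine WP.skip ⟨e18, hf₁'.set le_rfl, ?_, ?_⟩
      · intro b hb hbx
        have hne : (b : ℕ) ≠ g := fun h => hgx (Fin.ext h ▸ hbx)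
        exact hz₁ b (by omega) hbx
      · intro b
        show Row n m st₁ _ _
        have := hr₁ b
        by_cases hbg : b = g
        · subst hbg
          rw [if_neg (by omega)] at this
          rw [if_pos (by omega), Circuit.accumulate, if_neg hgx]
          exact this
        · have hne : (b : ℕ) ≠ g := fun h => hbg (Fin.ext h)
          have hiff : (b : ℕ) < i + 1 ↔ (b : ℕ) < i := by omega
          simpa only [hiff] using this
  · rintro st' ⟨hf, -, hr⟩ -
    exact ⟨fun g => by simpa using hr g, hf⟩

/-- Row 0 contains the set `Y`. -/
def SetRow (Y : Finset (Fin n)) (st : St) : Prop :=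
  ∀ v : Fin n, st.M 0 v = if v ∈ Y then 1 else 0

open Classical in
theorem wp_increment {st : St} {x : Fin t} {Y : Finset (Fin n)} (ha : At C m x Y st)
    (hp : st.r 10 = T.parent x) :
    WP (env C m hm) increment (fun st' => Frame 14 (fun a => a = 0) st st' ∧
      ((st'.r 17 = 1 ∧ T.forgotten x ⊆ Y ∧ SetRow (Y \ T.forgotten x) st') ∨
        (st'.r 17 = 0 ∧ ∃ v ∈ T.forgotten x, v ∉ Y ∧ (∀ u ∈ T.forgotten x, u < v → u ∈ Y) ∧
          SetRow (insert v (Y \ (T.forgotten x).filter (· < v))) st'))) st := by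
  have h64 := env_const_le C m hm
  obtain ⟨hnN, hnQ⟩ := env_n_lt C m hm
  refine WP.seq (WP.asg (by norm_num) rfl (by simp) (by simp; omega) ?_)
  refine WP.for' (fun i st' => Frame 14 (fun a => a = 0) st st' ∧
    ((st'.r 17 = 1 ∧ (∀ u ∈ T.forgotten x, (u : ℕ) < i → u ∈ Y) ∧
        SetRow (Y \ (T.forgotten x).filter (fun u : Fin n => (u : ℕ) < i)) st') ∨
      (st'.r 17 = 0 ∧ ∃ v ∈ T.forgotten x, v ∉ Y ∧ (∀ u ∈ T.forgotten x, u < v → u ∈ Y) ∧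
        SetRow (insert v (Y \ (T.forgotten x).filter (· < v))) st')))
    n (by norm_num) (by omega) (by omega) rfl ?_ ?_ ?_ ?_
  · rintro i st' ⟨hf, -⟩
    exact ⟨by simp, by simpa using (ha.toGlob.frame hf (by norm_num)).n_eq⟩
  · refine ⟨((Frame.refl _ _ _).set (by norm_num)).set (by norm_num), Or.inl ⟨by simp, by simp, ?_⟩⟩
    simpa [SetRow] using ha.set_eq
  · rintro i hi st' ⟨hf, hI⟩ h14
    set w : Fin n := ⟨i, hi⟩ with hw
    have hwi : (w : ℕ) = i := rfl
    refine WP.seq ((wp_testForgotten (ha.toGlob.frame hf (by norm_num))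
      ((hf.r 7 (by norm_num)).trans ha.x_eq) ((hf.r 10 (by norm_num)).trans hp) w h14).mono ?_)
    rintro st₁ ⟨h15, hr, hM⟩
    have e14 : st₁.r 14 = i := (hr 14 (by norm_num) (by norm_num)).trans h14
    have e17 := hr 17 (by norm_num) (by norm_num)
    have hf₁ : Frame 14 (fun a => a = 0) st st₁ :=
      ⟨fun j hj => (hr j (by omega) (by omega)).trans (hf.r j hj),
        fun a h c => by rw [hM]; exact hf.M a h c⟩
    have hset : ∀ Z : Finset (Fin n), SetRow Z st' → SetRow Z st₁ := fun Z h v => by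
      rw [hM]
      exact h v
    have hcol : (0 : ℕ) < (env C m hm).rows ∧ i < (env C m hm).cols :=
      ⟨show 0 < 3 + s + s by omega, show i < n + 1 by omega⟩
    have hcond : (§15 * §17 : Exp).eval st₁ = (if w ∈ T.forgotten x then 1 else 0) * st'.r 17 := by
      simp [h15, e17]
    refine WP.cond rfl (by simp) (fun hne => ?_) (fun h0 => ?_)
    · rw [hcond] at hne
      have hwD : w ∈ T.forgotten x := by
        by_contra h
        simp [h] at hne
      rcases hI with ⟨h17, hall, hrow⟩ | ⟨h17, -⟩
      swap
      · simp [h17] at hne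
      have hrow₁ := hset _ hrow
      have hcell : st₁.M 0 i = if w ∈ Y then 1 else 0 := by
        have := hrow₁ w
        simpa [hwi] using this
      refine WP.seq (WP.asg (by norm_num) rfl (by simpa [e14] using hcol) ?_ ?_)
      · simp [e14, hcell]
        split_ifs <;> omega
      have hval : (Exp.cell 0 §14).eval st₁ = if w ∈ Y then 1 else 0 := by simp [e14, hcell]
      rw [hval]
      have hmem : ∀ v : Fin n, v ≠ w → (v ∈ Y \ (T.forgotten x).filter (fun u : Fin n =>
          (u : ℕ) < i + 1) ↔ v ∈ Y \ (T.forgotten x).filter (fun u : Fin n => (u : ℕ) < i)) := by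
        intro v hv
        have : (v : ℕ) ≠ i := fun h => hv (Fin.ext h)
        have hiff : (v : ℕ) < i + 1 ↔ (v : ℕ) < i := by omega
        simp only [Finset.mem_sdiff, Finset.mem_filter, hiff]
      refine WP.put rfl rfl rfl (by simp) (by simp) (by simp) hcol.1
        (by simpa [e14] using hcol.2) ?_ ?_
      · show _ < m
        simp
        omega
      · refine ⟨by simpa using e14, ((hf₁.set (by norm_num)).put (by simp)).set (by norm_num), ?_⟩
        by_cases hwY : w ∈ Y
        · refine Or.inl ⟨by simp [hwY], fun u hu hui => ?_, fun v => ?_⟩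
          · by_cases h : u = w
            · exact h ▸ hwY
            · have : (u : ℕ) ≠ i := fun h' => h (Fin.ext h')
              exact hall u hu (by omega)
          · by_cases h : v = w
            · simp [h, hwi, e14, hwY, hwD]
            · have hvi : (v : ℕ) ≠ i := fun h' => h (Fin.ext h')
              simp only [St.set_M, St.put_M, hmem v h]
              simp [e14, hvi]
              simpa using hrow₁ v
        · refine Or.inr ⟨by simp [hwY], w, hwD, hwY, fun u hu huw => hall u hu huw, fun v => ?_⟩
          by_cases h : v = w
          · simp [h, hwi, e14, hwY]
          · have hvi : (v : ℕ) ≠ i := fun h' => h (Fin.ext h')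
            have := hrow₁ v
            simp only [St.set_M, St.put_M, Finset.mem_insert, h, false_or, Fin.lt_def, hwi]
            simp [e14, hvi]
            simpa using this
    · rw [hcond] at h0
      refine WP.skip ⟨e14, hf₁.set (by norm_num), ?_⟩
      rcases hI with ⟨h17, hall, hrow⟩ | ⟨h17, v, hv, hvY, hall, hrow⟩
      · have hwD : w ∉ T.forgotten x := by
          intro h
          simp [h, h17] at h0
        have hiff : ∀ u ∈ T.forgotten x, ((u : ℕ) < i + 1 ↔ (u : ℕ) < i) := by
          intro u hu
          have : (u : ℕ) ≠ i := fun h => hwD ((Fin.ext h : u = w) ▸ hu)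
          omega
        refine Or.inl ⟨by simpa [e17] using h17, fun u hu h => hall u hu ((hiff u hu).1 h), ?_⟩
        rw [Finset.filter_congr hiff]
        exact hset _ hrow
      · exact Or.inr ⟨by simpa [e17] using h17, v, hv, hvY, hall, hset _ hrow⟩
  · rintro st' ⟨hf, hI⟩ -
    refine ⟨hf, ?_⟩
    rcases hI with ⟨h17, hall, hrow⟩ | h
    · rw [Finset.filter_true_of_mem (fun v _ => v.2)] at hrow
      exact Or.inl ⟨h17, fun u hu => hall u hu u.2, hrow⟩
    · exact Or.inr h

/-- The variables and the matrix hold a state of the traversal. -/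
structure Abs (C : Circuit T s) (m : ℕ) (cfg : Circuit.Config n t s (ZMod m)) (st : St) : Prop
    extends At C m cfg.x cfg.Y st where
  k_eq : st.r 8 = cfg.k
  run_eq : st.r 9 = cfg.run.toNat
  acc_eq : ∀ g : Fin s, Row n m st (3 + s + g) (cfg.acc g)

/-- A round of the program performs a step of the traversal. -/
theorem wp_round {cfg cfg' : Circuit.Config n t s (ZMod m)} (hstep : C.Step cfg cfg') {st : St}
    (ha : Abs C m cfg st) : WP (env C m hm) round (Abs C m cfg') st := by
  classical
  have h64 := env_const_le C m hm
  have htQ := env_t_lt C m hm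
  -- a child is entered or skipped
  have hchild : ∀ (x k : Fin t) (Y : Finset (Fin n)) (acc : Fin s → (ZMod m)⟦X⟧),
      Abs C m ⟨true, x, k, Y, acc⟩ st → WP (env C m hm) round
        (Abs C m (if T.IsChild k x then ⟨true, k, 0, Y, acc⟩ else ⟨true, x, k + 1, Y, acc⟩))
        st := by
    intro x k Y acc ha
    have hk : st.r 8 = k := ha.k_eq
    have hx : st.r 7 = x := ha.x_eq
    have hrun : st.r 9 = 1 := ha.run_eq
    refine WP.cond rfl (by simp) (fun _ => ?_) (fun h0 => ?_)
    swap
    · have := k.2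
      simp only [Exp.eval_sub, Exp.eval_var, ha.t_eq, hk] at h0
      omega
    refine WP.seq (WP.readAt (by norm_num) rfl (by simp [parentPos]) (T.parent k : ℕ) ?_
      (by have := (T.parent k).2; omega) ?_)
    · have := getD_instance_parent C m k
      simp [parentPos, ha.n_eq, hk]
      exact this
    set st₁ := (st.seek _).set 10 _ with hst₁
    have hf₁ : Frame 10 (fun _ => False) st st₁ := ((Frame.refl _ _ _).seek).set (by norm_num)
    have ha₁ := ha.toAt.frame hf₁ (by norm_num) not_false
    have e10 : st₁.r 10 = T.parent k := by simp [hst₁]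
    have e8 := (hf₁.r 8 (by norm_num)).trans hk
    have e9 := (hf₁.r 9 (by norm_num)).trans hrun
    have hacc₁ : ∀ g : Fin s, Row n m st₁ (3 + s + g) (acc g) := ha.acc_eq
    clear_value st₁
    have hcond : (eqExp §10 §7 * neExp §8 §5).eval st₁ = if T.IsChild k x then 1 else 0 := by
      have e7 : st₁.r 7 = x := ha₁.x_eq
      simp only [Exp.eval_mul, eval_eqExp, eval_neExp, Exp.eval_var, e10, e7, e8, ha₁.root_eq,
        T.isChild_iff, Fin.val_inj]
      by_cases h1 : T.parent k = x <;> by_cases h2 : k = T.root <;> simp [h1, h2]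
    refine WP.cond rfl (by simp) (fun hne => ?_) (fun h0 => ?_)
    · rw [hcond] at hne
      have hc : T.IsChild k x := by
        by_contra h
        simp [h] at hne
      rw [if_pos hc]
      refine WP.seq (WP.asg (by norm_num) rfl (by simp) (by simp [e8]; omega) ?_)
      refine WP.asg (by norm_num) rfl (by simp) (by simp) ?_
      exact ⟨⟨⟨ha₁.n_eq, ha₁.t_eq, ha₁.s_eq, ha₁.m_eq, ha₁.root_eq, ha₁.out_eq⟩, by simp [e8],
        ha₁.set_eq⟩, by simp, by simpa using e9, hacc₁⟩
    · rw [hcond] at h0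
      have hc : ¬ T.IsChild k x := by
        intro h
        simp [h] at h0
      rw [if_neg hc]
      refine WP.asg (by norm_num) rfl (by simp) (by simp [e8]; omega) ?_
      exact ⟨⟨⟨ha₁.n_eq, ha₁.t_eq, ha₁.s_eq, ha₁.m_eq, ha₁.root_eq, ha₁.out_eq⟩, ha₁.x_eq,
        ha₁.set_eq⟩, by simp [e8], by simpa using e9, hacc₁⟩
  -- the gates at a node are evaluated
  have heval : ∀ (x : Fin t) (Y : Finset (Fin n)) (acc : Fin s → (ZMod m)⟦X⟧),
      Abs C m ⟨true, x, t, Y, acc⟩ st → C.Ready x Y acc → WP (env C m hm) round (fun st' =>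
        (T.forgotten x ⊆ Y ∧ Abs C m ⟨decide (x ≠ T.root), T.parent x, x + 1, Y \ T.forgotten x,
          C.accumulate x Y acc⟩ st') ∨
        ∃ v ∈ T.forgotten x, v ∉ Y ∧ (∀ u ∈ T.forgotten x, u < v → u ∈ Y) ∧
          Abs C m ⟨true, x, 0, insert v (Y \ (T.forgotten x).filter (· < v)),
            C.accumulate x Y acc⟩ st') st := by
    intro x Y acc ha hready
    have hk : st.r 8 = t := ha.k_eq
    have hx : st.r 7 = x := ha.x_eq
    have hrun : st.r 9 = 1 := ha.run_eq
    refine WP.cond rfl (by simp) (fun hne => ?_) (fun _ => ?_)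
    · simp [ha.t_eq, hk] at hne
    refine WP.seq (WP.readAt (by norm_num) rfl (by simp [parentPos]) (T.parent x : ℕ) ?_
      (by have := (T.parent x).2; omega) ?_)
    · have := getD_instance_parent C m x
      simp [parentPos, ha.n_eq, hx]
      exact this
    set st₁ := (st.seek _).set 10 _ with hst₁
    have hf₁ : Frame 10 (fun _ => False) st st₁ := ((Frame.refl _ _ _).seek).set (by norm_num)
    have ha₁ := ha.toAt.frame hf₁ (by norm_num) not_false
    have e10 : st₁.r 10 = T.parent x := by simp [hst₁]
    have e9 := (hf₁.r 9 (by norm_num)).trans hrun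
    have hacc₁ : ∀ g : Fin s, Row n m st₁ (3 + s + g) (acc g) := ha.acc_eq
    clear_value st₁
    refine WP.seq ((wp_countForgotten ha₁ e10).mono ?_)
    rintro st₂ ⟨h11, h12, h13, hf₂⟩
    have ha₂ := ha₁.frame hf₂ (by norm_num) not_false
    refine WP.seq ((wp_evalGates ha₂ h11 h12 h13 hready
      (fun g => Row.frame (hacc₁ g) hf₂ not_false)).mono ?_)
    rintro st₃ ⟨hacc₃, hf₃⟩
    have ha₃ := ha₂.frame hf₃ (by norm_num) (by simp)
    have e10₃ := (hf₃.r 10 (by norm_num)).trans ((hf₂.r 10 (by norm_num)).trans e10)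
    refine WP.seq ((wp_increment ha₃ e10₃).mono ?_)
    rintro st₄ ⟨hf₄, hcase⟩
    have hg₄ := ha₃.toGlob.frame hf₄ (by norm_num)
    have e7₄ : st₄.r 7 = x := (hf₄.r 7 (by norm_num)).trans ha₃.x_eq
    have e9₄ : st₄.r 9 = 1 := (hf₄.r 9 (by norm_num)).trans ((hf₃.r 9 (by norm_num)).trans
      ((hf₂.r 9 (by norm_num)).trans e9))
    have e10₄ := (hf₄.r 10 (by norm_num)).trans e10₃
    have hacc₄ : ∀ g : Fin s, Row n m st₄ (3 + s + g) (C.accumulate x Y acc g) := fun g =>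
      Row.frame (hacc₃ g) hf₄ (by omega)
    rcases hcase with ⟨h17, hsub, hrow⟩ | ⟨h17, v, hv, hvY, hall, hrow⟩
    · refine WP.cond rfl (by simp) (fun _ => ?_) (fun h0 => ?_)
      swap
      · simp [h17] at h0
      refine WP.seq (WP.asg (by norm_num) rfl (by simp) (by have := x.2; simp [e7₄]; omega) ?_)
      refine WP.seq (WP.asg (by norm_num) rfl (by simp) (by simp; split_ifs <;> omega) ?_)
      refine WP.asg (by norm_num) rfl (by simp)
        (by have := (T.parent x).2; simp [e10₄]; omega) (Or.inl ⟨hsub, ?_⟩)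
      refine ⟨⟨⟨hg₄.n_eq, hg₄.t_eq, hg₄.s_eq, hg₄.m_eq, hg₄.root_eq, hg₄.out_eq⟩, by simp [e10₄],
        hrow⟩, by simp [e7₄], ?_, hacc₄⟩
      by_cases h : x = T.root <;> simp [e7₄, hg₄.root_eq, h, Fin.val_inj]
    · refine WP.cond rfl (by simp) (fun hne => ?_) (fun _ => ?_)
      · simp [h17] at hne
      refine WP.asg (by norm_num) rfl (by simp) (by simp) (Or.inr ⟨v, hv, hvY, hall, ?_⟩)
      exact ⟨⟨⟨hg₄.n_eq, hg₄.t_eq, hg₄.s_eq, hg₄.m_eq, hg₄.root_eq, hg₄.out_eq⟩, e7₄, hrow⟩,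
        by simp, by simpa using e9₄, hacc₄⟩
  cases hstep with
  | @descend x k Y acc hc =>
    have := hchild x k Y acc ha
    rwa [if_pos hc] at this
  | @skip x k Y acc hc =>
    have := hchild x k Y acc ha
    rwa [if_neg hc] at this
  | @next x Y acc v hready hv hvY hall =>
    refine (heval x Y acc ha hready).mono ?_
    rintro st' (⟨hsub, -⟩ | ⟨w, hw, hwY, hall', h⟩)
    · exact absurd (hsub hv) hvY
    · have : w = v := by
        rcases lt_trichotomy w v with h | h | h
        · exact absurd (hall w hw h) hwY
        · exact h
        · exact absurd (hall' v hv h) hvY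
      subst this
      convert h
  | @up x Y acc hready hsub =>
    refine (heval x Y acc ha hready).mono ?_
    rintro st' (⟨-, h⟩ | ⟨w, hw, hwY, -⟩)
    · convert h
    · exact absurd (hsub hw) hwY

end RAM

/-! ### The complete run -/

namespace RAM

open PowerSeries

variable {n : ℕ} {G : SimpleGraph (Fin n)} {t : ℕ} {T : TreeDecomp G t} {s : ℕ}
variable (C : Circuit T s) {m : ℕ} (hm : 1 < m)

/-- The values of the variables at the start. -/
def St.init : St := ⟨fun _ => 0, fun _ _ => 0, 0⟩

theorem run_initCols :
    ∃ τ, Run (env C m hm) initCols Store.init τ ∧ Rep (env C m hm) τ St.init := by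
  obtain ⟨-, hnQ⟩ := env_n_lt C m hm
  have hinp : (env C m hm).inp.getD 0 0 = n := rfl
  have h₀ : Bounded (env C m hm) Store.init :=
    ⟨Nat.zero_le _, fun i _ => by simp [Store.init], fun i _ => (env C m hm).m_pos⟩
  have h₁ : Bounded (env C m hm) (Store.init.write 40 n) :=
    h₀.write_reg (by norm_num) ((env C m hm).size_le_bits (by omega))
  have h₂ : Bounded (env C m hm) ((Store.init.write 40 n).write 41 1) :=
    h₁.write_reg (by norm_num) ((env C m hm).size_le_bits (by omega))
  have h₃ : Bounded (env C m hm) (((Store.init.write 40 n).write 41 1).write 40 (n + 1)) :=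
    h₂.write_reg (by norm_num) ((env C m hm).size_le_bits hnQ)
  have e1 : (Instr.read 40).exec (env C m hm).inp Store.init = Store.init.write 40 n := rfl
  have e3 : (Instr.arith .add 40 40 41).exec (env C m hm).inp
      ((Store.init.write 40 n).write 41 1) =
      ((Store.init.write 40 n).write 41 1).write 40 (n + 1) := rfl
  refine ⟨_, .seq (τ := Store.init.write 40 n) ?_ (.seq (τ := (Store.init.write 40 n).write 41 1)
    (.instr (a := .set 41 1) (by simp [Instr.Low]) h₁ h₂) ?_), h₃, ?_, ?_, ?_, ?_, rfl⟩
  · exact .instr (a := .read 40) (by simp [Instr.Low]) h₀ h₁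
  · rw [← e3]
    exact .instr (by simp [Instr.Low]) h₂ h₃
  · intro i hi
    have h40 : i ≠ 40 := by omega
    have h41 : i ≠ 41 := by omega
    simp [Store.write, Store.init, St.init, h40, h41]
  · exact fun _ _ => Nat.zero_le _
  · simp [Store.write]
    rfl
  · intro a _ b _
    have h40 : 64 + a * (env C m hm).cols + b ≠ 40 := by omega
    have h41 : 64 + a * (env C m hm).cols + b ≠ 41 := by omega
    simp [Store.write, Store.init, St.init, h40, h41]

theorem wp_readHeader :
    WP (env C m hm) readHeader (Abs C m ⟨true, T.root, 0, ∅, fun _ => 0⟩) St.init := by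
  have h64 := env_const_le C m hm
  have hmQ := env_m_le C m hm
  have htQ := env_t_lt C m hm
  obtain ⟨-, hsQ⟩ := env_s_le C m hm
  obtain ⟨-, hnQ⟩ := env_n_lt C m hm
  have hroot := T.root.2
  have hout := C.out.2
  refine WP.seq (WP.readAt (by norm_num) rfl (by simp) n rfl (by omega) ?_)
  refine WP.seq (WP.readAt (by norm_num) rfl (by simp) t rfl (by omega) ?_)
  refine WP.seq (WP.readAt (by norm_num) rfl (by simp) s rfl (by omega) ?_)
  refine WP.seq (WP.readAt (by norm_num) rfl (by simp) m rfl (by omega) ?_)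
  refine WP.seq (WP.readAt (by norm_num) rfl (by simp) (T.root : ℕ) rfl (by omega) ?_)
  refine WP.seq (WP.readAt (by norm_num) rfl (by simp) (C.out : ℕ) rfl (by omega) ?_)
  refine WP.seq (WP.asg (by norm_num) rfl (by simp) (by simp; omega) ?_)
  refine WP.seq (WP.asg (by norm_num) rfl (by simp) (by simp) ?_)
  refine WP.asg (by norm_num) rfl (by simp) (by simp; omega) ?_
  refine ⟨⟨⟨?_, ?_, ?_, ?_, ?_, ?_⟩, ?_, ?_⟩, ?_, ?_, ?_⟩
  all_goals try simp
  · simp [St.init]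
  · intro g j _
    simp [St.init]

/-- A run of the main loop that follows the steps of the traversal. -/
theorem exec_rounds {k : ℕ} {cfg fin : Circuit.Config n t s (ZMod m)} (hrun : fin.run = false)
    (hk : C.Steps k cfg fin) {σ : Store} {st : St} (hσ : Rep (env C m hm) σ st)
    (ha : Abs C m cfg st) :
    ∃ time space τ st', Exec (env C m hm).inp (.loop 9 round) σ time space τ ∧
      time ≤ (env C m hm).unit * (1 + k * (1 + round.steps (env C m hm).N)) ∧
      space ≤ (env C m hm).room ∧ Rep (env C m hm) τ st' ∧ Abs C m fin st' := by
  obtain ⟨time, space, τ, he, ht, hs, st', cfg', hτ, ha', hk'⟩ := exec_loop (E := env C m hm)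
    (i := 9) (p := round) (by norm_num)
    (J := fun j σ => ∃ st cfg, Rep (env C m hm) σ st ∧ Abs C m cfg st ∧ C.Steps j cfg fin)
    (fun j σ ⟨_, _, h, _⟩ => h.bounded)
    (fun σ ⟨st, cfg, h, ha, hk⟩ => by
      cases hk
      rw [h.var 9 (by norm_num), ha.run_eq, hrun]
      rfl)
    (fun j σ ⟨st, cfg, h, ha, hk⟩ => by
      cases hk with
      | head hstep hk =>
        obtain ⟨τ, st', h1, h2, h3⟩ := wp_round (hm := hm) hstep ha σ h
        refine ⟨?_, τ, h1, st', _, h2, h3, hk⟩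
        rw [h.var 9 (by norm_num), ha.run_eq]
        cases hstep <;> simp)
    k σ ⟨st, cfg, hσ, ha, hk⟩
  cases hk'
  exact ⟨time, space, τ, st', he, ht, hs, hτ, ha'⟩

/-- The output modulo `m` is the constant coefficient of the accumulator of the output gate. -/
theorem wp_output {k : ℕ} {acc : Fin s → (ZMod m)⟦X⟧} {st : St}
    (ha : Abs C m ⟨false, T.root, k, ∅, acc⟩ st) :
    WP (env C m hm) (asg 0 (.cell (3 + §3 + §6) 0)) (fun st' => st'.r 0 < m ∧
      (st'.r 0 : ZMod m) = coeff 0 (acc C.out)) st := by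
  have hrow : 3 + s + (C.out : ℕ) < (env C m hm).rows :=
    show 3 + s + (C.out : ℕ) < 3 + s + s by omega
  have hcol : 0 < (env C m hm).cols := show 0 < n + 1 by omega
  have hmQ := env_m_le C m hm
  refine WP.of_bounds fun _ hM => ?_
  have hlt : st.M (3 + s + C.out) 0 < m := hM _ hrow 0 hcol
  refine WP.asg (by norm_num) rfl ?_ ?_ ?_
  · simp [ha.s_eq, ha.out_eq, hrow, hcol]
  · simp [ha.s_eq, ha.out_eq]
    omega
  · have := ha.acc_eq C.out 0 (Nat.zero_le _)
    simpa [ha.s_eq, ha.out_eq] using And.intro hlt this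

/-- The body of the main loop together with the code around it.  This is not executed; its number of
steps bounds the number of steps of each part. -/
def parts : Prog :=
  .seq initCols <| .seq readHeader <| .seq round (asg 0 (.cell (3 + §3 + §6) 0))

/-- The loops inside a round are iterated at most polynomially often, and `reach_final` bounds the
number of rounds. -/
theorem exec_evaluator :
    ∃ time space τ, Exec (encodeInstance G T C m) evaluator Store.init time space τ ∧
      time ≤ (env C m hm).unit * (((t + 1) * t * 2 ^ T.branchSize + 1) *
        (1 + parts.steps (env C m hm).N)) ∧
      space ≤ (env C m hm).room ∧ τ.mem 0 < m ∧
      (τ.mem 0 : ZMod m) = (C.value C.out (T.bag T.root) : ZMod m) := by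
  obtain ⟨k, acc, ⟨j, hj, hsteps⟩, hval⟩ := C.reach_final (fun _ => (0 : (ZMod m)⟦X⟧))
  obtain ⟨σ₁, ⟨t₁, s₁, he₁, ht₁, hs₁⟩, hσ₁⟩ := run_initCols C hm
  obtain ⟨σ₂, st₂, ⟨t₂, s₂, he₂, ht₂, hs₂⟩, hσ₂, ha₂⟩ := wp_readHeader C hm σ₁ hσ₁
  obtain ⟨t₃, s₃, σ₃, st₃, he₃, ht₃, hs₃, hσ₃, ha₃⟩ := exec_rounds C hm rfl hsteps hσ₂ ha₂
  obtain ⟨σ₄, st₄, ⟨t₄, s₄, he₄, ht₄, hs₄⟩, hσ₄, hlt, hval₄⟩ := wp_output C hm ha₃ σ₃ hσ₃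
  refine ⟨_, _, σ₄, .seq he₁ (.seq he₂ (.seq he₃ he₄)), ?_, ?_, ?_, ?_⟩
  · set N := (env C m hm).N
    set K := (t + 1) * t * 2 ^ T.branchSize
    calc t₁ + (t₂ + (t₃ + t₄)) ≤ (env C m hm).unit * initCols.steps N +
          ((env C m hm).unit * readHeader.steps N +
          ((env C m hm).unit * (1 + j * (1 + round.steps N)) +
          (env C m hm).unit * (asg 0 (.cell (3 + §3 + §6) 0)).steps N)) := by omega
      _ = (env C m hm).unit * (initCols.steps N + readHeader.steps N +
          (1 + j * (1 + round.steps N)) + (asg 0 (.cell (3 + §3 + §6) 0)).steps N) := by ring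
      _ ≤ (env C m hm).unit * ((K + 1) * (1 + parts.steps N)) := by
        refine Nat.mul_le_mul_left _ ?_
        have h1 : j * (1 + round.steps N) ≤ K * (1 + parts.steps N) := by
          refine Nat.mul_le_mul hj ?_
          simp only [parts, Prog.steps]
          omega
        have h2 : initCols.steps N + readHeader.steps N +
            (asg 0 (.cell (3 + §3 + §6) 0)).steps N ≤ parts.steps N := by
          simp only [parts, Prog.steps]
          omega
        rw [add_mul]
        omega
  · exact max_le hs₁ (max_le hs₂ (max_le hs₃ hs₄))
  · rwa [hσ₄.var 0 (by norm_num)]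
  · rw [hσ₄.var 0 (by norm_num), hval₄, hval]

theorem size_le_self (a : ℕ) : Nat.size a ≤ a := Nat.size_le.2 Nat.lt_two_pow_self

theorem size_env_Q_le : Nat.size (env C m hm).Q ≤ 13 + 2 * s + n + Nat.size m := by
  have h1 := size_add_le (64 + (3 + s + s) * (n + 1)) m
  have h2 := size_add_le 64 ((3 + s + s) * (n + 1))
  have h3 := size_mul_le (3 + s + s) (n + 1)
  have h4 := size_le_self (3 + s + s)
  have h5 := size_le_self (n + 1)
  have h6 : Nat.size 64 ≤ 7 := Nat.size_le.2 (by norm_num)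
  have h7 : Nat.size (env C m hm).Q = Nat.size (64 + (3 + s + s) * (n + 1) + m) := rfl
  omega

theorem env_unit_le :
    (env C m hm).unit ≤ 800 * bitLength (encodeInstance G T C m) := by
  have h1 := size_env_Q_le C hm
  have h2 := length_le_bitLength (encodeInstance G T C m)
  have h3 := le_length_instance C m
  have h4 : Nat.size m ≤ bitLength (encodeInstance G T C m) :=
    size_le_bitLength (by simp [encodeInstance])
  have h5 : n ≤ n * n := Nat.le_mul_self n
  have h6 : s * (n + 6) = s * n + 6 * s := by ring
  have h7 := Nat.zero_le (s * n)
  have h8 := Nat.zero_le (t * n)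
  rw [Env.unit, Env.bits]
  omega

/-- The matrix has `3 + 2 s` rows of `n + 1` numbers below `m`, and the remaining registers hold
numbers of length `O(n + s + log m)`. -/
theorem env_room_le (hn : 0 < n) :
    ((env C m hm).room : ℝ) ≤ 80000 * ((n : ℝ) * s * Real.logb 2 m) := by
  have hs : 0 < s := C.out.pos
  have hl : 0 < Nat.size m := Nat.size_pos.2 (by omega)
  have h1 := size_env_Q_le C hm
  set l := Nat.size m with hldef
  have hroom : (env C m hm).room ≤ 40000 * (n * s * l) := by
    have e1 : 1 ≤ n * s := Nat.mul_pos hn hs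
    have e2 : n * s ≤ n * s * l := Nat.le_mul_of_pos_right _ hl
    have e3 : n ≤ n * s := Nat.le_mul_of_pos_right _ hs
    have e4 : s ≤ n * s := Nat.le_mul_of_pos_left _ hn
    have e5 : l ≤ n * s * l := Nat.le_mul_of_pos_left _ e1
    have e6 : (3 + s + s) * (n + 1) * (1 + l) ≤ (5 * s) * (2 * n) * (2 * l) := by
      gcongr <;> omega
    have e7 : (5 * s) * (2 * n) * (2 * l) = 20 * (n * s * l) := by ring
    have e8 : (env C m hm).room = 64 * (1 + 32 * (Nat.size (env C m hm).Q + 1)) +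
      (3 + s + s) * (n + 1) * (1 + l) := rfl
    omega
  have hlog : (l : ℝ) ≤ 2 * Real.logb 2 m := by
    have hm0 : (0 : ℝ) < m := by
      have : 0 < m := by omega
      exact_mod_cast this
    have h2 : (1 : ℝ) ≤ Real.logb 2 m := by
      rw [Real.le_logb_iff_rpow_le (by norm_num) hm0, Real.rpow_one]
      exact_mod_cast hm
    have h3 : ((l - 1 : ℕ) : ℝ) ≤ Real.logb 2 m := by
      rw [Real.le_logb_iff_rpow_le (by norm_num) hm0, Real.rpow_natCast]
      have : 2 ^ (l - 1) ≤ m := Nat.lt_size.1 (by omega)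
      exact_mod_cast this
    rw [Nat.cast_sub (by omega), Nat.cast_one] at h3
    linarith
  calc ((env C m hm).room : ℝ) ≤ 40000 * ((n : ℝ) * s * l) := by exact_mod_cast hroom
    _ ≤ 40000 * ((n : ℝ) * s * (2 * Real.logb 2 m)) := by gcongr
    _ = _ := by ring

end RAM

theorem theorem2 :
    ∃ (P : RAM.Prog) (a k : ℕ),
      ∀ (n : ℕ) (hn : 0 < n) (G : SimpleGraph (Fin n)) (t : ℕ) (T : TreeDecomp G t)
        (s : ℕ) (C : Circuit T s) (f : Finset (Fin n) → ℤ) (hf : C.Evaluates f)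
        (m : ℕ) (hm : 1 < m) (hf0 : 0 ≤ f Finset.univ) (hfm : f Finset.univ < (m : ℤ)),
        ∃ (time space : ℕ) (τ : RAM.Store),
          RAM.Exec (encodeInstance G T C m) P RAM.Store.init time space τ ∧
          (τ.mem 0 : ℤ) = f Finset.univ ∧
          time ≤ a * RAM.bitLength (encodeInstance G T C m) ^ k *
            ((n + G.edgeSet.ncard) * 2 ^ T.branchSize) ∧
          (space : ℝ) ≤ a * ((n : ℝ) * (s : ℝ) * Real.logb 2 (m : ℝ)) := by
  obtain ⟨c, d, hcd⟩ := RAM.parts.exists_steps_le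
  refine ⟨RAM.evaluator, 800 * (1 + c) + 80000, d + 3, ?_⟩
  intro n hn G t T s C f hf m hm hf0 hfm
  obtain ⟨time, space, τ, he, ht, hs, hlt, hval⟩ := RAM.exec_evaluator C hm
  refine ⟨time, space, τ, he, ?_, ?_, ?_⟩
  · have hfv : f Finset.univ = C.value C.out (T.bag T.root) := by
      rw [← hf _ (Finset.Subset.refl _), Finset.union_compl]
    rw [← hfv] at hval
    have h1 : ((τ.mem 0 : ℤ) : ZMod m) = ((f Finset.univ : ℤ) : ZMod m) := by
      rw [← hval]
      simp
    have h2 := (ZMod.intCast_eq_intCast_iff' _ _ m).1 h1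
    rwa [Int.emod_eq_of_lt (by positivity) (by exact_mod_cast hlt), Int.emod_eq_of_lt hf0 hfm] at h2
  · set L := RAM.bitLength (encodeInstance G T C m) with hL
    have hlen := (RAM.le_length_instance C m).trans (RAM.length_le_bitLength _)
    rw [← hL] at hlen
    have ht1 : t + 1 ≤ L := by
      have := Nat.zero_le (t * n)
      omega
    have hL0 : 0 < L := by omega
    have hsteps : 1 + RAM.parts.steps L ≤ (1 + c) * L ^ d := by
      have h1 := hcd L hL0
      have h2 : 1 ≤ L ^ d := Nat.one_le_pow _ _ hL0
      rw [add_mul, one_mul]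
      omega
    have hK : (t + 1) * t * 2 ^ T.branchSize + 1 ≤ L * L * 2 ^ T.branchSize := by
      have h2 : 1 ≤ 2 ^ T.branchSize := Nat.one_le_two_pow
      calc (t + 1) * t * 2 ^ T.branchSize + 1
          ≤ (t + 1) * t * 2 ^ T.branchSize + (t + 1) * 2 ^ T.branchSize := by
            have : 1 ≤ (t + 1) * 2 ^ T.branchSize := Nat.mul_pos (by omega) h2
            omega
        _ = (t + 1) * (t + 1) * 2 ^ T.branchSize := by ring
        _ ≤ L * L * 2 ^ T.branchSize := by gcongr
    calc time ≤ (800 * L) * ((L * L * 2 ^ T.branchSize) * ((1 + c) * L ^ d)) :=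
          ht.trans (Nat.mul_le_mul (RAM.env_unit_le C hm) (Nat.mul_le_mul hK hsteps))
      _ = 800 * (1 + c) * L ^ (d + 3) * (1 * 2 ^ T.branchSize) := by ring
      _ ≤ (800 * (1 + c) + 80000) * L ^ (d + 3) * ((n + G.edgeSet.ncard) * 2 ^ T.branchSize) := by
          gcongr
          · omega
          · omega
  · have h1 : (space : ℝ) ≤ ((RAM.env C m hm).room : ℝ) := by exact_mod_cast hs
    refine (h1.trans (RAM.env_room_le C hm hn)).trans ?_
    have h2 : 0 ≤ (n : ℝ) * s * Real.logb 2 m := by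
      have : 0 ≤ Real.logb 2 m := Real.logb_nonneg (by norm_num) (by exact_mod_cast hm.le)
      positivity
    refine mul_le_mul_of_nonneg_right ?_ h2
    push_cast
    have : (0 : ℝ) ≤ c := by positivity
    linarith
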